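/- **Types and terms.** Fix a set of base types. Simple types: $\sigma::=a\mid\sigma\to\sigma$ with $a$ a base type. EAL formulas: $A::=a\mid A\multimap A\mid\,!A$; the erasure $\overline A$ deletes every $!$ and turns $\multimap$ into $\to$. $\lambda$-terms $M::=x\mid\lambda x.M\mid(M\,N)$ are taken up to $\alpha$-equivalence. A basis $\Gamma$ is a finite set of declarations $x:A$ with distinct variables $x$. **EAL typing.** The sequent calculus of (implicational) Elementary Affine Logic, where comma denotes union of bases with disjoint domains, has the rules - (ax) $x:A\vdash x:A$; - (cut) from $\Gamma\vdash N:A$ and $x:A,\Delta\vdash M:B$ infer $\Gamma,\Delta\vdash M\{N/x\}:B$; - (weak) from $\Gamma\vdash M:B$ infer $\Gamma,x:A\vdash M:B$; - (contr) from $\Gamma,x_1:!A,x_2:!A\vdash M:B$ infer $\Gamma,z:!A\vdash M\{z/x_1,z/x_2\}:B$; - ($\multimap R$) from $\Gamma,x:A\vdash M:B$ infer $\Gamma\vdash\lambda x.M:A\multimap B$; - ($\multimap L$) from $\Gamma\vdash N:A$ and $x:B,\Delta\vdash M:C$ infer $\Gamma,f:A\multimap B,\Delta\vdash M\{(f\,N)/x\}:C$;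 - ($!$) from $x_1:A_1,\dots,x_n:A_n\vdash M:B$ infer $x_1:!A_1,\dots,x_n:!A_n\vdash M:!B$. The sharing graph of a derivation is its term with each (contr) recorded by an explicit fan node $[M]_{P=x_1,x_2}$, which faces $P$ and whose two other ports are $x_1,x_2$ in $M$: (contr) yields $[M]_{z=x_1,x_2}$, the substitutions in (cut) and ($\multimap L$) act on graphs, and $!$ leaves the graph unchanged. Unfolding all fans, $[M]_{P=x_1,x_2}\mapsto M\{P/x_1,P/x_2\}$, gives the term of the derivation. Write $\Gamma\vdash_{\mathsf{EAL}}M:A$ iff there is a derivation of $\Gamma\vdash M:A$ in whose sharing graph fans share only variables, i.e. no fan faces the root of a subgraph that is an application (or an abstraction): for every fan $[N]_{P=x_1,x_2}$ the unfolding of $P$ is a variable. **General types and constraints.** General EAL-types are $\Theta::=\,!^{n_1+\cdots+n_k}a\mid\,!^{n_1+\cdots+n_k}(\Theta\multimap\Theta)$, $k\ge0$, with variables $n_i$ ranging over $\mathbb N$; $!^{n}!^{m}\Theta$ is identified with $!^{n+m}\Theta$. Constraints are $\sum\pm n_i=0$ and $\sum n_i\ge1$. A base is a multiset of pairs (variable,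 general type), one for each free variable occurrence; $\mathrm{FVO}(M)$ is the list of free variable occurrences of $M$. A critical point is a pair (equation of the current system, list of free variable occurrences); a slice is a set of critical points. An equation keeps its identity when it is modified, and different occurrences of a variable are distinguished. $X(\cdot)$ denotes instantiation by $X$. **Auxiliary functions** (all $p,b,c,n$ introduced are fresh). - $\mathcal P(a)=!^pa$, $\mathcal P(\sigma\to\tau)=!^p(\mathcal P(\sigma)\multimap\mathcal P(\tau))$. - $\mathcal U(\Theta_1,\dots,\Theta_h)$, for $h\ge2$ types with the same erasure: the equations $e_i-e_{i+1}=0$ ($1\le i<h$) between consecutive outermost exponents, followed, for types $!^{e_i}(\Theta_i'\multimap\Theta_i'')$, by $\mathcal U(\Theta_1',\dots,\Theta_h')$ and $\mathcal U(\Theta_1'',\dots,\Theta_h'')$. - $\mathcal C(\Theta)=\emptyset$; for $h\ge2$, $\mathcal C(\Theta_1,\dots,\Theta_h)=\{e_1\ge1\}\cup\mathcal U(\Theta_1,\dots,\Theta_h)$ with $e_1$ the outermost exponent of $\Theta_1$. - $\mathbb B(M,B,\Gamma,cpts,A)$: if $M$ is a variable, $\langle B,\Gamma,A\rangle$. Otherwise,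 for each slice $sl\in cpts$ in turn take a fresh $c$, replace $\Gamma$ by $!^c\Gamma$, put $!^c$ in front of the type of each occurrence in $B$ that is in no list of $sl$, and subtract $c$ from the left side of each equation of $A$ that is in $sl$; finally put $!^b$ in front of $\Gamma$ and of all types in $B$. - $cpts_1\Cup cpts_2=cpts_1\cup cpts_2\cup\{sl_1\cup sl_2: sl_i\in cpts_i\}$. **Synthesis.** $S$ works on a simple type derivation of $M:\sigma$ (the syntax tree of $M$ decorated with simple types) and returns $\langle$type, base, constraints, set of slices$\rangle$. - $S(x:\sigma)=\langle\Theta,\{x:\Theta\},\emptyset,\emptyset\rangle$ with $\Theta=\mathcal P(\sigma)$. - $S(\lambda x.M:\sigma\to\tau)$: let $S(M:\tau)=\langle\Gamma_1,B_1,A_1,cpts\rangle$ and $\mathbb B(M,B_1,\Gamma_1,cpts,A_1)=\langle B',\Gamma,A_2\rangle$. If $x$ occurs free in $M$, and $\Theta_1,\dots,\Theta_h$ are its types in $B'$ and $B$ is the rest of $B'$: $\langle\Theta_1\multimap\Gamma,\,B,\,A_2\cup\mathcal C(\Theta_1,\dots,\Theta_h),\,cpts'\rangle$, where $cpts'$ consists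 of the slices of $cpts$ none of whose lists contains an occurrence of $x$. If $x$ does not occur and $M$ is an application, and $\Gamma=!^{e}\Gamma'$ with outermost exponent $e$: $\langle\mathcal P(\sigma)\multimap!^n\Gamma',\,B',\,A_2\cup\{e-n=0\},\,cpts\cup\{\{(e-n=0,\mathrm{FVO}(M))\}\}\rangle$. If $x$ does not occur and $M$ is not an application: $\langle\mathcal P(\sigma)\multimap\Gamma,B',A_2,cpts\rangle$. - $S((M\,N):\tau)$: let $S(M:\sigma\to\tau)=\langle!^{e}(\Theta_1\multimap\Gamma),B_1,A_1,cpts_1\rangle$, $S(N:\sigma)=\langle\Theta_2,B_2,A_2,cpts_2\rangle$, $\mathbb B(N,B_2,\Theta_2,cpts_2,A_2)=\langle B_3,\Theta_3,A_3\rangle$, and $A_4=\mathcal U(\Theta_3,\Theta_1)$ if $N$ is an application, $A_4=\mathcal U(\Theta_1,\Theta_3)$ otherwise. If $M$ is an application add the slice $\{(e=0,\mathrm{FVO}(M))\}$ to $cpts_1$; if $N$ is an application add the slice $\{(A_4^1,\mathrm{FVO}(N))\}$ to $cpts_2$, where $A_4^1$ is the first equation of $A_4$. The result is $\langle\Gamma,B_1\cup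 B_3,A_1\cup A_3\cup A_4\cup\{e=0\},cpts_1\Cup cpts_2\rangle$. - The algorithm $\mathcal S(M:\sigma)$: let $S(M:\sigma)=\langle\Theta_1,B_1,A',cpts\rangle$ and $\mathbb B(M,B_1,\Theta_1,cpts,A')=\langle B_2,\Theta,A_0\rangle$. For each free variable $x_j$ of $M$ let $\Theta_{1_j},\dots,\Theta_{k_j}$ be its types in $B_2$. Then $\mathcal S(M:\sigma)=\langle\Theta,\ \{x_j:\Theta_{1_j}\}_j,\ A_0\cup\bigcup_j\mathcal C(\Theta_{1_j},\dots,\Theta_{k_j})\rangle$. **Theorem (Main theorem).** Let $M$ be a simply typeable $\lambda$-term. For every basis $\Gamma$ and EAL formula $C$: $\Gamma\vdash_{\mathsf{EAL}}M:C$ if and only if, for some simple type derivation of $M:\overline C$, the algorithm yields $\mathcal S(M:\overline C)=\langle\Theta,B,A\rangle$ where $A$ admits an integral solution $X$ (with values in $\mathbb N$) such that $X(B)\subseteq\Gamma$ and $C=X(\Theta)$. -/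

import Mathlib

namespace EAL

/-! ### Simple types, EAL formulas, type-free λ-terms -/

/-- Simple types over a set `ι` of base types. -/
inductive STy (ι : Type*) : Type _
  | atom (a : ι) : STy ι
  | arr (σ τ : STy ι) : STy ι

/-- Formulas of implicational Elementary Affine Logic. -/
inductive Formula (ι : Type*) : Type _
  | atom (a : ι) : Formula ι
  | lolli (A B : Formula ι) : Formula ι
  | bang (A : Formula ι) : Formula ι

/-- The erasure: forget every `!` and turn `⊸` into `→`. -/
def Formula.erase {ι : Type*} : Formula ι → STy ι
  | .atom a => .atom a
  | .lolli A B => .arr A.erase B.erase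
  | .bang A => A.erase

/-- Type-free λ-terms up to α-equivalence, in de Bruijn notation: `lam` binds the index `0`.
An index that points beyond all enclosing binders is a free variable. -/
inductive Term : Type
  | var (x : ℕ) : Term
  | lam (M : Term) : Term
  | app (M N : Term) : Term

def Term.isApp : Term → Bool
  | .app _ _ => true
  | _ => false

def Term.isVar : Term → Bool
  | .var _ => true
  | _ => false

/-- A renaming of free variables, pushed under one binder. -/
def liftRen (ρ : ℕ → ℕ) : ℕ → ℕ
  | 0 => 0
  | x + 1 => ρ x + 1

def Term.rename : Term → (ℕ → ℕ) → Term
  | .var x, ρ => .var (ρ x)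
  | .lam M, ρ => .lam (M.rename (liftRen ρ))
  | .app M N, ρ => .app (M.rename ρ) (N.rename ρ)

/-- A simultaneous substitution, pushed under one binder. -/
def Term.liftSub (s : ℕ → Term) : ℕ → Term
  | 0 => .var 0
  | x + 1 => (s x).rename Nat.succ

/-- Simultaneous capture-avoiding substitution. -/
def Term.subst : Term → (ℕ → Term) → Term
  | .var x, s => s x
  | .lam M, s => .lam (M.subst (Term.liftSub s))
  | .app M N, s => .app (M.subst s) (N.subst s)

/-! ### Sharing graphs

A sharing graph is written as a λ-term with explicit fan nodes: `share P N` is the graph `N`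
(in which the indices `0` and `1` are bound) where the two auxiliary ports of a fan are connected
to the variables `0` and `1` of `N`, and its principal port faces the root of `P`. -/

inductive Graph : Type
  | var (x : ℕ) : Graph
  | lam (G : Graph) : Graph
  | app (G H : Graph) : Graph
  | share (P N : Graph) : Graph

def Graph.rename : Graph → (ℕ → ℕ) → Graph
  | .var x, ρ => .var (ρ x)
  | .lam G, ρ => .lam (G.rename (liftRen ρ))
  | .app G H, ρ => .app (G.rename ρ) (H.rename ρ)
  | .share P N, ρ => .share (P.rename ρ) (N.rename (liftRen (liftRen ρ)))

def Graph.liftSub (s : ℕ → Graph) : ℕ → Graph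
  | 0 => .var 0
  | x + 1 => (s x).rename Nat.succ

def Graph.subst : Graph → (ℕ → Graph) → Graph
  | .var x, s => s x
  | .lam G, s => .lam (G.subst (Graph.liftSub s))
  | .app G H, s => .app (G.subst s) (H.subst s)
  | .share P N, s => .share (P.subst s) (N.subst (Graph.liftSub (Graph.liftSub s)))

/-- `H.plug G` is `H{G/x}` where `x` is the variable with index `0`; the other free variables
of `H` are renumbered accordingly. -/
def Graph.plug (H G : Graph) : Graph :=
  H.subst fun
    | 0 => G
    | x + 1 => .var x

/-- The λ-term that a sharing graph represents: every fan is unfolded. -/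
def Graph.readback : Graph → Term
  | .var x => .var x
  | .lam G => .lam G.readback
  | .app G H => .app G.readback H.readback
  | .share P N => N.readback.subst fun
      | 0 => P.readback
      | 1 => P.readback
      | x + 2 => .var x

/-- Fans share only variables: no fan faces (the root of) a subgraph which is an application or
an abstraction. -/
def Graph.SharesOnlyVariables : Graph → Prop
  | .var _ => True
  | .lam G => G.SharesOnlyVariables
  | .app G H => G.SharesOnlyVariables ∧ H.SharesOnlyVariables
  | .share P N =>
      (∃ x, P.readback = .var x) ∧ P.SharesOnlyVariables ∧ N.SharesOnlyVariables

/-! ### Sequent derivations of EAL -/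

/-- Contexts assign a formula to some of the free variables; a variable occurs at most once.
A basis is a context with finite domain. -/
abbrev Ctx (ι : Type*) : Type _ := ℕ → Option (Formula ι)

def Ctx.dom {ι : Type*} (Γ : Ctx ι) : Set ℕ := {x | Γ x ≠ none}

/-- The context `x : A`. -/
def Ctx.single {ι : Type*} (x : ℕ) (A : Formula ι) : Ctx ι :=
  Function.update (fun _ => none) x (some A)

/-- The context `Γ, x : A`. -/
def Ctx.add {ι : Type*} (Γ : Ctx ι) (x : ℕ) (A : Formula ι) : Ctx ι :=
  Function.update Γ x (some A)

/-- The context `Γ, Δ`; used only for contexts with disjoint domains. -/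
def Ctx.union {ι : Type*} (Γ Δ : Ctx ι) : Ctx ι := fun x => (Γ x).or (Δ x)

/-- The context under a binder: the bound variable has index `0` and type `A`. -/
def Ctx.cons {ι : Type*} (A : Formula ι) (Γ : Ctx ι) : Ctx ι
  | 0 => some A
  | x + 1 => Γ x

/-- The context `!Γ`. -/
def Ctx.bang {ι : Type*} (Γ : Ctx ι) : Ctx ι := fun x => (Γ x).map Formula.bang

/-- `Derives Γ G A`: there is a derivation of `Γ ⊢ M : A` in the sequent calculus of EAL whose
sharing graph is `G` (and hence whose term `M` is `G.readback`). -/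
inductive Derives {ι : Type*} : Ctx ι → Graph → Formula ι → Prop
  | ax (x : ℕ) (A : Formula ι) : Derives (Ctx.single x A) (.var x) A
  | cut {Γ Δ : Ctx ι} {G H : Graph} {A B : Formula ι} :
      Disjoint Γ.dom Δ.dom → Derives Γ G A → Derives (Ctx.cons A Δ) H B →
      Derives (Γ.union Δ) (H.plug G) B
  | weak {Γ : Ctx ι} {G : Graph} {B : Formula ι} (x : ℕ) (A : Formula ι) :
      x ∉ Γ.dom → Derives Γ G B → Derives (Γ.add x A) G B
  | contr {Γ : Ctx ι} {G : Graph} {A B : Formula ι} (z : ℕ) :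
      z ∉ Γ.dom → Derives (Ctx.cons A.bang (Ctx.cons A.bang Γ)) G B →
      Derives (Γ.add z A.bang) (.share (.var z) G) B
  | lolliR {Γ : Ctx ι} {G : Graph} {A B : Formula ι} :
      Derives (Ctx.cons A Γ) G B → Derives Γ (.lam G) (.lolli A B)
  | lolliL {Γ Δ : Ctx ι} {G H : Graph} {A B C : Formula ι} (f : ℕ) :
      Disjoint Γ.dom Δ.dom → f ∉ Γ.dom → f ∉ Δ.dom →
      Derives Γ G A → Derives (Ctx.cons B Δ) H C →
      Derives ((Γ.union Δ).add f (.lolli A B)) (H.plug (.app (.var f) G)) C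
  | bang {Γ : Ctx ι} {G : Graph} {B : Formula ι} :
      Derives Γ G B → Derives Γ.bang G B.bang

/-- `Γ ⊢_EAL M : A`: some derivation of `Γ ⊢ M : A` has a sharing graph in which the fans share
only variables. -/
def Typing {ι : Type*} (Γ : Ctx ι) (M : Term) (A : Formula ι) : Prop :=
  ∃ G : Graph, Derives Γ G A ∧ G.readback = M ∧ G.SharesOnlyVariables

/-! ### Simple type derivations -/

/-- The simple type environment under a binder. -/
def envCons {ι : Type*} (σ : STy ι) (E : ℕ → STy ι) : ℕ → STy ι
  | 0 => σ
  | x + 1 => E x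

/-- Natural deduction derivations of `E ⊢ M : σ`, i.e. syntax trees of `M` decorated with simple
types. -/
inductive SDer {ι : Type*} : (ℕ → STy ι) → Term → STy ι → Type _
  | var (E : ℕ → STy ι) (x : ℕ) : SDer E (.var x) (E x)
  | lam {E : ℕ → STy ι} {M : Term} {σ τ : STy ι} :
      SDer (envCons σ E) M τ → SDer E (.lam M) (.arr σ τ)
  | app {E : ℕ → STy ι} {M N : Term} {σ τ : STy ι} :
      SDer E M (.arr σ τ) → SDer E N σ → SDer E (.app M N) τ

/-- `M` is simply typeable (over the base types `ι`). -/
def SimplyTypeable (ι : Type*) (M : Term) : Prop :=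
  ∃ (E : ℕ → STy ι) (σ : STy ι), Nonempty (SDer E M σ)

/-! ### General EAL-types and linear constraints

Integer variables are natural numbers; a list of variables stands for their sum. -/

/-- General EAL-types with erasure `σ`: `!^{n₁+⋯+n_k} a` or `!^{n₁+⋯+n_k} (Θ ⊸ Γ)`. -/
inductive GTy {ι : Type*} : STy ι → Type _
  | atom (ns : List ℕ) (a : ι) : GTy (.atom a)
  | lolli {σ τ : STy ι} (ns : List ℕ) (Θ : GTy σ) (Γ : GTy τ) : GTy (.arr σ τ)

namespace GTy

variable {ι : Type*} {σ τ : STy ι}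

/-- The outermost exponent. -/
def outer : {σ : STy ι} → GTy σ → List ℕ
  | _, .atom ns _ => ns
  | _, .lolli ns _ _ => ns

/-- Replace the outermost exponent. -/
def setOuter (ms : List ℕ) : {σ : STy ι} → GTy σ → GTy σ
  | _, .atom _ a => .atom ms a
  | _, .lolli _ Θ Γ => .lolli ms Θ Γ

/-- `!^c Θ`, identified with the general EAL-type that has `c` added to the outer exponent. -/
def bang (c : ℕ) (Θ : GTy σ) : GTy σ := Θ.setOuter (c :: Θ.outer)

def dom : GTy (.arr σ τ) → GTy σ
  | .lolli _ Θ _ => Θ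

def cod : GTy (.arr σ τ) → GTy τ
  | .lolli _ _ Γ => Γ

/-- The instantiation `X(Θ)`. -/
def inst (X : ℕ → ℕ) : {σ : STy ι} → GTy σ → Formula ι
  | _, .atom ns a => Formula.bang^[(ns.map X).sum] (.atom a)
  | _, .lolli ns Θ Γ => Formula.bang^[(ns.map X).sum] (.lolli (Θ.inst X) (Γ.inst X))

end GTy

/-- Linear constraints: `∑ pos - ∑ neg = 0` and `∑ ns ≥ 1`. -/
inductive Constraint : Type
  | eq (pos neg : List ℕ) : Constraint
  | ge (ns : List ℕ) : Constraint

def Constraint.Holds (X : ℕ → ℕ) : Constraint → Prop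
  | .eq pos neg => ((pos.map X).sum : ℤ) - ((neg.map X).sum : ℤ) = 0
  | .ge ns => 1 ≤ (ns.map X).sum

/-- The constraint `A - c`, for an equation `A`. -/
def Constraint.sub (c : ℕ) : Constraint → Constraint
  | .eq pos neg => .eq pos (neg ++ [c])
  | .ge ns => .ge ns

/-- A row of the constraint matrix. The number `id` is the identity of the row: it does not change
when the boxing function modifies the constraint in this row. -/
structure Row : Type where
  id : ℕ
  lin : Constraint

/-- Number new rows consecutively, from `n` on. -/
def newRows (n : ℕ) (cs : List Constraint) : List Row :=
  cs.mapIdx fun i c => ⟨n + i, c⟩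

/-- A slice: a list of critical points. A critical point is a pair of (the identity of) a row and
a list of free variable occurrences. -/
abbrev Slice : Type := List (ℕ × List ℕ)

/-- The row with identity `i` belongs to the slice. -/
def Slice.hasRow (sl : Slice) (i : ℕ) : Bool := sl.any fun p => p.1 == i

/-- The variable occurrence `o` belongs to the slice. -/
def Slice.hasOcc (sl : Slice) (o : ℕ) : Bool := sl.any fun p => p.2.contains o

/-- An entry of a base: a variable, the identity of one of its occurrences, and the general
EAL-type of this occurrence. -/
structure Entry {ι : Type*} (E : ℕ → STy ι) : Type _ where
  var : ℕ
  occ : ℕ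
  ty : GTy (E var)

def Entry.bang {ι : Type*} {E : ℕ → STy ι} (c : ℕ) (e : Entry E) : Entry E :=
  ⟨e.var, e.occ, e.ty.bang c⟩

/-! ### The functions of the algorithm

Every function that needs fresh integer variables, row identities or occurrence identities takes
the first unused number `n`, and returns the next unused one. -/

/-- Type processing `𝒫`. -/
def process {ι : Type*} : (σ : STy ι) → ℕ → GTy σ × ℕ
  | .atom a, n => (.atom [n] a, n + 1)
  | .arr σ τ, n =>
      let Θ := process σ (n + 1)
      let Γ := process τ Θ.2
      (.lolli [n] Θ.1 Γ.1, Γ.2)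

/-- Equations between consecutive exponents. -/
def chain : List (List ℕ) → List Constraint
  | a :: b :: l => .eq a b :: chain (b :: l)
  | _ => []

/-- Unification `𝒰` of general EAL-types with the same erasure. -/
def unify {ι : Type*} : (σ : STy ι) → List (GTy σ) → List Constraint
  | .atom _, l => chain (l.map GTy.outer)
  | .arr σ τ, l =>
      chain (l.map GTy.outer) ++ unify σ (l.map GTy.dom) ++ unify τ (l.map GTy.cod)

/-- Contraction `𝒞`. -/
def contraction {ι : Type*} {σ : STy ι} : List (GTy σ) → List Constraint
  | Θ₁ :: Θ₂ :: l => .ge Θ₁.outer :: unify σ (Θ₁ :: Θ₂ :: l)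
  | _ => []

/-- The result `⟨base, type, constraints⟩` of boxing, and the next unused number. -/
structure Boxed {ι : Type*} (E : ℕ → STy ι) (σ : STy ι) : Type _ where
  base : List (Entry E)
  ty : GTy σ
  rows : List Row
  next : ℕ

/-- Boxing through the critical points. -/
def boxSlices {ι : Type*} {E : ℕ → STy ι} {σ : STy ι} :
    List (Entry E) → GTy σ → List Slice → List Row → ℕ → Boxed E σ
  | B, Γ, [], A, n => ⟨B, Γ, A, n⟩
  | B, Γ, sl :: cpts, A, n =>
      boxSlices
        (B.map fun e => if sl.hasOcc e.occ then e else e.bang n)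
        (Γ.bang n) cpts
        (A.map fun r => if sl.hasRow r.id then ⟨r.id, r.lin.sub n⟩ else r)
        (n + 1)

/-- Boxing `𝔹`: nothing for a variable; otherwise box through the critical points and then add
`b` boxes around the term. -/
def box {ι : Type*} {E : ℕ → STy ι} {σ : STy ι} (M : Term) (B : List (Entry E)) (Γ : GTy σ)
    (cpts : List Slice) (A : List Row) (n : ℕ) : Boxed E σ :=
  if M.isVar then ⟨B, Γ, A, n⟩
  else
    let r := boxSlices B Γ cpts A n
    ⟨r.base.map (Entry.bang r.next), r.ty.bang r.next, r.rows, r.next + 1⟩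

/-- Product union of sets of slices. -/
def productUnion : List Slice → List Slice → List Slice
  | [], cpts => cpts
  | sl :: cpts₁, cpts₂ => (sl :: cpts₂.map fun sl₂ => sl ++ sl₂) ++ productUnion cpts₁ cpts₂

/-- The result `⟨type, base, constraints, critical points⟩` of type synthesis, and the next unused
number. -/
structure Synth {ι : Type*} (E : ℕ → STy ι) (σ : STy ι) : Type _ where
  ty : GTy σ
  base : List (Entry E)
  rows : List Row
  cpts : List Slice
  next : ℕ

/-- The list of free variable occurrences of the term for which the base was synthesized. -/
def occurrences {ι : Type*} {E : ℕ → STy ι} (B : List (Entry E)) : List ℕ := B.map Entry.occ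

/-- The types of the occurrences of the variable that is being abstracted. -/
def boundTypes {ι : Type*} {E : ℕ → STy ι} {σ : STy ι} (B : List (Entry (envCons σ E))) :
    List (GTy σ) :=
  B.filterMap fun
    | ⟨0, _, Θ⟩ => some Θ
    | ⟨_ + 1, _, _⟩ => none

/-- The occurrences of the variable that is being abstracted. -/
def boundOccs {ι : Type*} {E : ℕ → STy ι} {σ : STy ι} (B : List (Entry (envCons σ E))) :
    List ℕ :=
  B.filterMap fun
    | ⟨0, o, _⟩ => some o
    | ⟨_ + 1, _, _⟩ => none

/-- The rest of the base, with variables renumbered for the context outside the abstraction. -/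
def unbound {ι : Type*} {E : ℕ → STy ι} {σ : STy ι} (B : List (Entry (envCons σ E))) :
    List (Entry E) :=
  B.filterMap fun
    | ⟨0, _, _⟩ => none
    | ⟨x + 1, o, Θ⟩ => some ⟨x, o, Θ⟩

/-- Variable case of type synthesis. -/
def synthVar {ι : Type*} (E : ℕ → STy ι) (x n : ℕ) : Synth E (E x) :=
  let Θ := process (E x) n
  ⟨Θ.1, [⟨x, Θ.2, Θ.1⟩], [], [], Θ.2 + 1⟩

/-- Abstraction cases of type synthesis: `M` is the body and `r` the result for the body. -/
def synthLam {ι : Type*} {E : ℕ → STy ι} {σ τ : STy ι} (M : Term)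
    (r : Synth (envCons σ E) τ) : Synth E (.arr σ τ) :=
  let bx := box M r.base r.ty r.cpts r.rows r.next
  match boundTypes bx.base with
  | Θ₁ :: Θs =>
      -- the abstracted variable occurs in the body
      let A₃ := contraction (Θ₁ :: Θs)
      ⟨.lolli [] Θ₁ bx.ty, unbound bx.base, bx.rows ++ newRows bx.next A₃,
        r.cpts.filter (fun sl => !(boundOccs bx.base).any sl.hasOcc),
        bx.next + A₃.length⟩
  | [] =>
      let Θ := process σ bx.next
      if M.isApp then
        -- `Θ.2` is the fresh integer variable, `Θ.2 + 1` the identity of the new row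
        ⟨.lolli [] Θ.1 (bx.ty.setOuter [Θ.2]), unbound bx.base,
          bx.rows ++ [⟨Θ.2 + 1, .eq bx.ty.outer [Θ.2]⟩],
          r.cpts ++ [[(Θ.2 + 1, occurrences bx.base)]],
          Θ.2 + 2⟩
      else
        ⟨.lolli [] Θ.1 bx.ty, unbound bx.base, bx.rows, r.cpts, Θ.2⟩

/-- Application cases of type synthesis, for `M N`: `r₁` is the result for `M` and `r₂` the result
for `N`, which uses numbers not used by `r₁`. -/
def synthApp {ι : Type*} {E : ℕ → STy ι} {σ τ : STy ι} (M N : Term)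
    (r₁ : Synth E (.arr σ τ)) (r₂ : Synth E σ) : Synth E τ :=
  let bx := box N r₂.base r₂.ty r₂.cpts r₂.rows r₂.next
  let A₄ := if N.isApp then unify σ [bx.ty, r₁.ty.dom] else unify σ [r₁.ty.dom, bx.ty]
  -- the first row of `A₄`, between the outermost exponents, has the identity `bx.next`
  let k := bx.next + A₄.length
  let cpts₁ := if M.isApp then r₁.cpts ++ [[(k, occurrences r₁.base)]] else r₁.cpts
  let cpts₂ := if N.isApp then r₂.cpts ++ [[(bx.next, occurrences r₂.base)]] else r₂.cpts
  ⟨r₁.ty.cod, r₁.base ++ bx.base,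
    r₁.rows ++ bx.rows ++ newRows bx.next A₄ ++ [⟨k, .eq r₁.ty.outer []⟩],
    productUnion cpts₁ cpts₂, k + 1⟩

/-- Type synthesis on a simple type derivation. -/
def synth {ι : Type*} : {E : ℕ → STy ι} → {M : Term} → {σ : STy ι} → SDer E M σ → ℕ → Synth E σ
  | _, _, _, .var E x, n => synthVar E x n
  | _, .lam M, _, .lam d, n => synthLam M (synth d n)
  | _, .app M N, _, .app d₁ d₂, n =>
      let r₁ := synth d₁ n
      synthApp M N r₁ (synth d₂ r₁.next)

/-- The types of the occurrences of the free variable `x` in a base. -/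
def typesOf {ι : Type*} {E : ℕ → STy ι} (B : List (Entry E)) (x : ℕ) : List (GTy (E x)) :=
  B.filterMap fun e => if h : e.var = x then some (h ▸ e.ty) else none

/-- The result `⟨Θ, B, A⟩` of the type synthesis algorithm. -/
structure Result {ι : Type*} (E : ℕ → STy ι) (σ : STy ι) : Type _ where
  ty : GTy σ
  base : List ((x : ℕ) × GTy (E x))
  constraints : List Constraint

/-- The type synthesis algorithm: synthesize, box, forget the critical points, and contract the
occurrences of every free variable, keeping the type of the first one. -/
def algorithm {ι : Type*} {E : ℕ → STy ι} {M : Term} {σ : STy ι} (d : SDer E M σ) : Result E σ :=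
  let r := synth d 0
  let bx := box M r.base r.ty r.cpts r.rows r.next
  let vars := (bx.base.map Entry.var).dedup
  { ty := bx.ty
    base := vars.flatMap fun x => ((typesOf bx.base x).take 1).map fun Θ => ⟨x, Θ⟩
    constraints := bx.rows.map Row.lin ++ vars.flatMap fun x => contraction (typesOf bx.base x) }

/-- `X` solves all constraints; its values are natural numbers. -/
def Solves (X : ℕ → ℕ) (A : List Constraint) : Prop := ∀ c ∈ A, c.Holds X

/-- `X(B) ⊆ Γ`. -/
def InstSubset {ι : Type*} {E : ℕ → STy ι} (X : ℕ → ℕ) (B : List ((x : ℕ) × GTy (E x)))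
    (Γ : Ctx ι) : Prop :=
  ∀ p ∈ B, Γ p.1 = some (p.2.inst X)

end EAL

/-!
On the syntax tree of its term, an EAL derivation puts a number of `!`-boxes around every node. When
all types are read outside the boxes, only three conditions on a simple typing remain: a type at
level `d` starts with `d` modalities, a box around a binder is around all occurrences of the bound
variable, and a variable that occurs twice has a type `!A`. Such a *leveled typing* can be read off
a derivation because fans that face variables only share occurrences of variables, so that no
subterm with boxes of its own is shared. Conversely, an outermost box of a leveled typing can be
opened by the rule for `!` once the applications that it leaves outside have been cut out.

Type synthesis parametrizes the leveled typings. A slice is the inner boundary of a box around a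
term: its critical points are the applications which that box leaves outside, given by the equation
and the variable occurrences that the box does not reach. The unknown of the slice counts the boxes
with this boundary, and an equation from which these unknowns are subtracted compares the numbers of
boxes on both sides of an edge of the syntax tree.
-/

namespace EAL

/-! ### Variable sequences and occurrence lists -/

/-- The sequence `a, f 0, f 1, …`: the assignment `f` seen under a binder whose variable is
assigned `a`. -/
def scons {α : Type*} (a : α) (f : ℕ → α) : ℕ → α
  | 0 => a
  | x + 1 => f x

theorem scons_comp_liftRen {α : Type*} (a : α) (f : ℕ → α) (ρ : ℕ → ℕ) :
    (fun x => scons a f (liftRen ρ x)) = scons a fun x => f (ρ x) := by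
  funext x; cases x <;> rfl

/-- The occurrences, seen from outside a binder, of the variables that it does not bind. -/
def lower (l : List ℕ) : List ℕ := l.filterMap Nat.ppred

theorem lower_append (l l' : List ℕ) : lower (l ++ l') = lower l ++ lower l' :=
  List.filterMap_append

theorem count_lower (l : List ℕ) (x : ℕ) : (lower l).count x = l.count (x + 1) := by
  rw [lower, List.count_filterMap, List.count]
  congr 1; funext a; cases a <;> simp

theorem mem_lower {l : List ℕ} {x : ℕ} : x ∈ lower l ↔ x + 1 ∈ l := by
  rw [← List.count_pos_iff, count_lower, List.count_pos_iff]

theorem lower_map_succ (l : List ℕ) : lower (l.map Nat.succ) = l := by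
  rw [lower, List.filterMap_map]; exact List.filterMap_some

theorem lower_flatMap (l : List ℕ) {f g : ℕ → List ℕ} (hzero : lower (f 0) = [])
    (hsucc : ∀ x, lower (f (x + 1)) = g x) : lower (l.flatMap f) = (lower l).flatMap g := by
  induction l with
  | nil => rfl
  | cons a l ih =>
    rw [List.flatMap_cons, lower_append, ih]
    cases a with
    | zero => rw [hzero]; rfl
    | succ a => rw [hsucc]; rfl

theorem lower_map_liftRen (l : List ℕ) (ρ : ℕ → ℕ) :
    lower (l.map (liftRen ρ)) = (lower l).map ρ := by
  simp only [List.map_eq_flatMap]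
  exact lower_flatMap l rfl fun _ => rfl

theorem forall_mem_of_scons {l : List ℕ} {p : ℕ → Prop} (hzero : p 0)
    (hsucc : ∀ x ∈ lower l, p (x + 1)) : ∀ x ∈ l, p x
  | 0, _ => hzero
  | x + 1, hx => hsucc x (mem_lower.2 hx)

/-! ### Terms -/

namespace Term

/-- The list of free variable occurrences, from left to right. -/
def fvs : Term → List ℕ
  | .var x => [x]
  | .lam M => lower M.fvs
  | .app M N => M.fvs ++ N.fvs

theorem liftSub_var_comp (ρ : ℕ → ℕ) :
    liftSub (fun x => .var (ρ x)) = fun x => .var (liftRen ρ x) := by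
  funext x; cases x <;> rfl

theorem liftSub_var : liftSub .var = .var := by
  funext x; cases x <;> rfl

theorem rename_eq_subst (M : Term) (ρ : ℕ → ℕ) : M.rename ρ = M.subst fun x => .var (ρ x) := by
  induction M generalizing ρ with
  | var x => rfl
  | lam M ih => simp only [rename, subst, ih, liftSub_var_comp]
  | app M N ihM ihN => simp only [rename, subst, ihM, ihN]

theorem subst_rename (M : Term) (ρ : ℕ → ℕ) (s : ℕ → Term) :
    (M.rename ρ).subst s = M.subst fun x => s (ρ x) := by
  induction M generalizing ρ s with
  | var x => rfl
  | lam M ih =>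
    simp only [rename, subst, ih]
    congr 2; funext x; cases x <;> rfl
  | app M N ihM ihN => simp only [rename, subst, ihM, ihN]

theorem rename_rename (M : Term) (ρ ρ' : ℕ → ℕ) :
    (M.rename ρ).rename ρ' = M.rename fun x => ρ' (ρ x) := by
  rw [rename_eq_subst, subst_rename, rename_eq_subst]

theorem rename_subst (M : Term) (s : ℕ → Term) (ρ : ℕ → ℕ) :
    (M.subst s).rename ρ = M.subst fun x => (s x).rename ρ := by
  induction M generalizing ρ s with
  | var x => rfl
  | lam M ih =>
    simp only [rename, subst, ih]
    congr 2; funext x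
    cases x with
    | zero => rfl
    | succ x => simp only [liftSub, rename_rename]; rfl
  | app M N ihM ihN => simp only [rename, subst, ihM, ihN]

theorem subst_subst (M : Term) (s t : ℕ → Term) :
    (M.subst s).subst t = M.subst fun x => (s x).subst t := by
  induction M generalizing s t with
  | var x => rfl
  | lam M ih =>
    simp only [subst, ih]
    congr 2; funext x
    cases x with
    | zero => rfl
    | succ x => simp only [liftSub, subst_rename, rename_subst]
  | app M N ihM ihN => simp only [subst, ihM, ihN]

theorem subst_var (M : Term) : M.subst .var = M := by
  induction M with
  | var x => rfl
  | lam M ih => rw [subst, liftSub_var, ih]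
  | app M N ihM ihN => rw [subst, ihM, ihN]

theorem fvs_rename (M : Term) (ρ : ℕ → ℕ) : (M.rename ρ).fvs = M.fvs.map ρ := by
  induction M generalizing ρ with
  | var x => rfl
  | lam M ih => simp only [rename, fvs, ih, lower_map_liftRen]
  | app M N ihM ihN => simp only [rename, fvs, ihM, ihN, List.map_append]

theorem fvs_subst (M : Term) (s : ℕ → Term) :
    (M.subst s).fvs = M.fvs.flatMap fun x => (s x).fvs := by
  induction M generalizing s with
  | var x => exact (List.flatMap_singleton (fun x => (s x).fvs) x).symm
  | lam M ih =>
    rw [subst, fvs, ih]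
    refine lower_flatMap _ rfl fun x => ?_
    rw [liftSub, fvs_rename, lower_map_succ]
  | app M N ihM ihN => simp only [subst, fvs, ihM, ihN, List.flatMap_append]

theorem forall_mem_fvs_rename {M : Term} {ρ : ℕ → ℕ} {p : ℕ → Prop} :
    (∀ x ∈ (M.rename ρ).fvs, p x) ↔ ∀ x ∈ M.fvs, p (ρ x) := by
  rw [fvs_rename, List.forall_mem_map]

theorem forall_mem_fvs_subst {M : Term} {s : ℕ → Term} {p : ℕ → Prop} :
    (∀ y ∈ (M.subst s).fvs, p y) ↔ ∀ x ∈ M.fvs, ∀ y ∈ (s x).fvs, p y := by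
  rw [fvs_subst, List.forall_mem_flatMap]

theorem count_zero_fvs_subst_liftSub (M : Term) (s : ℕ → Term) :
    (M.subst (liftSub s)).fvs.count 0 = M.fvs.count 0 := by
  rw [fvs_subst]
  induction M.fvs with
  | nil => rfl
  | cons a l ih =>
    rw [List.flatMap_cons, List.count_append, ih]
    cases a with
    | zero => simp [liftSub, fvs, Nat.add_comm]
    | succ a => simp [liftSub, fvs_rename, List.count_eq_zero]

theorem count_zero_fvs_rename_liftRen (M : Term) (ρ : ℕ → ℕ) :
    (M.rename (liftRen ρ)).fvs.count 0 = M.fvs.count 0 := by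
  rw [rename_eq_subst, ← liftSub_var_comp, count_zero_fvs_subst_liftSub]

theorem eq_var_of_subst_eq_var {M : Term} {s : ℕ → Term} {z : ℕ} (h : M.subst s = .var z) :
    ∃ x, M = .var x ∧ s x = .var z := by
  cases M with
  | var x => exact ⟨x, rfl, h⟩
  | lam M => exact Term.noConfusion h
  | app M N => exact Term.noConfusion h

end Term

/-! ### Readback of sharing graphs -/

namespace Graph

/-- The list of free variable occurrences of a graph, before fans are unfolded. -/
def fvs : Graph → List ℕ
  | .var x => [x]
  | .lam G => lower G.fvs
  | .app G H => G.fvs ++ H.fvs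
  | .share P N => P.fvs ++ lower (lower N.fvs)

theorem readback_share (P N : Graph) :
    (share P N).readback =
      N.readback.subst (scons P.readback (scons P.readback Term.var)) := by
  rw [readback]
  congr 1; funext x; rcases x with _ | _ | x <;> rfl

theorem readback_share_var (z : ℕ) (N : Graph) :
    (share (.var z) N).readback = N.readback.rename (scons z (scons z id)) := by
  rw [Term.rename_eq_subst, readback_share]
  congr 1; funext x; rcases x with _ | _ | x <;> rfl

theorem readback_rename (G : Graph) (ρ : ℕ → ℕ) :
    (G.rename ρ).readback = G.readback.rename ρ := by
  induction G generalizing ρ with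
  | var x => rfl
  | lam G ih => simp only [rename, readback, Term.rename, ih]
  | app G H ihG ihH => simp only [rename, readback, Term.rename, ihG, ihH]
  | share P N ihP ihN =>
    simp only [rename, readback_share, ihP, ihN, Term.subst_rename, Term.rename_subst]
    congr 1; funext x; rcases x with _ | _ | x <;> rfl

theorem readback_liftSub (s : ℕ → Graph) :
    (fun x => (liftSub s x).readback) = Term.liftSub fun x => (s x).readback := by
  funext x
  cases x with
  | zero => rfl
  | succ x => exact readback_rename _ _

theorem readback_subst (G : Graph) (s : ℕ → Graph) :
    (G.subst s).readback = G.readback.subst fun x => (s x).readback := by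
  induction G generalizing s with
  | var x => rfl
  | lam G ih => simp only [subst, readback, Term.subst, ih, readback_liftSub]
  | app G H ihG ihH => simp only [subst, readback, Term.subst, ihG, ihH]
  | share P N ihP ihN =>
    simp only [subst, readback_share, ihP, ihN, Term.subst_subst, readback_liftSub]
    congr 1; funext x
    rcases x with _ | _ | x
    · rfl
    · rfl
    · simp only [Term.liftSub, Term.subst_rename, scons, Term.subst]
      exact Term.subst_var _

theorem readback_plug (H G : Graph) :
    (H.plug G).readback = H.readback.subst (scons G.readback Term.var) := by
  rw [plug, readback_subst]
  congr 1; funext x; cases x <;> rfl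

theorem fvs_rename (G : Graph) (ρ : ℕ → ℕ) : (G.rename ρ).fvs = G.fvs.map ρ := by
  induction G generalizing ρ with
  | var x => rfl
  | lam G ih => simp only [rename, fvs, ih, lower_map_liftRen]
  | app G H ihG ihH => simp only [rename, fvs, ihG, ihH, List.map_append]
  | share P N ihP ihN => simp only [rename, fvs, ihP, ihN, List.map_append, lower_map_liftRen]

theorem lower_flatMap_fvs_liftSub (l : List ℕ) (s : ℕ → Graph) :
    lower (l.flatMap fun x => (liftSub s x).fvs) = (lower l).flatMap fun x => (s x).fvs :=
  lower_flatMap l rfl fun x => by rw [liftSub, fvs_rename, lower_map_succ]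

theorem fvs_subst (G : Graph) (s : ℕ → Graph) :
    (G.subst s).fvs = G.fvs.flatMap fun x => (s x).fvs := by
  induction G generalizing s with
  | var x => exact (List.flatMap_singleton (fun x => (s x).fvs) x).symm
  | lam G ih => simp only [subst, fvs, ih, lower_flatMap_fvs_liftSub]
  | app G H ihG ihH => simp only [subst, fvs, ihG, ihH, List.flatMap_append]
  | share P N ihP ihN =>
    simp only [subst, fvs, ihP, ihN, List.flatMap_append, lower_flatMap_fvs_liftSub]

theorem mem_fvs_of_mem_readback {G : Graph} {x : ℕ} (h : x ∈ G.readback.fvs) : x ∈ G.fvs := by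
  induction G generalizing x with
  | var y => exact h
  | lam G ih => exact mem_lower.2 (ih (mem_lower.1 h))
  | app G H ihG ihH => exact List.mem_append.2 ((List.mem_append.1 h).imp ihG ihH)
  | share P N ihP ihN =>
    rw [readback_share, Term.fvs_subst, List.mem_flatMap] at h
    simp only [fvs, List.mem_append, mem_lower]
    obtain ⟨y, hy, hx⟩ := h
    rcases y with _ | _ | y
    · exact .inl (ihP hx)
    · exact .inl (ihP hx)
    · obtain rfl := List.mem_singleton.1 hx
      exact .inr (ihN hy)

end Graph

/-! ### Formulas -/

namespace Formula

variable {ι : Type*}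

/-- The formula does not start with `!`. Every formula is `!^m A` for a unique number `m` and a
unique core `A`. -/
def IsCore : Formula ι → Prop
  | .bang _ => False
  | _ => True

theorem iterate_bang_injective (n : ℕ) : Function.Injective (bang (ι := ι))^[n] :=
  Function.Injective.iterate (fun _ _ => bang.inj) n

theorem iterate_bang_inj {A B : Formula ι} (hA : A.IsCore) (hB : B.IsCore) {m n : ℕ}
    (h : bang^[m] A = bang^[n] B) : m = n ∧ A = B := by
  induction m generalizing n with
  | zero =>
    cases n with
    | zero => exact ⟨rfl, h⟩
    | succ n =>
      rw [Function.iterate_succ_apply', Function.iterate_zero_apply] at h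
      subst h; exact hA.elim
  | succ m ih =>
    cases n with
    | zero =>
      rw [Function.iterate_succ_apply', Function.iterate_zero_apply] at h
      subst h; exact hB.elim
    | succ n =>
      rw [Function.iterate_succ_apply', Function.iterate_succ_apply'] at h
      exact (ih (bang.inj h)).imp_left (congrArg Nat.succ)

theorem erase_iterate_bang (n : ℕ) (A : Formula ι) : (bang^[n] A).erase = A.erase := by
  induction n with
  | zero => rfl
  | succ n ih => rw [Function.iterate_succ_apply']; exact ih

theorem exists_eq_iterate_bang (A : Formula ι) : ∃ m A₀, A = bang^[m] A₀ ∧ A₀.IsCore := by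
  induction A with
  | atom a => exact ⟨0, .atom a, rfl, trivial⟩
  | lolli A B => exact ⟨0, .lolli A B, rfl, trivial⟩
  | bang A ih =>
    obtain ⟨m, A₀, rfl, hA₀⟩ := ih
    exact ⟨m + 1, A₀, (Function.iterate_succ_apply' ..).symm, hA₀⟩

end Formula

/-! ### Leveled typings -/

/-- `Leveled ℓ T d M A` is a typing of `M` in which every node of the syntax tree has a level, the
number of boxes around it, and every type is read outside all boxes: the root of `M` has level `d`
and type `A`, and the binder of a free variable `x` has level `ℓ x` and gives `x` the type `T x`.
A node is never of lower level than the binder of a variable that occurs below it, so a box that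
contains a binder contains all occurrences of its variable. -/
inductive Leveled {ι : Type*} : (ℕ → ℕ) → (ℕ → Formula ι) → ℕ → Term → Formula ι → Prop
  | var (ℓ : ℕ → ℕ) (T : ℕ → Formula ι) (d x : ℕ) : Leveled ℓ T d (.var x) (T x)
  | lam {ℓ : ℕ → ℕ} {T : ℕ → Formula ι} {d d' : ℕ} {M : Term} {A B : Formula ι} :
      (∀ x ∈ (Term.lam M).fvs, ℓ x ≤ d) → (2 ≤ M.fvs.count 0 → ∃ A', A = .bang A') →
      Leveled (scons d ℓ) (scons (Formula.bang^[d] A) T) d' M (Formula.bang^[d] B) →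
      Leveled ℓ T d (.lam M) (Formula.bang^[d] (.lolli A B))
  | app {ℓ : ℕ → ℕ} {T : ℕ → Formula ι} {d d₁ d₂ : ℕ} {M N : Term} {A B : Formula ι} :
      (∀ x ∈ (Term.app M N).fvs, ℓ x ≤ d) →
      Leveled ℓ T d₁ M (Formula.bang^[d] (.lolli A B)) →
      Leveled ℓ T d₂ N (Formula.bang^[d] A) →
      Leveled ℓ T d (.app M N) (Formula.bang^[d] B)

namespace Leveled

variable {ι : Type*} {ℓ ℓ' : ℕ → ℕ} {T T' : ℕ → Formula ι} {d : ℕ} {M N : Term} {C : Formula ι}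

theorem eq_of_var {x : ℕ} (h : Leveled ℓ T d (.var x) C) : C = T x := by cases h; rfl

theorem var_of_eq {x : ℕ} (h : C = T x) : Leveled ℓ T d (.var x) C := by subst h; exact .var _ _ _ _

theorem lam_inv (h : Leveled ℓ T d (.lam M) C) :
    ∃ A B d', C = Formula.bang^[d] (.lolli A B) ∧ (∀ x ∈ (Term.lam M).fvs, ℓ x ≤ d) ∧
      (2 ≤ M.fvs.count 0 → ∃ A', A = .bang A') ∧
      Leveled (scons d ℓ) (scons (Formula.bang^[d] A) T) d' M (Formula.bang^[d] B) := by
  cases h with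
  | lam hle hbang hM => exact ⟨_, _, _, rfl, hle, hbang, hM⟩

theorem app_inv (h : Leveled ℓ T d (.app M N) C) :
    ∃ A B d₁ d₂, C = Formula.bang^[d] B ∧ (∀ x ∈ (Term.app M N).fvs, ℓ x ≤ d) ∧
      Leveled ℓ T d₁ M (Formula.bang^[d] (.lolli A B)) ∧
      Leveled ℓ T d₂ N (Formula.bang^[d] A) := by
  cases h with
  | app hle hM hN => exact ⟨_, _, _, _, rfl, hle, hM, hN⟩

theorem congr (h : Leveled ℓ T d M C) (hℓ : ∀ x ∈ M.fvs, ℓ' x ≤ ℓ x)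
    (hT : ∀ x ∈ M.fvs, T' x = T x) : Leveled ℓ' T' d M C := by
  induction h generalizing ℓ' T' with
  | var ℓ T d x => exact var_of_eq (hT x List.mem_cons_self).symm
  | lam hle hbang _ ih =>
    exact .lam (fun x hx => (hℓ x hx).trans (hle x hx)) hbang
      (ih (forall_mem_of_scons le_rfl hℓ) (forall_mem_of_scons rfl hT))
  | app hle _ _ ihM ihN =>
    rw [Term.fvs, List.forall_mem_append] at hℓ hT
    exact .app (fun x hx => ((List.forall_mem_append.2 hℓ) x hx).trans (hle x hx))
      (ihM hℓ.1 hT.1) (ihN hℓ.2 hT.2)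

theorem rename {ρ : ℕ → ℕ} (h : Leveled (fun x => ℓ (ρ x)) (fun x => T (ρ x)) d M C) :
    Leveled ℓ T d (M.rename ρ) C := by
  induction M generalizing ℓ T d C ρ with
  | var x => exact var_of_eq (x := ρ x) h.eq_of_var
  | lam M ih =>
    obtain ⟨A, B, d', rfl, hle, hbang, hM⟩ := h.lam_inv
    rw [← scons_comp_liftRen d ℓ ρ, ← scons_comp_liftRen _ T ρ] at hM
    rw [← Term.count_zero_fvs_rename_liftRen _ ρ] at hbang
    exact .lam (Term.forall_mem_fvs_rename (M := .lam M).2 hle) hbang (ih hM)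
  | app M N ihM ihN =>
    obtain ⟨A, B, d₁, d₂, rfl, hle, hM, hN⟩ := h.app_inv
    exact .app (Term.forall_mem_fvs_rename (M := .app M N).2 hle) (ihM hM) (ihN hN)

theorem of_rename {ρ : ℕ → ℕ} (h : Leveled ℓ T d (M.rename ρ) C) :
    Leveled (fun x => ℓ (ρ x)) (fun x => T (ρ x)) d M C := by
  induction M generalizing ℓ T d C ρ with
  | var x => exact var_of_eq h.eq_of_var
  | lam M ih =>
    obtain ⟨A, B, d', rfl, hle, hbang, hM⟩ := lam_inv (M := M.rename (liftRen ρ)) h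
    replace hM := ih hM
    rw [scons_comp_liftRen, scons_comp_liftRen] at hM
    rw [Term.count_zero_fvs_rename_liftRen] at hbang
    exact .lam (Term.forall_mem_fvs_rename (M := .lam M).1 hle) hbang hM
  | app M N ihM ihN =>
    obtain ⟨A, B, d₁, d₂, rfl, hle, hM, hN⟩ := app_inv (M := M.rename ρ) (N := N.rename ρ) h
    exact .app (Term.forall_mem_fvs_rename (M := .app M N).1 hle) (ihM hM) (ihN hN)

theorem subst {s : ℕ → Term} (h : Leveled ℓ T d M C)
    (hs : ∀ x ∈ M.fvs, ∃ e, Leveled ℓ' T' e (s x) (T x))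
    (hℓ : ∀ x ∈ M.fvs, ∀ y ∈ (s x).fvs, ℓ' y ≤ ℓ x) : ∃ e, Leveled ℓ' T' e (M.subst s) C := by
  induction h generalizing ℓ' T' s with
  | var ℓ T _ x => exact hs x List.mem_cons_self
  | @lam ℓ T d _ M A B hle hbang _ ih =>
    have hle' : ∀ y ∈ (Term.subst (.lam M) s).fvs, ℓ' y ≤ d :=
      Term.forall_mem_fvs_subst.2 fun x hx y hy => (hℓ x hx y hy).trans (hle x hx)
    rw [← Term.count_zero_fvs_subst_liftSub _ s] at hbang
    obtain ⟨e, he⟩ := ih (ℓ' := scons d ℓ') (T' := scons (Formula.bang^[d] A) T')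
      (s := Term.liftSub s)
      (forall_mem_of_scons ⟨0, .var _ _ _ 0⟩ fun x hx =>
        (hs x hx).imp fun _ h =>
          rename (ℓ := scons d ℓ') (T := scons (Formula.bang^[d] A) T') (ρ := Nat.succ) h)
      (forall_mem_of_scons (fun y hy => by obtain rfl := List.mem_singleton.1 hy; exact le_rfl)
        fun x hx => Term.forall_mem_fvs_rename.2 (hℓ x hx))
    exact ⟨d, .lam hle' hbang he⟩
  | @app ℓ T d _ _ M N A B hle _ _ ihM ihN =>
    have hle' : ∀ y ∈ (Term.subst (.app M N) s).fvs, ℓ' y ≤ d :=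
      Term.forall_mem_fvs_subst.2 fun x hx y hy => (hℓ x hx y hy).trans (hle x hx)
    rw [Term.fvs, List.forall_mem_append] at hs hℓ
    obtain ⟨e₁, he₁⟩ := ihM hs.1 hℓ.1
    obtain ⟨e₂, he₂⟩ := ihN hs.2 hℓ.2
    exact ⟨d, .app hle' he₁ he₂⟩

theorem bang (h : Leveled ℓ T d M C) (hℓ : ∀ x, ℓ' x ≤ ℓ x + 1) :
    Leveled ℓ' (fun x => (T x).bang) (d + 1) M C.bang := by
  induction h generalizing ℓ' with
  | var ℓ T d x => exact .var _ _ _ x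
  | @lam ℓ T d d' M A B hle hbang _ ih =>
    have hM := ih (ℓ' := scons (d + 1) ℓ') fun x => by
      cases x with
      | zero => exact le_rfl
      | succ x => exact hℓ x
    rw [← Function.iterate_succ_apply' Formula.bang] at hM ⊢
    refine .lam (fun x hx => (hℓ x).trans (Nat.succ_le_succ (hle x hx))) hbang
      (hM.congr (fun _ _ => le_rfl) (forall_mem_of_scons ?_ fun _ _ => rfl))
    exact Function.iterate_succ_apply' ..
  | @app ℓ T d d₁ d₂ M N A B hle _ _ ihM ihN =>
    rw [← Function.iterate_succ_apply' Formula.bang]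
    refine .app (fun x hx => (hℓ x).trans (Nat.succ_le_succ (hle x hx)))
      (d₁ := d₁ + 1) (d₂ := d₂ + 1) (A := A) ?_ ?_
    · rw [Function.iterate_succ_apply']; exact ihM hℓ
    · rw [Function.iterate_succ_apply']; exact ihN hℓ

end Leveled

/-- `M` has a leveled typing in the context `Γ`: the variables of `Γ` are outside all boxes, and
one that occurs more than once in `M` has a type `!A`. -/
structure LeveledTyping {ι : Type*} (Γ : Ctx ι) (M : Term) (C : Formula ι) : Prop where
  eq_bang_of_two_le_count : ∀ x, 2 ≤ M.fvs.count x → ∃ A, Γ x = some (.bang A)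
  exists_leveled : ∃ (T : ℕ → Formula ι) (d : ℕ),
    (∀ x ∈ M.fvs, Γ x = some (T x)) ∧ Leveled (fun _ => 0) T d M C

/-! ### From sequent derivations to leveled typings -/

theorem apply_scons {α β : Type*} (g : α → β) (a : α) (f : ℕ → α) :
    (fun x => g (scons a f x)) = scons (g a) fun x => g (f x) := by
  funext x; cases x <;> rfl

theorem count_flatMap_scons (l a : List ℕ) (f : ℕ → List ℕ) (y : ℕ) :
    (l.flatMap (scons a f)).count y =
      l.count 0 * a.count y + ((lower l).flatMap f).count y := by
  induction l with
  | nil => simp [lower]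
  | cons b l ih =>
    rw [List.flatMap_cons, List.count_append, ih]
    cases b with
    | zero =>
      rw [List.count_cons_self, Nat.add_one_mul]
      change a.count y + _ = _ + ((lower l).flatMap f).count y
      omega
    | succ b =>
      rw [List.count_cons_of_ne (Nat.succ_ne_zero b)]
      change (f b).count y + _ = _ + ((b :: lower l).flatMap f).count y
      rw [List.flatMap_cons, List.count_append]
      omega

namespace Term

theorem count_fvs_subst_scons (M N : Term) (s : ℕ → Term) (y : ℕ) :
    (M.subst (scons N s)).fvs.count y =
      M.fvs.count 0 * N.fvs.count y + ((lower M.fvs).flatMap fun x => (s x).fvs).count y := by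
  rw [fvs_subst, apply_scons, count_flatMap_scons]

theorem count_fvs_subst_scons_var (M N : Term) (y : ℕ) :
    (M.subst (scons N var)).fvs.count y = M.fvs.count 0 * N.fvs.count y + M.fvs.count (y + 1) := by
  rw [count_fvs_subst_scons, ← count_lower]
  exact congrArg (_ + List.count y ·) (List.flatMap_singleton' _)

theorem count_fvs_subst_scons_scons_var (M N : Term) (y : ℕ) :
    (M.subst (scons N (scons N var))).fvs.count y =
      (M.fvs.count 0 + M.fvs.count 1) * N.fvs.count y + M.fvs.count (y + 2) := by
  rw [count_fvs_subst_scons, apply_scons, count_flatMap_scons]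
  simp only [fvs, List.flatMap_singleton', count_lower, Nat.add_mul, Nat.add_assoc, Nat.zero_add]

end Term

namespace Graph

theorem plug_eq_subst (H G : Graph) : H.plug G = H.subst (scons G var) :=
  congrArg H.subst (funext fun x => by cases x <;> rfl)

theorem count_fvs_plug (H G : Graph) (y : ℕ) :
    (H.plug G).fvs.count y = H.fvs.count 0 * G.fvs.count y + H.fvs.count (y + 1) := by
  rw [plug_eq_subst, fvs_subst, apply_scons, count_flatMap_scons, ← count_lower]
  exact congrArg (_ + List.count y ·) (List.flatMap_singleton' _)

theorem exists_readback_rename_eq_var {G : Graph} {ρ : ℕ → ℕ} :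
    (∃ x, (G.rename ρ).readback = .var x) ↔ ∃ x, G.readback = .var x := by
  rw [readback_rename]
  cases G.readback <;> simp [Term.rename]

theorem sharesOnlyVariables_rename {G : Graph} {ρ : ℕ → ℕ} :
    (G.rename ρ).SharesOnlyVariables ↔ G.SharesOnlyVariables := by
  induction G generalizing ρ with
  | var x => exact Iff.rfl
  | lam _ ih => exact ih
  | app _ _ ihG ihH => exact and_congr ihG ihH
  | share P N ihP ihN => exact and_congr exists_readback_rename_eq_var (and_congr ihP ihN)

namespace SharesOnlyVariables

variable {H : Graph} {s : ℕ → Graph} {x : ℕ}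

theorem of_subst (h : (H.subst s).SharesOnlyVariables) : H.SharesOnlyVariables := by
  induction H generalizing s with
  | var x => trivial
  | lam G ih => exact ih (s := liftSub s) h
  | app G H ihG ihH => exact ⟨ihG h.1, ihH h.2⟩
  | share P N ihP ihN =>
    obtain ⟨⟨x, hx⟩, hP, hN⟩ := h
    rw [readback_subst] at hx
    exact ⟨(Term.eq_var_of_subst_eq_var hx).imp fun _ => And.left, ihP hP, ihN hN⟩

theorem of_subst_of_mem (h : (H.subst s).SharesOnlyVariables) (hx : x ∈ H.fvs) :
    (s x).SharesOnlyVariables := by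
  induction H generalizing s x with
  | var y => obtain rfl := List.mem_singleton.1 hx; exact h
  | lam G ih => exact sharesOnlyVariables_rename.1 (ih (s := liftSub s) h (mem_lower.1 hx))
  | app G H ihG ihH => exact (List.mem_append.1 hx).elim (ihG h.1) (ihH h.2)
  | share P N ihP ihN =>
    refine (List.mem_append.1 hx).elim (ihP h.2.1) fun hx => ?_
    exact sharesOnlyVariables_rename.1 (sharesOnlyVariables_rename.1
      (ihN (s := liftSub (liftSub s)) h.2.2 (mem_lower.1 (mem_lower.1 hx))))

theorem exists_readback_eq_var_of_mem (h : (H.subst s).SharesOnlyVariables) {P N : Graph}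
    (hH : H = share P N) (hx : x ∈ P.readback.fvs) : ∃ y, (s x).readback = .var y := by
  subst hH
  obtain ⟨⟨y, hy⟩, -⟩ := h
  rw [readback_subst] at hy
  obtain ⟨z, hz, hzy⟩ := Term.eq_var_of_subst_eq_var hy
  rw [hz] at hx
  obtain rfl := List.mem_singleton.1 hx
  exact ⟨y, hzy⟩

/-- In a graph that uses `x` at most once, several occurrences of `x` in the readback come from a
fan that faces `x`. -/
theorem exists_readback_eq_var_of_two_le_count (h : (H.subst s).SharesOnlyVariables)
    (hle : H.fvs.count x ≤ 1) (htwo : 2 ≤ H.readback.fvs.count x) :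
    ∃ y, (s x).readback = .var y := by
  have hzero : ∀ {G : Graph} {x}, G.fvs.count x = 0 → G.readback.fvs.count x = 0 := fun hG =>
    List.count_eq_zero.2 fun hx => List.count_eq_zero.1 hG (mem_fvs_of_mem_readback hx)
  induction H generalizing s x with
  | var y => exact absurd (hle.trans_lt htwo) (lt_irrefl _)
  | lam G ih =>
    simp only [readback, Term.fvs, fvs, count_lower] at hle htwo
    exact exists_readback_rename_eq_var.1 (ih (s := liftSub s) h hle htwo)
  | app G H ihG ihH =>
    simp only [readback, Term.fvs, fvs, List.count_append] at hle htwo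
    rcases Nat.eq_zero_or_pos (G.fvs.count x) with hG | hG
    · exact ihH h.2 (by omega) (by rwa [hzero hG, Nat.zero_add] at htwo)
    · exact ihG h.1 (by omega) (by rwa [hzero (G := H) (by omega)] at htwo)
  | share P N _ ihN =>
    by_cases hP : x ∈ P.readback.fvs
    · exact h.exists_readback_eq_var_of_mem rfl hP
    · rw [readback_share, Term.count_fvs_subst_scons_scons_var, List.count_eq_zero.2 hP,
        Nat.mul_zero, Nat.zero_add] at htwo
      rw [fvs, List.count_append, count_lower, count_lower] at hle
      exact exists_readback_rename_eq_var.1 (exists_readback_rename_eq_var.1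
        (ihN (s := liftSub (liftSub s)) h.2.2 ((Nat.le_add_left _ _).trans hle) htwo))

end SharesOnlyVariables

end Graph

section

variable {ι : Type*}

namespace Ctx

variable {Γ Δ : Ctx ι} {x : ℕ} {A : Formula ι}

theorem mem_dom_of_eq_some (h : Γ x = some A) : x ∈ Γ.dom :=
  fun hnone => Option.some_ne_none A (h.symm.trans hnone)

theorem add_apply_self (Γ : Ctx ι) (x : ℕ) (A : Formula ι) : Γ.add x A x = some A :=
  Function.update_self ..

theorem add_apply_of_eq_some {y : ℕ} {B : Formula ι} (hx : x ∉ Γ.dom) (h : Γ y = some B) :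
    Γ.add x A y = some B := by
  rwa [add, Function.update_of_ne]
  rintro rfl
  exact hx (mem_dom_of_eq_some h)

theorem union_apply_of_left (h : Γ x = some A) : Γ.union Δ x = some A := by
  rw [union, h]; rfl

theorem union_apply_of_right (hd : Disjoint Γ.dom Δ.dom) (h : Δ x = some A) :
    Γ.union Δ x = some A := by
  rw [union, not_not.1 (Set.disjoint_right.1 hd (mem_dom_of_eq_some h)), h]; rfl

theorem isSome_toNat_union (hd : Disjoint Γ.dom Δ.dom) (x : ℕ) :
    (Γ.union Δ x).isSome.toNat = (Γ x).isSome.toNat + (Δ x).isSome.toNat := by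
  have hx : ¬ (Γ x ≠ none ∧ Δ x ≠ none) := fun h => Set.disjoint_left.1 hd h.1 h.2
  cases hΓ : Γ x <;> cases hΔ : Δ x <;> simp_all [union]

theorem add_union (Γ Δ : Ctx ι) (x : ℕ) (A : Formula ι) :
    (Γ.union Δ).add x A = (Γ.add x A).union Δ := by
  funext y
  by_cases h : y = x <;> simp [add, union, h]

theorem disjoint_dom_add (hd : Disjoint Γ.dom Δ.dom) (hx : x ∉ Δ.dom) :
    Disjoint (Γ.add x A).dom Δ.dom := by
  rw [Set.disjoint_left] at hd ⊢
  intro y hy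
  by_cases h : y = x
  · exact h ▸ hx
  · exact hd (by simpa [dom, add, h] using hy)

end Ctx

theorem Graph.count_fvs_plug_le {Δ : Ctx ι} {G H : Graph} {x m : ℕ} {A : Formula ι}
    (hH : ∀ y, H.fvs.count y ≤ (Δ.cons A y).isSome.toNat) (hG : G.fvs.count x ≤ m) :
    (H.plug G).fvs.count x ≤ m + (Δ x).isSome.toNat := by
  rw [count_fvs_plug]
  exact Nat.add_le_add ((Nat.mul_le_mul (hH 0) hG).trans_eq (Nat.one_mul m)) (hH (x + 1))

theorem Derives.count_fvs_le {Γ : Ctx ι} {G : Graph} {A : Formula ι} (h : Derives Γ G A) (x : ℕ) :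
    G.fvs.count x ≤ (Γ x).isSome.toNat := by
  induction h generalizing x with
  | ax y A => by_cases h : y = x <;> simp [Graph.fvs, Ctx.single, h]
  | cut hd _ _ ihG ihH =>
    rw [Ctx.isSome_toNat_union hd]
    exact Graph.count_fvs_plug_le ihH (ihG x)
  | weak y A _ _ ih =>
    by_cases h : x = y
    · simpa [Ctx.add, h] using (ih x).trans (Bool.toNat_le _)
    · simpa [Ctx.add, h] using ih x
  | @contr Γ G _ _ z hz _ ih =>
    have hG : G.fvs.count (x + 2) ≤ (Γ x).isSome.toNat := ih (x + 2)
    rw [Graph.fvs, List.count_append, count_lower, count_lower]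
    by_cases h : x = z
    · subst h
      simpa [Ctx.add, Graph.fvs, not_not.1 hz] using hG
    · simpa [Ctx.add, Graph.fvs, h, Ne.symm h] using hG
  | lolliR _ ih =>
    rw [Graph.fvs, count_lower]
    exact ih (x + 1)
  | @lolliL Γ _ _ _ _ _ _ f hd hfΓ hfΔ _ _ ihG ihH =>
    rw [Ctx.add_union, Ctx.isSome_toNat_union (Ctx.disjoint_dom_add hd hfΔ)]
    refine Graph.count_fvs_plug_le ihH ?_
    rw [Graph.fvs, List.count_append]
    by_cases h : x = f
    · subst h
      simpa [Ctx.add, Graph.fvs, not_not.1 hfΓ] using ihG x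
    · simpa [Ctx.add, Graph.fvs, h, Ne.symm h] using ihG x
  | bang _ ih => simpa [Ctx.bang] using ih x

namespace LeveledTyping

variable {Γ Δ : Ctx ι} {M N : Term} {A B C : Formula ι}

theorem exists_eq_some (h : LeveledTyping Γ M C) {x : ℕ} (hx : x ∈ M.fvs) : ∃ A, Γ x = some A :=
  let ⟨T, _, hT, _⟩ := h.exists_leveled
  ⟨T x, hT x hx⟩

theorem leveled_getD (h : LeveledTyping Γ M C) (D : Formula ι) :
    ∃ d, Leveled (fun _ => 0) (fun x => (Γ x).getD D) d M C := by
  obtain ⟨T, d, hT, hM⟩ := h.exists_leveled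
  exact ⟨d, hM.congr (fun _ _ => le_rfl) fun x hx => by rw [hT x hx]; rfl⟩

theorem of_leveled_getD {d : ℕ} {D : Formula ι}
    (hbang : ∀ x, 2 ≤ M.fvs.count x → ∃ A, Γ x = some (.bang A))
    (hdom : ∀ x ∈ M.fvs, ∃ A, Γ x = some A)
    (h : Leveled (fun _ => 0) (fun x => (Γ x).getD D) d M C) : LeveledTyping Γ M C :=
  ⟨hbang, _, d, fun x hx => by obtain ⟨A, hA⟩ := hdom x hx; rw [hA]; rfl, h⟩

theorem mono (h : LeveledTyping Γ M C) (hΓ : ∀ x A, Γ x = some A → Δ x = some A) :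
    LeveledTyping Δ M C := by
  obtain ⟨T, d, hT, hM⟩ := h.exists_leveled
  exact ⟨fun x hx => (h.eq_bang_of_two_le_count x hx).imp fun A => hΓ x A.bang,
    T, d, fun x hx => hΓ _ _ (hT x hx), hM⟩

theorem var {x : ℕ} (h : Γ x = some A) : LeveledTyping Γ (.var x) A := by
  refine ⟨fun y hy => absurd (hy.trans List.count_le_length) (Nat.lt_irrefl 1), fun _ => A, 0, ?_,
    .var _ _ _ x⟩
  rintro y hy
  obtain rfl := List.mem_singleton.1 hy
  exact h

theorem eq_some_of_var {x : ℕ} (h : LeveledTyping Γ (.var x) A) : Γ x = some A := by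
  obtain ⟨T, d, hT, hx⟩ := h.exists_leveled
  rw [hx.eq_of_var, hT x List.mem_cons_self]

theorem lam (h : LeveledTyping (Ctx.cons A Γ) M B) : LeveledTyping Γ (.lam M) (.lolli A B) := by
  obtain ⟨T, d, hT, hM⟩ := h.exists_leveled
  refine ⟨fun x hx => h.eq_bang_of_two_le_count (x + 1) ?_, fun x => T (x + 1), 0,
    fun x hx => hT (x + 1) (mem_lower.1 hx), .lam (d := 0) (d' := d) (fun _ _ => le_rfl)
      (fun hx => (h.eq_bang_of_two_le_count 0 hx).imp fun _ => Option.some.inj) (hM.congr ?_ ?_)⟩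
  · rwa [← count_lower]
  · exact forall_mem_of_scons le_rfl fun _ _ => le_rfl
  · intro x hx
    cases x with
    | zero => exact Option.some.inj (hT 0 hx)
    | succ x => rfl

theorem app (hM : LeveledTyping Γ M (.lolli A B)) (hN : LeveledTyping Γ N A)
    (hbang : ∀ x, 2 ≤ (Term.app M N).fvs.count x → ∃ A, Γ x = some (.bang A)) :
    LeveledTyping Γ (.app M N) B := by
  obtain ⟨d₁, hdM⟩ := hM.leveled_getD B
  obtain ⟨d₂, hdN⟩ := hN.leveled_getD B
  exact .of_leveled_getD hbang
    (List.forall_mem_append.2 ⟨fun _ => hM.exists_eq_some, fun _ => hN.exists_eq_some⟩)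
    (.app (d := 0) (A := A) (fun _ _ => le_rfl) hdM hdN)

theorem bang (h : LeveledTyping Γ M C) : LeveledTyping Γ.bang M C.bang := by
  obtain ⟨T, d, hT, hM⟩ := h.exists_leveled
  have hΓ : ∀ x ∈ M.fvs, Γ.bang x = some (T x).bang := fun x hx => by simp [Ctx.bang, hT x hx]
  exact ⟨fun x hx => ⟨T x, hΓ x (List.count_pos_iff.1 (by omega))⟩, _, d + 1, hΓ,
    hM.bang fun _ => Nat.zero_le _⟩

theorem subst {s : ℕ → Term} (hM : LeveledTyping Δ M B)
    (hs : ∀ x ∈ M.fvs, ∀ A, Δ x = some A → LeveledTyping Γ (s x) A)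
    (hbang : ∀ x, 2 ≤ (M.subst s).fvs.count x → ∃ A, Γ x = some (.bang A)) :
    LeveledTyping Γ (M.subst s) B := by
  obtain ⟨T, d, hT, hL⟩ := hM.exists_leveled
  have hs' : ∀ x ∈ M.fvs, LeveledTyping Γ (s x) (T x) := fun x hx => hs x hx _ (hT x hx)
  obtain ⟨e, he⟩ := hL.subst (fun x hx => (hs' x hx).leveled_getD B) fun _ _ _ _ => le_rfl
  exact .of_leveled_getD hbang
    (Term.forall_mem_fvs_subst.2 fun x hx _ => (hs' x hx).exists_eq_some) he

theorem eq_bang_of_two_le_count_plug (hd : Disjoint Γ.dom Δ.dom)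
    (hM : LeveledTyping (Ctx.cons A Δ) M B) (hN : 0 ∈ M.fvs → LeveledTyping Γ N A)
    (hvar : 2 ≤ M.fvs.count 0 → ∃ y, N = .var y) {x : ℕ}
    (hx : 2 ≤ (M.subst (scons N Term.var)).fvs.count x) :
    ∃ A, Γ.union Δ x = some (.bang A) := by
  rw [Term.count_fvs_subst_scons_var] at hx
  by_cases hzero : M.fvs.count 0 * N.fvs.count x = 0
  · rw [hzero, Nat.zero_add] at hx
    obtain ⟨A', hA'⟩ : ∃ A', Δ x = some (.bang A') := hM.eq_bang_of_two_le_count (x + 1) hx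
    exact ⟨A', Ctx.union_apply_of_right hd hA'⟩
  obtain ⟨h0, hxN⟩ := mul_ne_zero_iff.1 hzero
  have h0 := List.count_pos_iff.1 (Nat.pos_of_ne_zero h0)
  have hxN := List.count_pos_iff.1 (Nat.pos_of_ne_zero hxN)
  suffices ∃ A, Γ x = some (.bang A) from this.imp fun _ => Ctx.union_apply_of_left
  by_cases htwo : 2 ≤ M.fvs.count 0
  · obtain ⟨y, rfl⟩ := hvar htwo
    obtain rfl := List.mem_singleton.1 hxN
    rw [(hN h0).eq_some_of_var]
    exact hM.eq_bang_of_two_le_count 0 htwo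
  · refine (hN h0).eq_bang_of_two_le_count x ?_
    have hMx : M.fvs.count (x + 1) = 0 := List.count_eq_zero.2 fun h => by
      obtain ⟨_, hΔ⟩ := hM.exists_eq_some h
      obtain ⟨_, hΓ⟩ := (hN h0).exists_eq_some hxN
      exact Set.disjoint_left.1 hd (Ctx.mem_dom_of_eq_some hΓ) (Ctx.mem_dom_of_eq_some (Γ := Δ) hΔ)
    rw [hMx, Nat.add_zero] at hx
    exact hx.trans ((Nat.mul_le_mul_right _ (by omega)).trans_eq (Nat.one_mul _))

theorem plug {G H : Graph} (hd : Disjoint Γ.dom Δ.dom) (hs : (H.plug G).SharesOnlyVariables)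
    (hlin : H.fvs.count 0 ≤ 1) (hH : LeveledTyping (Ctx.cons A Δ) H.readback B)
    (hG : G.SharesOnlyVariables → LeveledTyping Γ G.readback A) :
    LeveledTyping (Γ.union Δ) (H.plug G).readback B := by
  have hG' (h0 : 0 ∈ H.readback.fvs) : LeveledTyping Γ G.readback A :=
    hG (hs.of_subst_of_mem (x := 0) (Graph.mem_fvs_of_mem_readback h0))
  rw [Graph.readback_plug]
  refine hH.subst (fun x hx A' hA' => ?_) fun x => hH.eq_bang_of_two_le_count_plug hd hG'
    (hs.exists_readback_eq_var_of_two_le_count (x := 0) hlin)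
  cases x with
  | zero =>
    obtain rfl := Option.some.inj hA'
    exact (hG' hx).mono fun _ _ => Ctx.union_apply_of_left
  | succ x => exact .var (Ctx.union_apply_of_right hd hA')

theorem add (h : LeveledTyping Γ M C) {x : ℕ} (hx : x ∉ Γ.dom) (A : Formula ι) :
    LeveledTyping (Γ.add x A) M C :=
  h.mono fun _ _ => Ctx.add_apply_of_eq_some hx

theorem share {z : ℕ} {G : Graph} (hz : z ∉ Γ.dom)
    (h : LeveledTyping (Ctx.cons A.bang (Ctx.cons A.bang Γ)) G.readback B) :
    LeveledTyping (Γ.add z A.bang) (Graph.share (.var z) G).readback B := by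
  have hself := Ctx.add_apply_self Γ z A.bang
  rw [Graph.readback_share]
  refine h.subst (fun x hx C hC => ?_) fun x hx => ?_
  · rcases x with _ | _ | x
    · exact .var (hself.trans hC)
    · exact .var (hself.trans hC)
    · exact .var (Ctx.add_apply_of_eq_some hz hC)
  · rw [Term.count_fvs_subst_scons_scons_var] at hx
    by_cases hxz : x = z
    · exact ⟨A, hxz ▸ hself⟩
    · rw [Graph.readback, Term.fvs, List.count_singleton, if_neg (by simpa using Ne.symm hxz),
        Nat.mul_zero, Nat.zero_add] at hx
      exact (h.eq_bang_of_two_le_count (x + 2) hx).imp fun _ => Ctx.add_apply_of_eq_some hz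

theorem app_var {f : ℕ} (hf : f ∉ Γ.dom) (h : LeveledTyping Γ N A) :
    LeveledTyping (Γ.add f (.lolli A B)) (.app (.var f) N) B := by
  have hadd := h.add hf (.lolli A B)
  have hN : f ∉ N.fvs := fun hx => by
    obtain ⟨C, hC⟩ := h.exists_eq_some hx
    exact hf (Ctx.mem_dom_of_eq_some hC)
  refine .app (.var (Ctx.add_apply_self ..)) hadd fun x hx => ?_
  refine hadd.eq_bang_of_two_le_count x ?_
  by_cases hxf : x = f
  · subst hxf
    simp [Term.fvs, List.count_eq_zero.2 hN] at hx
  · simpa [Term.fvs, Ne.symm hxf] using hx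

theorem of_derives {G : Graph} (h : Derives Γ G A) (hG : G.SharesOnlyVariables) :
    LeveledTyping Γ G.readback A := by
  induction h with
  | ax x A => exact .var (Function.update_self ..)
  | cut hd _ hH ihG ihH => exact plug hd hG (hH.count_fvs_le 0) (ihH hG.of_subst) ihG
  | weak x A hx _ ih => exact (ih hG).add hx A
  | contr z hz _ ih => exact (ih hG.2.2).share hz
  | lolliR _ ih => exact (ih hG).lam
  | lolliL f hd hfΓ hfΔ _ hH ihG ihH =>
    rw [Ctx.add_union]
    exact plug (Ctx.disjoint_dom_add hd hfΔ) hG (hH.count_fvs_le 0) (ihH hG.of_subst)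
      fun hG => (ihG hG.2).app_var hfΓ
  | bang _ ih => exact (ih hG).bang

end LeveledTyping

theorem Typing.leveledTyping {Γ : Ctx ι} {M : Term} {A : Formula ι} (h : Typing Γ M A) :
    LeveledTyping Γ M A := by
  obtain ⟨G, hG, rfl, hs⟩ := h
  exact .of_derives hG hs

end

/-! ### Sequent derivations whose fans share variable occurrences -/

namespace Graph

/-- Every fan faces a variable, and the free variables that fans face satisfy `p`. -/
def FansFace : Graph → (ℕ → Prop) → Prop
  | .var _, _ => True
  | .lam G, p => G.FansFace (scons True p)
  | .app G H, p => G.FansFace p ∧ H.FansFace p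
  | .share P N, p => (∃ z, P = .var z ∧ p z) ∧ N.FansFace (scons True (scons True p))

namespace FansFace

variable {G : Graph} {p q : ℕ → Prop}

theorem mono (h : G.FansFace p) (hpq : ∀ x, p x → q x) : G.FansFace q := by
  have hscons : ∀ {p q : ℕ → Prop}, (∀ x, p x → q x) → ∀ x, scons True p x → scons True q x := by
    rintro p q h (_ | x)
    · exact id
    · exact h x
  induction G generalizing p q with
  | var x => trivial
  | lam G ih => exact ih h (hscons hpq)
  | app G H ihG ihH => exact ⟨ihG h.1 hpq, ihH h.2 hpq⟩
  | share P N _ ihN =>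
    exact ⟨h.1.imp fun z hz => ⟨hz.1, hpq z hz.2⟩, ihN h.2 (hscons (hscons hpq))⟩

theorem sharesOnlyVariables (h : G.FansFace p) : G.SharesOnlyVariables := by
  induction G generalizing p with
  | var x => trivial
  | lam G ih => exact ih h
  | app G H ihG ihH => exact ⟨ihG h.1, ihH h.2⟩
  | share P N _ ihN =>
    obtain ⟨⟨z, rfl, -⟩, hN⟩ := h
    exact ⟨⟨z, rfl⟩, trivial, ihN hN⟩

theorem rename {ρ : ℕ → ℕ} (h : G.FansFace fun x => p (ρ x)) : (G.rename ρ).FansFace p := by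
  induction G generalizing p ρ with
  | var x => trivial
  | lam G ih =>
    refine ih (ρ := liftRen ρ) ?_
    rwa [scons_comp_liftRen]
  | app G H ihG ihH => exact ⟨ihG h.1, ihH h.2⟩
  | share P N _ ihN =>
    obtain ⟨⟨z, rfl, hz⟩, hN⟩ := h
    refine ⟨⟨ρ z, rfl, hz⟩, ihN (ρ := liftRen (liftRen ρ)) ?_⟩
    rwa [scons_comp_liftRen, scons_comp_liftRen]

theorem liftSub {s : ℕ → Graph} (hs : ∀ x, (s x).FansFace q) :
    ∀ x, (Graph.liftSub s x).FansFace (scons True q)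
  | 0 => trivial
  | x + 1 => rename (ρ := Nat.succ) (hs x)

theorem exists_liftSub_eq_var {s : ℕ → Graph} (h : ∀ x, p x → ∃ y, s x = .var y ∧ q y) :
    ∀ x, scons True p x → ∃ y, Graph.liftSub s x = .var y ∧ scons True q y
  | 0, _ => ⟨0, rfl, trivial⟩
  | x + 1, hx => by
    obtain ⟨y, hy, hq⟩ := h x hx
    exact ⟨y + 1, by rw [Graph.liftSub, hy]; rfl, hq⟩

theorem subst {s : ℕ → Graph} (h : G.FansFace p) (hs : ∀ x, (s x).FansFace q)
    (hvar : ∀ x, p x → ∃ y, s x = .var y ∧ q y) : (G.subst s).FansFace q := by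
  induction G generalizing p q s with
  | var x => exact hs x
  | lam G ih => exact ih h (liftSub hs) (exists_liftSub_eq_var hvar)
  | app G H ihG ihH => exact ⟨ihG h.1 hs hvar, ihH h.2 hs hvar⟩
  | share P N _ ihN =>
    obtain ⟨⟨z, rfl, hz⟩, hN⟩ := h
    exact ⟨hvar z hz, ihN hN (liftSub (liftSub hs))
      (exists_liftSub_eq_var (exists_liftSub_eq_var hvar))⟩

end FansFace

end Graph

section

variable {ι : Type*}

/-- Some sequent derivation of `Γ ⊢ M : A` has fans only at variables that occur at least twice
in `M`. In particular, a cut on a variable that occurs once keeps all fans at variables. -/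
def PlainTyping (Γ : Ctx ι) (M : Term) (A : Formula ι) : Prop :=
  ∃ G : Graph, Derives Γ G A ∧ G.readback = M ∧ G.FansFace fun x => 2 ≤ M.fvs.count x

namespace PlainTyping

variable {Γ Δ : Ctx ι} {M N : Term} {A B : Formula ι}

theorem typing (h : PlainTyping Γ M A) : Typing Γ M A := by
  obtain ⟨G, hG, hM, hfans⟩ := h
  exact ⟨G, hG, hM, hfans.sharesOnlyVariables⟩

theorem cut (hd : Disjoint Γ.dom Δ.dom) (hN : PlainTyping Γ N A)
    (hM : PlainTyping (Ctx.cons A Δ) M B) (hone : M.fvs.count 0 = 1) :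
    PlainTyping (Γ.union Δ) (M.subst (scons N Term.var)) B := by
  obtain ⟨G, hG, rfl, hGfans⟩ := hN
  obtain ⟨H, hH, rfl, hHfans⟩ := hM
  refine ⟨H.plug G, .cut hd hG hH, Graph.readback_plug H G, ?_⟩
  simp only [Graph.plug_eq_subst, Term.count_fvs_subst_scons_var, hone, Nat.one_mul]
  refine hHfans.subst (fun x => ?_) fun x hx => ?_
  · cases x with
    | zero => exact hGfans.mono fun x hx => hx.trans (Nat.le_add_right _ _)
    | succ x => trivial
  · cases x with
    | zero => omega
    | succ x => exact ⟨x, rfl, hx.trans (Nat.le_add_left _ _)⟩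

theorem weak {x : ℕ} (h : PlainTyping Γ M B) (hx : x ∉ Γ.dom) (A : Formula ι) :
    PlainTyping (Γ.add x A) M B := by
  obtain ⟨G, hG, hM⟩ := h
  exact ⟨G, .weak x A hx hG, hM⟩

theorem lam (h : PlainTyping (Ctx.cons A Γ) M B) : PlainTyping Γ (.lam M) (.lolli A B) := by
  obtain ⟨G, hG, rfl, hfans⟩ := h
  refine ⟨.lam G, .lolliR hG, rfl, Graph.FansFace.mono (G := G) hfans ?_⟩
  rintro (_ | x) hx
  · trivial
  · exact hx.trans_eq (count_lower _ _).symm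

theorem bang (h : PlainTyping Γ M B) : PlainTyping Γ.bang M B.bang := by
  obtain ⟨G, hG, hM⟩ := h
  exact ⟨G, .bang hG, hM⟩

theorem contr {z : ℕ} (hz : z ∉ Γ.dom)
    (h : PlainTyping (Ctx.cons A.bang (Ctx.cons A.bang Γ)) M B)
    (hzero : 0 ∈ M.fvs) (hone : 1 ∈ M.fvs) :
    PlainTyping (Γ.add z A.bang) (M.rename (scons z (scons z id))) B := by
  obtain ⟨G, hG, rfl, hfans⟩ := h
  have hcount (x : ℕ) : (G.readback.rename (scons z (scons z id))).fvs.count x =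
      (G.readback.fvs.count 0 + G.readback.fvs.count 1) * (Term.var z).fvs.count x +
        G.readback.fvs.count (x + 2) := by
    rw [Term.rename_eq_subst, apply_scons, apply_scons]
    exact Term.count_fvs_subst_scons_scons_var ..
  refine ⟨.share (.var z) G, .contr z hz hG, Graph.readback_share_var _ _, ⟨z, rfl, ?_⟩,
    hfans.mono ?_⟩
  · have := List.count_pos_iff.2 hzero
    have := List.count_pos_iff.2 hone
    change 2 ≤ (G.readback.rename _).fvs.count z
    rw [hcount, Term.fvs, List.count_singleton_self]
    omega
  · rintro (_ | _ | x) hx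
    · trivial
    · trivial
    · exact (hx.trans (Nat.le_add_left _ _)).trans_eq (hcount x).symm

theorem appVar {f : ℕ} (h : PlainTyping Γ M A) (hf : f ∉ Γ.dom) (B : Formula ι) :
    PlainTyping (Γ.add f (.lolli A B)) (.app (.var f) M) B := by
  obtain ⟨G, hG, rfl, hfans⟩ := h
  let Δ : Ctx ι := fun _ => none
  have hcons : Δ.cons B = Ctx.single 0 B := by
    funext x; cases x <;> simp [Δ, Ctx.cons, Ctx.single]
  have hunion : Γ.union Δ = Γ := funext fun x => Option.or_none
  have hdom : ∀ x, x ∉ Δ.dom := fun x hx => hx rfl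
  have hvar : Derives (Δ.cons B) (.var 0) B := hcons ▸ .ax 0 B
  have happ := Derives.lolliL f (Set.disjoint_left.2 fun x _ => hdom x) hf (hdom f) hG hvar
  rw [hunion] at happ
  refine ⟨_, happ, rfl, trivial, hfans.mono fun x hx => hx.trans ?_⟩
  rw [Term.fvs, List.count_append]
  exact Nat.le_add_left _ _

theorem mono (h : PlainTyping Γ M B) (hΔ : Δ.dom.Finite)
    (hΓ : ∀ x A, Γ x = some A → Δ x = some A) : PlainTyping Δ M B := by
  suffices ∀ (s : Finset ℕ) (Γ : Ctx ι), (∀ x ∉ s, Γ x = Δ x) →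
      (∀ x A, Γ x = some A → Δ x = some A) → PlainTyping Γ M B → PlainTyping Δ M B by
    refine this hΔ.toFinset Γ (fun x hx => ?_) hΓ h
    have hx : Δ x = none := by simpa [Ctx.dom] using hx
    cases hΓx : Γ x with
    | none => exact hx.symm
    | some A => rw [← hΓ x A hΓx]
  intro s
  induction s using Finset.induction_on with
  | empty => exact fun Γ hs _ h => (funext fun x => hs x (Finset.notMem_empty x)) ▸ h
  | insert a s _ ih =>
    intro Γ hs hΓ h
    by_cases ha : Γ a = Δ a
    · refine ih Γ (fun x hx => ?_) hΓ h
      by_cases hxa : x = a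
      · rw [hxa, ha]
      · exact hs x (by simp [hxa, hx])
    have haΓ : Γ a = none := Option.eq_none_iff_forall_ne_some.2 fun A hA =>
      ha (hA.trans (hΓ a A hA).symm)
    obtain ⟨A, hA⟩ := Option.ne_none_iff_exists'.1 fun h => ha (haΓ.trans h.symm)
    refine ih (Γ.add a A) (fun x hx => ?_) (fun x B hB => ?_) (h.weak (not_not.2 haΓ) A)
    · by_cases hxa : x = a
      · rw [hxa, Ctx.add_apply_self, hA]
      · rw [Ctx.add, Function.update_of_ne hxa]
        exact hs x (by simp [hxa, hx])
    · by_cases hxa : x = a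
      · subst hxa
        rwa [hA, ← Ctx.add_apply_self Γ x A]
      · rw [Ctx.add, Function.update_of_ne hxa] at hB
        exact hΓ x B hB

end PlainTyping

end

section

variable {ι : Type*}

/-- Removes one outermost `!`, if there is one. -/
def Formula.unbang : Formula ι → Formula ι
  | .bang A => A
  | A => A

/-- The basis that gives the variables in the list `l` their types under `T`. -/
def Ctx.restrict (T : ℕ → Formula ι) (l : List ℕ) : Ctx ι :=
  fun x => if x ∈ l then some (T x) else none

namespace Ctx

variable {T : ℕ → Formula ι} {l l' : List ℕ}

theorem mem_dom_restrict {x : ℕ} : x ∈ (restrict T l).dom ↔ x ∈ l := by simp [dom, restrict]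

theorem restrict_congr (h : ∀ x, x ∈ l ↔ x ∈ l') : restrict T l = restrict T l' := by
  funext x; simp only [restrict, h]

theorem disjoint_dom_restrict (h : l.Disjoint l') :
    Disjoint (restrict T l).dom (restrict T l').dom :=
  Set.disjoint_left.2 fun _ hx hx' => h (mem_dom_restrict.1 hx) (mem_dom_restrict.1 hx')

theorem restrict_append (T : ℕ → Formula ι) (l l' : List ℕ) :
    restrict T (l ++ l') = (restrict T l).union (restrict T l') := by
  funext x
  by_cases hx : x ∈ l <;> simp [restrict, union, hx]

theorem restrict_cons (T : ℕ → Formula ι) (x : ℕ) (l : List ℕ) :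
    restrict T (x :: l) = (restrict T l).add x (T x) := by
  funext y
  by_cases hy : y = x <;> simp [restrict, add, hy]

theorem restrict_scons_of_mem (A : Formula ι) (hl : 0 ∈ l) :
    restrict (scons A T) l = Ctx.cons A (restrict T (lower l)) := by
  funext x
  cases x with
  | zero => simp [restrict, hl, scons, Ctx.cons]
  | succ x => simp only [restrict, mem_lower, scons, Ctx.cons]

theorem restrict_bang_comp (hl : ∀ x ∈ l, ∃ A, T x = .bang A) :
    (restrict (fun x => (T x).unbang) l).bang = restrict T l := by
  funext x
  by_cases hx : x ∈ l
  · obtain ⟨A, hA⟩ := hl x hx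
    simp [restrict, bang, hx, hA, Formula.unbang]
  · simp [restrict, bang, hx]

end Ctx

theorem Term.fvs_subst_scons_var_perm {M : Term} (hone : M.fvs.count 0 = 1) (N : Term) :
    (M.subst (scons N var)).fvs.Perm (N.fvs ++ lower M.fvs) := by
  refine List.perm_iff_count.2 fun x => ?_
  rw [count_fvs_subst_scons_var, hone, Nat.one_mul, List.count_append, count_lower]

theorem Term.mem_fvs_rename_scons_scons_id {M : Term} {x z : ℕ} (hzero : 0 ∈ M.fvs) :
    x ∈ (M.rename (scons z (scons z id))).fvs ↔ x ∈ z :: lower (lower M.fvs) := by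
  simp only [fvs_rename, List.mem_map, List.mem_cons, mem_lower]
  constructor
  · rintro ⟨_ | _ | y, hy, rfl⟩
    · exact .inl rfl
    · exact .inl rfl
    · exact .inr hy
  · rintro (rfl | hx)
    · exact ⟨0, hzero, rfl⟩
    · exact ⟨x + 2, hx, rfl⟩

namespace PlainTyping

variable {T : ℕ → Formula ι} {M N : Term} {A B : Formula ι}

theorem restrict_var (T : ℕ → Formula ι) (x : ℕ) :
    PlainTyping (Ctx.restrict T (Term.var x).fvs) (.var x) (T x) := by
  have hsingle : Ctx.restrict T [x] = Ctx.single x (T x) := Ctx.restrict_cons T x []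
  exact ⟨.var x, hsingle ▸ .ax x (T x), rfl, trivial⟩

theorem restrict_lam (h : PlainTyping (Ctx.restrict (scons A T) M.fvs) M B) :
    PlainTyping (Ctx.restrict T (Term.lam M).fvs) (.lam M) (.lolli A B) := by
  refine .lam ?_
  change PlainTyping (Ctx.cons A (Ctx.restrict T (lower (0 :: M.fvs)))) M B
  rw [← Ctx.restrict_scons_of_mem A List.mem_cons_self]
  by_cases hzero : 0 ∈ M.fvs
  · rwa [Ctx.restrict_congr (l' := M.fvs) (by simp [hzero])]
  · rw [Ctx.restrict_cons]
    exact h.weak (mt Ctx.mem_dom_restrict.1 hzero) A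

theorem restrict_bang (h : PlainTyping (Ctx.restrict (fun x => (T x).unbang) M.fvs) M B)
    (hT : ∀ x ∈ M.fvs, ∃ A, T x = .bang A) : PlainTyping (Ctx.restrict T M.fvs) M B.bang :=
  Ctx.restrict_bang_comp hT ▸ h.bang

theorem restrict_cut (hN : PlainTyping (Ctx.restrict T N.fvs) N A)
    (hM : PlainTyping (Ctx.restrict (scons A T) M.fvs) M B) (hone : M.fvs.count 0 = 1)
    (hnodup : (M.subst (scons N Term.var)).fvs.Nodup) :
    PlainTyping (Ctx.restrict T (M.subst (scons N Term.var)).fvs)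
      (M.subst (scons N Term.var)) B := by
  have hperm := Term.fvs_subst_scons_var_perm hone N
  rw [Ctx.restrict_congr fun _ => hperm.mem_iff, Ctx.restrict_append]
  rw [Ctx.restrict_scons_of_mem A (List.count_pos_iff.1 (hone ▸ Nat.one_pos))] at hM
  exact hN.cut (Ctx.disjoint_dom_restrict
    (List.disjoint_of_nodup_append (hperm.nodup_iff.1 hnodup))) hM hone

theorem restrict_contr {z : ℕ} (hz : T z = A.bang)
    (h : PlainTyping (Ctx.restrict (scons A.bang (scons A.bang T)) M.fvs) M B)
    (hzero : 0 ∈ M.fvs) (hone : 1 ∈ M.fvs) (hz' : z + 2 ∉ M.fvs) :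
    PlainTyping (Ctx.restrict T (M.rename (scons z (scons z id))).fvs)
      (M.rename (scons z (scons z id))) B := by
  rw [Ctx.restrict_congr fun _ => Term.mem_fvs_rename_scons_scons_id hzero, Ctx.restrict_cons, hz]
  rw [Ctx.restrict_scons_of_mem _ hzero, Ctx.restrict_scons_of_mem _ (mem_lower.2 hone)] at h
  refine h.contr (fun hmem => hz' ?_) hzero hone
  exact mem_lower.1 (mem_lower.1 (Ctx.mem_dom_restrict.1 hmem))

theorem restrict_app
    (hM : PlainTyping (Ctx.restrict T M.fvs) M (.lolli A B))
    (hN : PlainTyping (Ctx.restrict (scons (.lolli A B) T) (N.rename Nat.succ).fvs)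
      (N.rename Nat.succ) A)
    (hnodup : (Term.app M N).fvs.Nodup) :
    PlainTyping (Ctx.restrict T (Term.app M N).fvs) (.app M N) B := by
  have hzero : 0 ∉ (N.rename Nat.succ).fvs := by simp [Term.fvs_rename]
  have happ := hN.appVar (mt Ctx.mem_dom_restrict.1 hzero) B
  change PlainTyping (Ctx.add _ _ (scons (.lolli A B) T 0)) _ _ at happ
  rw [← Ctx.restrict_cons] at happ
  have hsubst : (Term.app (.var 0) (N.rename Nat.succ)).subst (scons M Term.var) = .app M N := by
    rw [Term.subst, Term.subst_rename]
    exact congrArg (Term.app M) N.subst_var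
  rw [← hsubst] at hnodup ⊢
  refine hM.restrict_cut happ ?_ hnodup
  rw [Term.fvs, List.count_append, List.count_eq_zero.2 hzero]
  rfl

end PlainTyping

end

theorem exists_map_liftRen_eq (ρ : ℕ → ℕ) (m l : List ℕ) (h : l.map ρ = lower m) :
    ∃ l', l'.map (liftRen ρ) = m ∧ lower l' = l := by
  induction m generalizing l with
  | nil => exact ⟨[], rfl, (List.map_eq_nil_iff.1 h).symm⟩
  | cons a m ih =>
    cases a with
    | zero =>
      obtain ⟨l', hmap, hlower⟩ := ih l h
      exact ⟨0 :: l', congrArg (0 :: ·) hmap, hlower⟩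
    | succ a =>
      obtain ⟨b, l, rfl, rfl, hl⟩ := List.map_eq_cons_iff.1 h
      obtain ⟨l', hmap, hlower⟩ := ih l hl
      exact ⟨(b + 1) :: l', congrArg ((ρ b + 1) :: ·) hmap, congrArg (b :: ·) hlower⟩

/-- Sends `x` to `1` and every other variable `y` to `y + 2`: the free variables of a term with
two occurrences of `x`, one of which is to become the variable `0` and another one the
variable `1`. -/
def separate (x y : ℕ) : ℕ := if y = x then 1 else y + 2

theorem scons_scons_separate (x y : ℕ) : scons x (scons x id) (separate x y) = y := by
  unfold separate; split_ifs with hy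
  · exact hy.symm
  · rfl

theorem separate_injective (x : ℕ) : (separate x).Injective :=
  Function.LeftInverse.injective (scons_scons_separate x)

theorem separate_pos (x y : ℕ) : 0 < separate x y := by unfold separate; split_ifs <;> omega

theorem separate_ne_add_two (x y : ℕ) : separate x y ≠ x + 2 := by
  unfold separate; split_ifs <;> omega

/-- The renaming that exchanges the variables `0` and `1`. -/
def swap : ℕ → ℕ := scons 1 (scons 0 (· + 2))

theorem scons_scons_comp_swap {α : Type*} (a b : α) (f : ℕ → α) :
    (fun x => scons a (scons b f) (swap x)) = scons b (scons a f) := by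
  rw [swap, apply_scons, apply_scons]; rfl

theorem swap_injective : swap.Injective := by
  rintro (_ | _ | x) (_ | _ | y) h <;> simp_all [swap, scons]

namespace Term

/-- The number of nodes of the syntax tree. -/
def size : Term → ℕ
  | var _ => 1
  | lam M => M.size + 1
  | app M N => M.size + N.size + 1

theorem size_pos (M : Term) : 0 < M.size := by cases M <;> exact Nat.succ_pos _

theorem size_rename (M : Term) (ρ : ℕ → ℕ) : (M.rename ρ).size = M.size := by
  induction M generalizing ρ with
  | var _ => rfl
  | lam M ih => rw [rename, size, ih, size]
  | app M N ihM ihN => rw [rename, size, ihM, ihN, size]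

theorem exists_rename_eq {M : Term} {ρ : ℕ → ℕ} {l : List ℕ} (h : l.map ρ = M.fvs) :
    ∃ M' : Term, M'.fvs = l ∧ M'.rename ρ = M := by
  induction M generalizing ρ l with
  | var x =>
    obtain ⟨y, rfl, rfl⟩ := List.map_eq_singleton_iff.1 h
    exact ⟨.var y, rfl, rfl⟩
  | lam M ih =>
    obtain ⟨l', hmap, hlower⟩ := exists_map_liftRen_eq ρ M.fvs l h
    obtain ⟨M', hfvs, hrename⟩ := ih hmap
    exact ⟨.lam M', (congrArg lower hfvs).trans hlower, congrArg lam hrename⟩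
  | app M N ihM ihN =>
    obtain ⟨l₁, l₂, rfl, h₁, h₂⟩ := List.map_eq_append_iff.1 h
    obtain ⟨M', hfvsM, hrenameM⟩ := ihM h₁
    obtain ⟨N', hfvsN, hrenameN⟩ := ihN h₂
    exact ⟨.app M' N', congrArg₂ _ hfvsM hfvsN, congrArg₂ app hrenameM hrenameN⟩

theorem exists_rename_succ {M : Term} (hzero : 0 ∉ M.fvs) :
    ∃ M' : Term, M'.rename Nat.succ = M := by
  have hmap : (M.fvs.map Nat.pred).map Nat.succ = M.fvs := by
    rw [List.map_map]
    exact (List.map_congr_left fun x hx => Nat.succ_pred fun h => hzero (h ▸ hx)).trans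
      (List.map_id _)
  exact (exists_rename_eq hmap).imp fun _ => And.right

/-- The number of variable occurrences beyond the first one of each variable. -/
def excess (M : Term) : ℕ := M.fvs.length - M.fvs.dedup.length

theorem exists_rename_separate {M : Term} {x : ℕ} (h : 2 ≤ M.fvs.count x) :
    ∃ (M' : Term) (l : List ℕ), M'.rename (scons x (scons x id)) = M ∧
      M'.fvs.Perm (0 :: l.map (separate x)) ∧ M.fvs.Perm (x :: l) ∧ x ∈ l := by
  obtain ⟨l₁, l₂, hl⟩ := List.append_of_mem (List.count_pos_iff.1 (Nat.zero_lt_of_lt h))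
  have hmap : (l₁.map (separate x) ++ 0 :: l₂.map (separate x)).map (scons x (scons x id)) =
      M.fvs := by
    simp only [List.map_append, List.map_cons, List.map_map, Function.comp_def,
      scons_scons_separate, List.map_id', hl]
    rfl
  obtain ⟨M', hfvs, hM'⟩ := exists_rename_eq hmap
  have hperm : M.fvs.Perm (x :: (l₁ ++ l₂)) := hl ▸ List.perm_middle
  refine ⟨M', l₁ ++ l₂, hM', ?_, hperm, ?_⟩
  · rw [hfvs, List.map_append]
    exact List.perm_middle
  · rw [hperm.count_eq, List.count_cons_self] at h
    exact List.count_pos_iff.1 (Nat.lt_of_succ_lt_succ h)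

theorem excess_lt_of_perm {M M' : Term} {x : ℕ} {l : List ℕ}
    (hM' : M'.fvs.Perm (0 :: l.map (separate x))) (hM : M.fvs.Perm (x :: l)) (hx : x ∈ l) :
    M'.excess < M.excess := by
  have hzero : 0 ∉ l.map (separate x) := fun h => by
    obtain ⟨y, -, hy⟩ := List.mem_map.1 h
    exact (separate_pos x y).ne' hy
  have hle := M.fvs.dedup_sublist.length_le
  have hle' := M'.fvs.dedup_sublist.length_le
  rw [excess, excess]
  rw [hM'.length_eq, hM'.dedup.length_eq, List.dedup_cons_of_notMem hzero,
    List.dedup_map_of_injective (separate_injective x)] at *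
  rw [hM.length_eq, hM.dedup.length_eq, List.dedup_cons_of_mem hx] at *
  simp only [List.length_cons, List.length_map] at *
  omega

theorem mem_fvs_subst_scons_var {M : Term} {x : ℕ} (N : Term) (hx : x + 1 ∈ M.fvs) :
    x ∈ (M.subst (scons N var)).fvs :=
  List.count_pos_iff.1 (by
    rw [count_fvs_subst_scons_var]
    exact Nat.add_pos_right _ (List.count_pos_iff.2 hx))

theorem subst_rename_succ (M N : Term) : (M.rename Nat.succ).subst (scons N var) = M :=
  (subst_rename M _ _).trans M.subst_var

theorem lam_rename_swap_subst_scons (M N : Term) :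
    (lam (M.rename swap)).subst (scons N var) =
      lam (M.subst (scons (N.rename Nat.succ) var)) := by
  rw [subst, subst_rename]
  congr 2
  funext x
  rcases x with _ | _ | x <;> rfl

end Term

section

variable {ι : Type*}

namespace Leveled

variable {ℓ : ℕ → ℕ} {T : ℕ → Formula ι} {d d' : ℕ} {M N M₁ P : Term} {A B C : Formula ι}

/-- `Cut ℓ T d M A M₁ P C` splits the leveled typing of `M` into a typing of a term `M₁` with one
occurrence of the variable `0` and a typing of the subterm `P` of `M` at that place, which is
outside all boxes and so can be typed on its own. -/
structure Cut (ℓ : ℕ → ℕ) (T : ℕ → Formula ι) (d : ℕ) (M : Term) (A : Formula ι)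
    (M₁ P : Term) (C : Formula ι) : Prop where
  eq_subst : M₁.subst (scons P Term.var) = M
  outer : Leveled (scons 0 ℓ) (scons C T) d M₁ A
  inner : Leveled ℓ T 0 P C
  level_eq_zero : ∀ x ∈ P.fvs, ℓ x = 0
  count_zero : M₁.fvs.count 0 = 1
  size_outer_lt : M₁.size < M.size
  size_inner_le : P.size ≤ M.size
  size_inner_lt : d ≠ 0 → P.size < M.size

namespace Cut

theorem level_le (h : Cut ℓ T d' M A M₁ P C) (hle : ∀ x ∈ M.fvs, ℓ x ≤ d) :
    ∀ x ∈ M₁.fvs, scons 0 ℓ x ≤ d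
  | 0, _ => Nat.zero_le d
  | x + 1, hx => hle x (h.eq_subst ▸ Term.mem_fvs_subst_scons_var P hx)

theorem app_self (hle : ∀ x ∈ (Term.app M N).fvs, ℓ x ≤ 0)
    (h : Leveled ℓ T 0 (.app M N) A) : Cut ℓ T 0 (.app M N) A (.var 0) (.app M N) A where
  eq_subst := rfl
  outer := .var _ _ _ 0
  inner := h
  level_eq_zero := fun x hx => Nat.le_zero.1 (hle x hx)
  count_zero := rfl
  size_outer_lt := Nat.succ_lt_succ (Nat.add_pos_left M.size_pos _)
  size_inner_le := le_rfl
  size_inner_lt := fun h => (h rfl).elim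

theorem app_left (h : Cut ℓ T d' M (Formula.bang^[d] (.lolli A B)) M₁ P C)
    (hle : ∀ x ∈ (Term.app M N).fvs, ℓ x ≤ d) {e : ℕ}
    (hN : Leveled ℓ T e N (Formula.bang^[d] A)) :
    Cut ℓ T d (.app M N) (Formula.bang^[d] B) (.app M₁ (N.rename Nat.succ)) P C where
  eq_subst := congrArg₂ Term.app h.eq_subst (N.subst_rename_succ P)
  outer := by
    have hle' := List.forall_mem_append.1 hle
    refine .app (List.forall_mem_append.2 ⟨h.level_le hle'.1, ?_⟩) h.outer (rename hN)
    exact Term.forall_mem_fvs_rename.2 hle'.2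
  inner := h.inner
  level_eq_zero := h.level_eq_zero
  count_zero := by
    rw [Term.fvs, List.count_append, h.count_zero, List.count_eq_zero.2 (by simp [Term.fvs_rename])]
  size_outer_lt := by
    have := h.size_outer_lt
    simp only [Term.size, Term.size_rename]
    omega
  size_inner_le := h.size_inner_le.trans (by simp only [Term.size]; omega)
  size_inner_lt := fun _ => h.size_inner_le.trans_lt (by simp only [Term.size]; omega)

theorem app_right (h : Cut ℓ T d' N (Formula.bang^[d] A) M₁ P C)
    (hle : ∀ x ∈ (Term.app M N).fvs, ℓ x ≤ d) {e : ℕ}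
    (hM : Leveled ℓ T e M (Formula.bang^[d] (.lolli A B))) :
    Cut ℓ T d (.app M N) (Formula.bang^[d] B) (.app (M.rename Nat.succ) M₁) P C where
  eq_subst := congrArg₂ Term.app (M.subst_rename_succ P) h.eq_subst
  outer := by
    have hle' := List.forall_mem_append.1 hle
    refine .app (List.forall_mem_append.2 ⟨?_, h.level_le hle'.2⟩) (rename hM) h.outer
    exact Term.forall_mem_fvs_rename.2 hle'.1
  inner := h.inner
  level_eq_zero := h.level_eq_zero
  count_zero := by
    rw [Term.fvs, List.count_append, h.count_zero, List.count_eq_zero.2 (by simp [Term.fvs_rename])]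
  size_outer_lt := by
    have := h.size_outer_lt
    simp only [Term.size, Term.size_rename]
    omega
  size_inner_le := h.size_inner_le.trans (by simp only [Term.size]; omega)
  size_inner_lt := fun _ => h.size_inner_le.trans_lt (by simp only [Term.size]; omega)

theorem lam (h : Cut (scons d ℓ) (scons (Formula.bang^[d] A) T) d' M (Formula.bang^[d] B) M₁
      (P.rename Nat.succ) C)
    (hle : ∀ x ∈ (Term.lam M).fvs, ℓ x ≤ d)
    (hbang : 2 ≤ M.fvs.count 0 → ∃ A', A = .bang A') :
    Cut ℓ T d (.lam M) (Formula.bang^[d] (.lolli A B)) (.lam (M₁.rename swap)) P C := by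
  have heq : (Term.lam (M₁.rename swap)).subst (scons P Term.var) = .lam M :=
    (M₁.lam_rename_swap_subst_scons P).trans (congrArg Term.lam h.eq_subst)
  have hcount : (M₁.rename swap).fvs.count 0 ≤ M.fvs.count 0 := by
    rw [Term.fvs_rename, ← h.eq_subst, Term.count_fvs_subst_scons_var]
    exact (List.count_map_of_injective _ _ swap_injective 1).trans_le (Nat.le_add_left ..)
  refine ⟨heq, ?_, of_rename (ρ := Nat.succ) h.inner, ?_, ?_, ?_, ?_, fun _ => ?_⟩
  · refine .lam ?_ (fun h₂ => hbang (h₂.trans hcount)) (rename (d := d') ?_)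
    · rintro (_ | x) hx
      · exact Nat.zero_le d
      · exact hle x (heq ▸ Term.mem_fvs_subst_scons_var P hx)
    · rw [scons_scons_comp_swap, scons_scons_comp_swap]
      exact h.outer
  · exact fun x hx => h.level_eq_zero (x + 1) (Term.fvs_rename P _ ▸ List.mem_map_of_mem hx)
  · rw [Term.fvs, count_lower, Term.fvs_rename]
    exact (List.count_map_of_injective _ _ swap_injective 0).trans h.count_zero
  · exact Nat.succ_lt_succ ((M₁.size_rename swap).trans_lt h.size_outer_lt)
  · exact ((P.size_rename _).symm.trans_le h.size_inner_le).trans (Nat.le_succ _)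
  · exact Nat.lt_succ_of_le ((P.size_rename _).symm.trans_le h.size_inner_le)

end Cut

/-- The leveled typing of `M` at the type `!C` stays one when the outermost box is opened: all
levels decrease by one, and the types of the variables and of `M` lose a `!`. -/
def Unboxed (ℓ : ℕ → ℕ) (T : ℕ → Formula ι) (d : ℕ) (M : Term) (C : Formula ι) : Prop :=
  Leveled (fun x => ℓ x - 1) (fun x => (T x).unbang) (d - 1) M C ∧ ∀ x ∈ M.fvs, ∃ A, T x = .bang A

namespace Unboxed

theorem var {x : ℕ} (h : T x = C.bang) : Unboxed ℓ T d (.var x) C :=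
  ⟨var_of_eq (by rw [h, Formula.unbang]),
    fun y hy => ⟨C, (congrArg T (List.mem_singleton.1 hy)).trans h⟩⟩

theorem lam (h : Unboxed (scons (d + 1) ℓ) (scons (Formula.bang^[d + 1] A) T) d' M
      (Formula.bang^[d] B))
    (hle : ∀ x ∈ (Term.lam M).fvs, ℓ x ≤ d + 1)
    (hbang : 2 ≤ M.fvs.count 0 → ∃ A', A = .bang A') :
    Unboxed ℓ T (d + 1) (.lam M) (Formula.bang^[d] (.lolli A B)) := by
  refine ⟨.lam (fun x hx => Nat.sub_le_of_le_add (hle x hx)) hbang (h.1.congr ?_ ?_),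
    fun x hx => h.2 (x + 1) (mem_lower.1 hx)⟩
  · rintro (_ | x) - <;> exact le_rfl
  · rintro (_ | x) -
    · change _ = (Formula.bang^[d + 1] A).unbang
      rw [Function.iterate_succ_apply', Formula.unbang]
      rfl
    · rfl

theorem app {e e' : ℕ} (hM : Unboxed ℓ T e M (Formula.bang^[d] (.lolli A B)))
    (hN : Unboxed ℓ T e' N (Formula.bang^[d] A))
    (hle : ∀ x ∈ (Term.app M N).fvs, ℓ x ≤ d + 1) :
    Unboxed ℓ T (d + 1) (.app M N) (Formula.bang^[d] B) :=
  ⟨.app (fun x hx => Nat.sub_le_of_le_add (hle x hx)) hM.1 hN.1,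
    List.forall_mem_append.2 ⟨hM.2, hN.2⟩⟩

end Unboxed

/-- A subterm at level zero is the only obstruction to opening a box around `M`. Since its type
begins with `!`, it is an application. -/
theorem unboxed_or_exists_cut (h : Leveled ℓ T d M C.bang) :
    Unboxed ℓ T d M C ∨ ∃ M₁ P D, Cut ℓ T d M C.bang M₁ P D := by
  induction M generalizing ℓ T d C with
  | var x => exact .inl (.var h.eq_of_var.symm)
  | lam M ih =>
    obtain ⟨A, B, d', hC, hle, hbang, hM⟩ := h.lam_inv
    obtain _ | d := d
    · cases hC
    rw [Function.iterate_succ_apply', Formula.bang.injEq] at hC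
    subst hC
    rw [Function.iterate_succ_apply' _ _ B] at hM
    rcases ih hM with hun | ⟨M₁, P, D, hcut⟩
    · exact .inl (hun.lam hle hbang)
    · have hzero : 0 ∉ P.fvs := fun h => Nat.succ_ne_zero d (hcut.level_eq_zero 0 h)
      obtain ⟨P, rfl⟩ := Term.exists_rename_succ hzero
      rw [← Function.iterate_succ_apply' Formula.bang] at hcut ⊢
      exact .inr ⟨_, P, D, hcut.lam hle hbang⟩
  | app M N ihM ihN =>
    obtain ⟨A, B, e, e', hC, hle, hM, hN⟩ := h.app_inv
    obtain _ | d := d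
    · exact .inr ⟨_, _, _, .app_self hle h⟩
    rw [Function.iterate_succ_apply', Formula.bang.injEq] at hC
    subst hC
    have hM' := hM
    have hN' := hN
    rw [Function.iterate_succ_apply'] at hM' hN'
    rcases ihM hM' with hunM | ⟨M₁, P, D, hcut⟩
    · rcases ihN hN' with hunN | ⟨N₁, P, D, hcut⟩
      · exact .inl (hunM.app hunN hle)
      · rw [← Function.iterate_succ_apply' Formula.bang] at hcut ⊢
        exact .inr ⟨_, P, D, hcut.app_right hle hM⟩
    · rw [← Function.iterate_succ_apply' Formula.bang] at hcut ⊢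
      exact .inr ⟨_, P, D, hcut.app_left hle hN⟩

theorem eq_var_or_eq_bang (h : Leveled ℓ T (d + 1) M C) :
    (∃ x, M = .var x) ∨ ∃ C', C = .bang C' := by
  cases M with
  | var x => exact .inl ⟨x, rfl⟩
  | lam M =>
    obtain ⟨A, B, _, rfl, _⟩ := h.lam_inv
    exact .inr ⟨_, Function.iterate_succ_apply' ..⟩
  | app M N =>
    obtain ⟨A, B, _, _, rfl, _⟩ := h.app_inv
    exact .inr ⟨_, Function.iterate_succ_apply' ..⟩

end Leveled

end

section

variable {ι : Type*}

namespace PlainTyping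

variable {T : ℕ → Formula ι} {d : ℕ} {M : Term} {C : Formula ι}

/-- Occurrences of the same variable are separated one after the other and contracted again. -/
theorem of_leveled_of_linear
    (linear : ∀ (M' : Term) (T' : ℕ → Formula ι), M'.size = M.size → M'.fvs.Nodup →
      Leveled (fun _ => 0) T' d M' C → PlainTyping (Ctx.restrict T' M'.fvs) M' C)
    (h : Leveled (fun _ => 0) T d M C) (hbang : ∀ x, 2 ≤ M.fvs.count x → ∃ A, T x = .bang A) :
    PlainTyping (Ctx.restrict T M.fvs) M C := by
  induction hn : M.excess using Nat.strong_induction_on generalizing M T with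
  | _ n ih =>
    subst hn
    by_cases hnodup : M.fvs.Nodup
    · exact linear M T rfl hnodup h
    obtain ⟨x, hx⟩ : ∃ x, 2 ≤ M.fvs.count x := by
      by_contra! hcount
      exact hnodup (List.nodup_iff_count_le_one.2 fun x => Nat.le_of_lt_succ (hcount x))
    obtain ⟨A, hA⟩ := hbang x hx
    obtain ⟨M', l, rfl, hM', hM, hxl⟩ := Term.exists_rename_separate hx
    have hlt := Term.excess_lt_of_perm hM' hM hxl
    have hleveled := h.of_rename
    have hbang' : ∀ y, 2 ≤ M'.fvs.count y → ∃ A, T (scons x (scons x id) y) = .bang A :=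
      fun y hy => hbang _ (hy.trans (Term.fvs_rename M' _ ▸ List.count_le_count_map))
    have hplain := ih M'.excess hlt (by simpa only [Term.size_rename] using linear)
      hleveled hbang' rfl
    rw [apply_scons, apply_scons, hA] at hplain
    refine hplain.restrict_contr hA (hM'.mem_iff.2 List.mem_cons_self) ?_ fun hmem => ?_
    · exact hM'.mem_iff.2 (List.mem_cons_of_mem _ (List.mem_map.2 ⟨x, hxl, if_pos rfl⟩))
    · obtain ⟨y, -, hy⟩ := List.mem_map.1
        ((List.mem_cons.1 (hM'.mem_iff.1 hmem)).resolve_left (Nat.succ_ne_zero _))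
      exact separate_ne_add_two x y hy

theorem of_leveled_cut {M₁ P : Term} {D : Formula ι}
    (hcut : Leveled.Cut (fun _ => 0) T d M C M₁ P D) (hd : d ≠ 0) (hnodup : M.fvs.Nodup)
    (ih : ∀ (M' : Term) (T' : ℕ → Formula ι) (d' : ℕ) (C' : Formula ι), M'.size < M.size →
      M'.fvs.Nodup → Leveled (fun _ => 0) T' d' M' C' →
      PlainTyping (Ctx.restrict T' M'.fvs) M' C') :
    PlainTyping (Ctx.restrict T M.fvs) M C := by
  obtain rfl := hcut.eq_subst
  have hperm := (Term.fvs_subst_scons_var_perm hcut.count_zero P).nodup_iff.1 hnodup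
  have hnodup₁ : M₁.fvs.Nodup := List.nodup_iff_count_le_one.2 fun
    | 0 => hcut.count_zero.le
    | x + 1 => count_lower M₁.fvs x ▸ List.nodup_iff_count_le_one.1 hperm.of_append_right x
  have houter := hcut.outer.congr (ℓ' := fun _ => 0) (fun _ _ => Nat.zero_le _) fun _ _ => rfl
  exact restrict_cut (ih P T 0 D (hcut.size_inner_lt hd) hperm.of_append_left hcut.inner)
    (ih M₁ _ d C hcut.size_outer_lt hnodup₁ houter) hcut.count_zero hnodup

theorem of_leveled_zero {T : ℕ → Formula ι} {M : Term} {C : Formula ι}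
    (ih : ∀ (M' : Term) (T' : ℕ → Formula ι) (d' : ℕ) (C' : Formula ι), M'.size < M.size →
      Leveled (fun _ => 0) T' d' M' C' → (∀ x, 2 ≤ M'.fvs.count x → ∃ A, T' x = .bang A) →
      PlainTyping (Ctx.restrict T' M'.fvs) M' C')
    (hnodup : M.fvs.Nodup) (h : Leveled (fun _ => 0) T 0 M C) :
    PlainTyping (Ctx.restrict T M.fvs) M C := by
  have bang_of_nodup {M' : Term} {T' : ℕ → Formula ι} (hM' : M'.fvs.Nodup) (x : ℕ)
      (hx : 2 ≤ M'.fvs.count x) : ∃ A, T' x = .bang A :=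
    absurd (List.nodup_iff_count_le_one.1 hM' x) (Nat.not_le_of_lt hx)
  cases M with
  | var x => exact h.eq_of_var ▸ restrict_var T x
  | lam M =>
    obtain ⟨A, B, d', rfl, -, hbang, hM⟩ := h.lam_inv
    refine restrict_lam (ih M (scons A T) d' B (Nat.lt_succ_self _)
      (hM.congr (fun _ _ => Nat.zero_le _) fun _ _ => rfl) fun
      | 0, hx => hbang hx
      | x + 1, hx => bang_of_nodup hnodup x (hx.trans_eq (count_lower _ x).symm))
  | app M N =>
    obtain ⟨A, B, d₁, d₂, rfl, -, hM, hN⟩ := h.app_inv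
    have hnodupN : (N.rename Nat.succ).fvs.Nodup :=
      Term.fvs_rename N _ ▸ hnodup.of_append_right.map Nat.succ_injective
    refine restrict_app (ih M T d₁ _ ?_ hM (bang_of_nodup hnodup.of_append_left))
      (ih _ _ d₂ _ ?_ (Leveled.rename (ρ := Nat.succ) hN) (bang_of_nodup hnodupN)) hnodup
    · simp only [Term.size]; omega
    · simp only [Term.size, Term.size_rename]; omega

theorem of_leveled_of_nodup
    (ih : ∀ (M' : Term) (T' : ℕ → Formula ι) (d' : ℕ) (C' : Formula ι), M'.size < M.size →
      Leveled (fun _ => 0) T' d' M' C' → (∀ x, 2 ≤ M'.fvs.count x → ∃ A, T' x = .bang A) →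
      PlainTyping (Ctx.restrict T' M'.fvs) M' C')
    (hnodup : M.fvs.Nodup) (h : Leveled (fun _ => 0) T d M C) :
    PlainTyping (Ctx.restrict T M.fvs) M C := by
  induction d generalizing T C with
  | zero => exact of_leveled_zero ih hnodup h
  | succ d ihd =>
    rcases h.eq_var_or_eq_bang with ⟨x, rfl⟩ | ⟨C, rfl⟩
    · exact h.eq_of_var ▸ restrict_var T x
    rcases h.unboxed_or_exists_cut with ⟨hunboxed, hT⟩ | ⟨M₁, P, D, hcut⟩
    · exact restrict_bang (ihd hunboxed) hT
    · exact of_leveled_cut hcut d.succ_ne_zero hnodup fun M' T' d' C' hlt hM' hleveled =>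
        ih M' T' d' C' hlt hleveled fun x hx =>
          absurd (List.nodup_iff_count_le_one.1 hM' x) (Nat.not_le_of_lt hx)

theorem of_leveled (h : Leveled (fun _ => 0) T d M C)
    (hbang : ∀ x, 2 ≤ M.fvs.count x → ∃ A, T x = .bang A) :
    PlainTyping (Ctx.restrict T M.fvs) M C := by
  induction hn : M.size using Nat.strong_induction_on generalizing T d M C with
  | _ n ih =>
    subst hn
    refine of_leveled_of_linear (fun M' T' hsize hnodup hM' => ?_) h hbang
    exact of_leveled_of_nodup (fun M'' T'' d'' C'' hlt hM'' hbang'' =>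
      ih _ (hlt.trans_eq hsize) hM'' hbang'' rfl) hnodup hM'

end PlainTyping

theorem LeveledTyping.typing {Γ : Ctx ι} {M : Term} {C : Formula ι} (h : LeveledTyping Γ M C)
    (hΓ : Γ.dom.Finite) : Typing Γ M C := by
  obtain ⟨T, d, hT, hleveled⟩ := h.exists_leveled
  have hbang : ∀ x, 2 ≤ M.fvs.count x → ∃ A, T x = .bang A := fun x hx =>
    (h.eq_bang_of_two_le_count x hx).imp fun A hA =>
      Option.some.inj ((hT x (List.count_pos_iff.1 (Nat.zero_lt_of_lt hx))).symm.trans hA)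
  refine ((PlainTyping.of_leveled hleveled hbang).mono hΓ fun x A hx => ?_).typing
  by_cases hxM : x ∈ M.fvs
  · rw [← hx, hT x hxM, Ctx.restrict, if_pos hxM]
  · simp [Ctx.restrict, hxM] at hx

end

/-! ### Instances of general types -/

section

variable {ι : Type*} {E : ℕ → STy ι} {σ τ : STy ι} {X : ℕ → ℕ}

namespace GTy

/-- The instance `X(Θ)` without the `!`s of its outermost exponent. -/
def core (X : ℕ → ℕ) : {σ : STy ι} → GTy σ → Formula ι
  | _, .atom _ a => .atom a
  | _, .lolli _ Θ Γ => .lolli (Θ.inst X) (Γ.inst X)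

theorem isCore_core (Θ : GTy σ) : (Θ.core X).IsCore := by cases Θ <;> trivial

theorem inst_eq (Θ : GTy σ) : Θ.inst X = Formula.bang^[(Θ.outer.map X).sum] (Θ.core X) := by
  cases Θ <;> rfl

theorem core_setOuter (ms : List ℕ) (Θ : GTy σ) : (Θ.setOuter ms).core X = Θ.core X := by
  cases Θ <;> rfl

theorem outer_setOuter (ms : List ℕ) (Θ : GTy σ) : (Θ.setOuter ms).outer = ms := by
  cases Θ <;> rfl

theorem inst_bang (c : ℕ) (Θ : GTy σ) : (Θ.bang c).inst X = Formula.bang^[X c] (Θ.inst X) := by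
  rw [inst_eq, inst_eq, bang, core_setOuter, outer_setOuter, List.map_cons, List.sum_cons,
    Function.iterate_add_apply]

theorem core_eq_lolli (Θ : GTy (.arr σ τ)) :
    Θ.core X = .lolli (Θ.dom.inst X) (Θ.cod.inst X) := by
  cases Θ; rfl

theorem iterate_bang_inst_eq_iff {m n : ℕ} (Θ Θ' : GTy σ) :
    Formula.bang^[m] (Θ.inst X) = Formula.bang^[n] (Θ'.inst X) ↔
      m + (Θ.outer.map X).sum = n + (Θ'.outer.map X).sum ∧ Θ.core X = Θ'.core X := by
  rw [inst_eq, inst_eq, ← Function.iterate_add_apply, ← Function.iterate_add_apply]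
  refine ⟨fun h => Formula.iterate_bang_inj (isCore_core _) (isCore_core _) h, ?_⟩
  rintro ⟨h₁, h₂⟩
  rw [h₁, h₂]

theorem inst_eq_iff (Θ Θ' : GTy σ) : Θ.inst X = Θ'.inst X ↔
    (Θ.outer.map X).sum = (Θ'.outer.map X).sum ∧ Θ.core X = Θ'.core X := by
  simpa using iterate_bang_inst_eq_iff (m := 0) (n := 0) Θ Θ' (X := X)

theorem one_le_outer_iff (Θ : GTy σ) :
    1 ≤ (Θ.outer.map X).sum ↔ ∃ A, Θ.inst X = .bang A := by
  rw [inst_eq]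
  cases h : (Θ.outer.map X).sum with
  | zero =>
    refine ⟨fun h => absurd h (by omega), ?_⟩
    rintro ⟨A, hA⟩
    have := isCore_core Θ (X := X)
    rw [show Θ.core X = .bang A from hA] at this
    exact this.elim
  | succ n => exact ⟨fun _ => ⟨_, Function.iterate_succ_apply' _ _ _⟩, fun _ => by omega⟩

end GTy

/-- The constraint `A - k`, for an equation `A`, holds. -/
def Constraint.HoldsSub (X : ℕ → ℕ) (k : ℕ) : Constraint → Prop
  | .eq pos neg => (pos.map X).sum = (neg.map X).sum + k
  | .ge ns => 1 ≤ (ns.map X).sum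

theorem Constraint.holdsSub_zero {c : Constraint} : c.HoldsSub X 0 ↔ c.Holds X := by
  cases c with
  | eq pos neg =>
    simp only [HoldsSub, Holds, Nat.add_zero, sub_eq_zero, Nat.cast_inj]
  | ge ns => exact Iff.rfl

theorem Constraint.holdsSub_sub {c : Constraint} {n k : ℕ} :
    (c.sub n).HoldsSub X k ↔ c.HoldsSub X (X n + k) := by
  cases c with
  | eq pos neg => simp [HoldsSub, Constraint.sub, Nat.add_assoc]
  | ge ns => exact Iff.rfl

theorem solves_cons {c : Constraint} {cs : List Constraint} :
    Solves X (c :: cs) ↔ c.Holds X ∧ Solves X cs :=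
  List.forall_mem_cons

theorem solves_append {cs cs' : List Constraint} :
    Solves X (cs ++ cs') ↔ Solves X cs ∧ Solves X cs' :=
  List.forall_mem_append

theorem solves_chain (a : List ℕ) (l : List (List ℕ)) :
    Solves X (chain (a :: l)) ↔ ∀ b ∈ l, (b.map X).sum = (a.map X).sum := by
  induction l generalizing a with
  | nil => simp [chain, Solves]
  | cons b l ih =>
    rw [chain, solves_cons, ih, List.forall_mem_cons, ← Constraint.holdsSub_zero,
      Constraint.HoldsSub, Nat.add_zero, eq_comm]
    exact and_congr_right fun h => by rw [h]

theorem solves_unify (σ : STy ι) (Θ : GTy σ) (l : List (GTy σ)) :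
    Solves X (unify σ (Θ :: l)) ↔ ∀ Θ' ∈ l, Θ'.inst X = Θ.inst X := by
  induction σ with
  | atom a =>
    simp only [unify, List.map_cons, solves_chain, List.forall_mem_map, GTy.inst_eq_iff]
    refine forall₂_congr fun Θ' _ => (and_iff_left ?_).symm
    cases Θ; cases Θ'; rfl
  | arr σ τ ih₁ ih₂ =>
    simp only [unify, List.map_cons, solves_append, ih₁, ih₂, solves_chain,
      List.forall_mem_map, GTy.inst_eq_iff (σ := .arr σ τ), GTy.core_eq_lolli,
      Formula.lolli.injEq, and_assoc, ← forall₂_and]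

theorem exists_unify_pair_eq (Θ Θ' : GTy σ) :
    ∃ cs, unify σ [Θ, Θ'] = .eq Θ.outer Θ'.outer :: cs ∧
      ∀ X, Solves X cs ↔ Θ.core X = Θ'.core X := by
  cases σ with
  | atom a =>
    refine ⟨[], rfl, fun X => ?_⟩
    cases Θ; cases Θ'; simp [GTy.core, Solves]
  | arr σ τ =>
    refine ⟨unify σ [Θ.dom, Θ'.dom] ++ unify τ [Θ.cod, Θ'.cod], rfl, fun X => ?_⟩
    simp only [solves_append, solves_unify, List.mem_singleton, forall_eq,
      GTy.core_eq_lolli, Formula.lolli.injEq, eq_comm]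

theorem solves_contraction (Θ : GTy σ) (l : List (GTy σ)) :
    Solves X (contraction (Θ :: l)) ↔
      (l ≠ [] → ∃ A, Θ.inst X = .bang A) ∧ ∀ Θ' ∈ l, Θ'.inst X = Θ.inst X := by
  cases l with
  | nil => simp [contraction, Solves]
  | cons Θ' l =>
    rw [contraction, solves_cons, solves_unify, ← GTy.one_le_outer_iff]
    simp [Constraint.Holds]

/-! ### Slices as boxes -/

/-- The slice is empty or belongs to the set of slices. -/
def Slice.Allowed (cpts : List Slice) (sl : Slice) : Prop := sl ∈ cpts ∨ sl = []

theorem Slice.hasRow_append (s t : Slice) (i : ℕ) :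
    Slice.hasRow (s ++ t) i = (s.hasRow i || t.hasRow i) := by
  simp [Slice.hasRow]

theorem Slice.hasOcc_append (s t : Slice) (o : ℕ) :
    Slice.hasOcc (s ++ t) o = (s.hasOcc o || t.hasOcc o) := by
  simp [Slice.hasOcc]

theorem mem_productUnion {cpts₁ cpts₂ : List Slice} {sl : Slice} :
    sl ∈ productUnion cpts₁ cpts₂ ↔
      sl ∈ cpts₁ ∨ sl ∈ cpts₂ ∨ ∃ s ∈ cpts₁, ∃ t ∈ cpts₂, sl = s ++ t := by
  induction cpts₁ with
  | nil => simp [productUnion]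
  | cons s cpts₁ ih =>
    simp only [productUnion, List.cons_append, List.mem_cons, List.mem_append, List.mem_map, ih]
    grind

theorem Slice.allowed_productUnion {cpts₁ cpts₂ : List Slice} {sl : Slice} :
    Slice.Allowed (productUnion cpts₁ cpts₂) sl ↔
      ∃ s t, Slice.Allowed cpts₁ s ∧ Slice.Allowed cpts₂ t ∧ sl = s ++ t := by
  rw [Slice.Allowed, mem_productUnion]
  constructor
  · rintro ((h | h | ⟨s, hs, t, ht, rfl⟩) | rfl)
    · exact ⟨sl, [], .inl h, .inr rfl, by simp⟩
    · exact ⟨[], sl, .inr rfl, .inl h, rfl⟩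
    · exact ⟨s, t, .inl hs, .inl ht, rfl⟩
    · exact ⟨[], [], .inr rfl, .inr rfl, rfl⟩
  · rintro ⟨s, t, hs | rfl, ht | rfl, rfl⟩
    · exact .inl (.inr (.inr ⟨s, hs, t, ht, rfl⟩))
    · exact .inl (.inl (by simpa using hs))
    · exact .inl (.inr (.inl ht))
    · exact .inr rfl

/-- The rows hold when the boxes `W` are put around the term. -/
def RowsHold (X : ℕ → ℕ) (W : List Slice) (A : List Row) : Prop :=
  ∀ r ∈ A, r.lin.HoldsSub X (W.countP fun sl => sl.hasRow r.id)

/-- When the boxes `W` are put around the term, the types of the variable occurrences are given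
by `T`. -/
def BaseFits (X : ℕ → ℕ) (W : List Slice) (B : List (Entry E)) (T : ℕ → Formula ι) : Prop :=
  ∀ e ∈ B, Formula.bang^[W.countP fun sl => !sl.hasOcc e.occ] (e.ty.inst X) = T e.var

theorem RowsHold.perm {W W' : List Slice} {A : List Row} (h : RowsHold X W A) (hW : W.Perm W') :
    RowsHold X W' A := fun r hr => hW.countP_eq (fun sl => sl.hasRow r.id) ▸ h r hr

theorem BaseFits.perm {W W' : List Slice} {B : List (Entry E)} {T : ℕ → Formula ι}
    (h : BaseFits X W B T) (hW : W.Perm W') :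
    BaseFits X W' B T := fun e he => hW.countP_eq (fun sl => !sl.hasOcc e.occ) ▸ h e he

theorem rowsHold_append {W : List Slice} {A A' : List Row} :
    RowsHold X W (A ++ A') ↔ RowsHold X W A ∧ RowsHold X W A' := List.forall_mem_append

theorem baseFits_append {W : List Slice} {B B' : List (Entry E)} {T : ℕ → Formula ι} :
    BaseFits X W (B ++ B') T ↔ BaseFits X W B T ∧ BaseFits X W B' T := List.forall_mem_append

/-- The boxes through critical points that boxing adds under the instantiation `X`. -/
def sliceBoxes (X : ℕ → ℕ) : List Slice → ℕ → List Slice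
  | [], _ => []
  | sl :: cpts, n => List.replicate (X n) sl ++ sliceBoxes X cpts (n + 1)

/-- The boxes that boxing adds under the instantiation `X`. -/
def addedBoxes (X : ℕ → ℕ) (M : Term) (cpts : List Slice) (n : ℕ) : List Slice :=
  if M.isVar then []
  else sliceBoxes X cpts n ++ List.replicate (X (n + cpts.length)) []

theorem boxSlices_next (B : List (Entry E)) (Γ : GTy σ) (cpts : List Slice) (A : List Row)
    (n : ℕ) : (boxSlices B Γ cpts A n).next = n + cpts.length := by
  induction cpts generalizing B Γ A n with
  | nil => rfl
  | cons sl cpts ih => simp only [boxSlices, ih, List.length_cons]; omega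

theorem rowsHold_boxSlices {W : List Slice} (B : List (Entry E)) (Γ : GTy σ) (cpts : List Slice)
    (A : List Row) (n : ℕ) :
    RowsHold X W (boxSlices B Γ cpts A n).rows ↔ RowsHold X (W ++ sliceBoxes X cpts n) A := by
  induction cpts generalizing B Γ A n with
  | nil => simp [boxSlices, sliceBoxes]
  | cons sl cpts ih =>
    rw [boxSlices, ih]
    simp only [RowsHold, List.forall_mem_map]
    refine forall₂_congr fun r _ => ?_
    simp only [sliceBoxes, List.countP_append, List.countP_replicate]
    by_cases h : sl.hasRow r.id = true
    · simp only [h, if_true, Constraint.holdsSub_sub, Nat.add_left_comm (X n)]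
    · simp only [h, Bool.false_eq_true, if_false, Nat.zero_add]

theorem baseFits_boxSlices {W : List Slice} {T : ℕ → Formula ι} (B : List (Entry E)) (Γ : GTy σ)
    (cpts : List Slice) (A : List Row) (n : ℕ) :
    BaseFits X W (boxSlices B Γ cpts A n).base T ↔ BaseFits X (W ++ sliceBoxes X cpts n) B T := by
  induction cpts generalizing B Γ A n with
  | nil => simp [boxSlices, sliceBoxes]
  | cons sl cpts ih =>
    rw [boxSlices, ih]
    simp only [BaseFits, List.forall_mem_map]
    refine forall₂_congr fun e _ => ?_
    by_cases h : sl.hasOcc e.occ = true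
    · rw [show (if sl.hasOcc e.occ = true then e else e.bang n) = e from if_pos h]
      simp only [sliceBoxes, List.countP_append, List.countP_replicate, h, Bool.not_true,
        Bool.false_eq_true, if_false, Nat.zero_add]
    · rw [show (if sl.hasOcc e.occ = true then e else e.bang n) = e.bang n from if_neg h]
      simp only [sliceBoxes, List.countP_append, List.countP_replicate, h, Entry.bang,
        GTy.inst_bang, ← Function.iterate_add_apply, Bool.not_false, if_true]
      rw [show ∀ a b c : ℕ, a + (b + c) = a + c + b by omega]

theorem baseFits_map_bang {W : List Slice} {T : ℕ → Formula ι} (B : List (Entry E)) (c : ℕ) :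
    BaseFits X W (B.map (Entry.bang c)) T ↔
      BaseFits X (W ++ List.replicate (X c) []) B T := by
  simp only [BaseFits, List.forall_mem_map]
  refine forall₂_congr fun e _ => ?_
  simp [Entry.bang, GTy.inst_bang, Function.iterate_add_apply, List.countP_replicate,
    Slice.hasOcc]

theorem inst_boxSlices_ty (B : List (Entry E)) (Γ : GTy σ) (cpts : List Slice) (A : List Row)
    (n : ℕ) : (boxSlices B Γ cpts A n).ty.inst X =
      Formula.bang^[(sliceBoxes X cpts n).length] (Γ.inst X) := by
  induction cpts generalizing B Γ A n with
  | nil => rfl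
  | cons sl cpts ih =>
    rw [boxSlices, ih, GTy.inst_bang, ← Function.iterate_add_apply, sliceBoxes, List.length_append,
      List.length_replicate, Nat.add_comm]

theorem map_var_occ_base_boxSlices (B : List (Entry E)) (Γ : GTy σ) (cpts : List Slice)
    (A : List Row) (n : ℕ) : (boxSlices B Γ cpts A n).base.map (fun e => (e.var, e.occ)) =
      B.map fun e => (e.var, e.occ) := by
  induction cpts generalizing B Γ A n with
  | nil => rfl
  | cons sl cpts ih =>
    rw [boxSlices, ih, List.map_map]
    refine List.map_congr_left fun e _ => ?_
    simp only [Function.comp]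
    split_ifs <;> rfl

theorem map_id_rows_boxSlices (B : List (Entry E)) (Γ : GTy σ) (cpts : List Slice) (A : List Row)
    (n : ℕ) : (boxSlices B Γ cpts A n).rows.map Row.id = A.map Row.id := by
  induction cpts generalizing B Γ A n with
  | nil => rfl
  | cons sl cpts ih =>
    rw [boxSlices, ih, List.map_map]
    refine List.map_congr_left fun e _ => ?_
    simp only [Function.comp]
    split_ifs <;> rfl

section Box

variable (M : Term) (B : List (Entry E)) (Γ : GTy σ) (cpts : List Slice) (A : List Row) (n : ℕ)

theorem le_box_next : n ≤ (box M B Γ cpts A n).next := by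
  rw [box]
  split_ifs
  · exact le_rfl
  · simp only [boxSlices_next]; omega

theorem rowsHold_box {W : List Slice} :
    RowsHold X W (box M B Γ cpts A n).rows ↔ RowsHold X (W ++ addedBoxes X M cpts n) A := by
  rw [box, addedBoxes]
  split_ifs
  · simp
  · rw [rowsHold_boxSlices]
    simp [RowsHold, List.countP_append, List.countP_replicate, Slice.hasRow]

theorem baseFits_box {W : List Slice} {T : ℕ → Formula ι} :
    BaseFits X W (box M B Γ cpts A n).base T ↔
      BaseFits X (W ++ addedBoxes X M cpts n) B T := by
  rw [box, addedBoxes]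
  split_ifs
  · simp
  · simp only [baseFits_map_bang, boxSlices_next, baseFits_boxSlices]
    have hperm (V V' : List Slice) : (W ++ V ++ V').Perm (W ++ (V' ++ V)) := by
      rw [List.append_assoc]
      exact List.Perm.append_left _ List.perm_append_comm
    exact ⟨fun h => h.perm (hperm _ _), fun h => h.perm (hperm _ _).symm⟩

theorem inst_box_ty : (box M B Γ cpts A n).ty.inst X =
    Formula.bang^[(addedBoxes X M cpts n).length] (Γ.inst X) := by
  rw [box, addedBoxes]
  split_ifs
  · rfl
  · simp only [GTy.inst_bang, inst_boxSlices_ty, boxSlices_next, ← Function.iterate_add_apply,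
      List.length_append, List.length_replicate, Nat.add_comm]

theorem map_var_occ_base_box : (box M B Γ cpts A n).base.map (fun e => (e.var, e.occ)) =
    B.map fun e => (e.var, e.occ) := by
  rw [box]
  split_ifs
  · rfl
  · simp only [List.map_map]
    exact map_var_occ_base_boxSlices B Γ cpts A n

theorem map_var_base_box : (box M B Γ cpts A n).base.map Entry.var = B.map Entry.var := by
  have := congrArg (List.map Prod.fst) (map_var_occ_base_box M B Γ cpts A n)
  rw [List.map_map, List.map_map] at this
  exact this

theorem occurrences_box : occurrences (box M B Γ cpts A n).base = occurrences B := by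
  have := congrArg (List.map Prod.snd) (map_var_occ_base_box M B Γ cpts A n)
  rw [List.map_map, List.map_map] at this
  exact this

theorem map_id_rows_box : (box M B Γ cpts A n).rows.map Row.id = A.map Row.id := by
  rw [box]
  split_ifs
  · rfl
  · exact map_id_rows_boxSlices B Γ cpts A n

theorem forall_mem_box_base {p : ℕ → ℕ → Prop} :
    (∀ e ∈ (box M B Γ cpts A n).base, p e.var e.occ) ↔ ∀ e ∈ B, p e.var e.occ := by
  have h : ∀ L : List (Entry E), (∀ e ∈ L, p e.var e.occ) ↔
      ∀ q ∈ L.map (fun e => (e.var, e.occ)), p q.1 q.2 := fun L => by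
    simp only [List.forall_mem_map]
  rw [h, map_var_occ_base_box, ← h]

end Box

/-! ### Choosing the values of fresh unknowns -/

/-- Whatever the values of the unknowns below `n`, the unknowns from `n` to `m - 1` can be given
values that make `P` hold for all values of the remaining unknowns. Successive calls of the
algorithm use successive ranges of unknowns, so that such choices can be composed. -/
def Choosable (n m : ℕ) (P : (ℕ → ℕ) → Prop) : Prop :=
  ∀ X₀ : ℕ → ℕ, ∃ X : ℕ → ℕ, (∀ i < n, X i = X₀ i) ∧
    ∀ X' : ℕ → ℕ, (∀ i < m, X' i = X i) → P X'

namespace Choosable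

variable {n m k : ℕ} {P Q : (ℕ → ℕ) → Prop}

theorem of_forall (h : ∀ X, P X) : Choosable n m P := fun X₀ =>
  ⟨X₀, fun _ _ => rfl, fun X' _ => h X'⟩

theorem apply_eq (n v : ℕ) : Choosable n (n + 1) fun X => X n = v := fun X₀ =>
  ⟨Function.update X₀ n v, fun i hi => Function.update_of_ne hi.ne _ _, fun X' hX' => by
    simp only [hX' n n.lt_succ_self, Function.update_self]⟩

theorem imp (h : Choosable n m P) (hPQ : ∀ X, P X → Q X) : Choosable n m Q := fun X₀ =>
  let ⟨X, hX, hP⟩ := h X₀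
  ⟨X, hX, fun X' hX' => hPQ X' (hP X' hX')⟩

theorem mono_right (h : Choosable n m P) (hmk : m ≤ k) : Choosable n k P := fun X₀ =>
  let ⟨X, hX, hP⟩ := h X₀
  ⟨X, hX, fun X' hX' => hP X' fun i hi => hX' i (hi.trans_le hmk)⟩

theorem and (hP : Choosable n m P) (hQ : Choosable m k Q) (hnm : n ≤ m) (hmk : m ≤ k) :
    Choosable n k fun X => P X ∧ Q X := by
  intro X₀
  obtain ⟨X₁, h₁, hP⟩ := hP X₀
  obtain ⟨X₂, h₂, hQ⟩ := hQ X₁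
  exact ⟨X₂, fun i hi => (h₂ i (hi.trans_le hnm)).trans (h₁ i hi), fun X' hX' =>
    ⟨hP X' fun i hi => (hX' i (hi.trans_le hmk)).trans (h₂ i hi), hQ X' hX'⟩⟩

theorem exists_apply (h : Choosable n m P) : ∃ X, P X :=
  let ⟨X, _, hP⟩ := h 0
  ⟨X, hP X fun _ _ => rfl⟩

end Choosable

theorem choosable_sliceBoxes_perm (cpts : List Slice) (n : ℕ) (V : List Slice)
    (hV : ∀ sl ∈ V, Slice.Allowed cpts sl) :
    Choosable n (n + cpts.length + 1) fun X =>
      (sliceBoxes X cpts n ++ List.replicate (X (n + cpts.length)) []).Perm V := by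
  classical
  induction cpts generalizing n V with
  | nil =>
    have hV_eq : V = List.replicate V.length [] :=
      List.eq_replicate_of_mem fun sl hsl => (hV sl hsl).resolve_left (by simp)
    refine (Choosable.apply_eq n V.length).imp fun X hX => ?_
    simp only [sliceBoxes, List.length_nil, Nat.add_zero, List.nil_append, hX, ← hV_eq]
    exact List.Perm.refl _
  | cons sl cpts ih =>
    have hrest : ∀ s ∈ V.filter fun s => !(s == sl), Slice.Allowed cpts s := by
      intro s hs
      simp only [List.mem_filter, Bool.not_eq_true', beq_eq_false_iff_ne] at hs
      exact (hV s hs.1).imp_left fun h => (List.mem_cons.1 h).resolve_left hs.2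
    rw [List.length_cons, show n + (cpts.length + 1) = n + 1 + cpts.length by omega]
    refine ((Choosable.apply_eq n (V.count sl)).and (ih (n + 1) _ hrest) (by omega)
      (by omega)).imp fun X hX => ?_
    rw [sliceBoxes, hX.1, ← List.filter_beq, List.append_assoc]
    exact (hX.2.append_left _).trans (List.filter_append_perm (fun s => s == sl) V)

theorem choosable_addedBoxes_perm (M : Term) (B : List (Entry E)) (Γ : GTy σ)
    (cpts : List Slice) (A : List Row) (n : ℕ) {V : List Slice}
    (hV : ∀ sl ∈ V, Slice.Allowed cpts sl) (hM : M.isVar = true → V = []) :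
    Choosable n (box M B Γ cpts A n).next fun X => (addedBoxes X M cpts n).Perm V := by
  simp only [box, addedBoxes]
  split_ifs with hvar
  · exact .of_forall fun _ => by rw [hM hvar]
  · simpa only [boxSlices_next] using choosable_sliceBoxes_perm cpts n V hV

theorem le_process_next (σ : STy ι) (n : ℕ) : n ≤ (process σ n).2 := by
  induction σ generalizing n with
  | atom _ => exact Nat.le_succ n
  | arr σ τ ih₁ ih₂ => exact (Nat.le_succ n).trans ((ih₁ _).trans (ih₂ _))

theorem choosable_process_inst_eq (A : Formula ι) (hA : A.erase = σ) (n : ℕ) :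
    Choosable n (process σ n).2 fun X => (process σ n).1.inst X = A := by
  induction σ generalizing A n with
  | atom a =>
    obtain ⟨m, A₀, rfl, hcore⟩ := A.exists_eq_iterate_bang
    rw [Formula.erase_iterate_bang] at hA
    refine (Choosable.apply_eq n m).imp fun X hX => ?_
    cases A₀ with
    | atom b =>
      obtain rfl := STy.atom.inj hA
      simp [process, GTy.inst, hX]
    | lolli A B => cases hA
    | bang A => exact hcore.elim
  | arr σ τ ih₁ ih₂ =>
    obtain ⟨m, A₀, rfl, hcore⟩ := A.exists_eq_iterate_bang
    rw [Formula.erase_iterate_bang] at hA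
    cases A₀ with
    | atom b => cases hA
    | bang A => exact hcore.elim
    | lolli A B =>
      obtain ⟨hA, hB⟩ := STy.arr.inj hA
      have hle₁ := le_process_next σ (n + 1)
      have hle₂ := le_process_next τ (process σ (n + 1)).2
      refine (((Choosable.apply_eq n m).and (ih₁ A hA _) (by omega) hle₁).and (ih₂ B hB _)
        (by omega) hle₂).imp fun X hX => ?_
      simp [process, GTy.inst, hX]

end

/-! ### Critical points and their identities -/

section

variable {ι : Type*} {E : ℕ → STy ι} {σ τ : STy ι} {X : ℕ → ℕ}

/-- All identities in the slice are numbers from `m` to `n - 1`. -/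
def Slice.InRange (m n : ℕ) (sl : Slice) : Prop :=
  ∀ p ∈ sl, (m ≤ p.1 ∧ p.1 < n) ∧ ∀ o ∈ p.2, m ≤ o ∧ o < n

theorem Slice.InRange.hasRow_eq_false {m n : ℕ} {sl : Slice} (h : sl.InRange m n) {i : ℕ}
    (hi : i < m ∨ n ≤ i) : sl.hasRow i = false := by
  simp only [Slice.hasRow, List.any_eq_false, beq_iff_eq]
  intro p hp hpi
  have := (h p hp).1
  omega

theorem Slice.InRange.hasOcc_eq_false {m n : ℕ} {sl : Slice} (h : sl.InRange m n) {o : ℕ}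
    (ho : o < m ∨ n ≤ o) : sl.hasOcc o = false := by
  simp only [Slice.hasOcc, List.any_eq_false, List.contains_iff_mem]
  intro p hp hpo
  have := (h p hp).2 o hpo
  omega

theorem Slice.InRange.mono {m n m' n' : ℕ} {sl : Slice} (h : sl.InRange m n) (hm : m' ≤ m)
    (hn : n ≤ n') : sl.InRange m' n' := fun p hp =>
  ⟨⟨hm.trans (h p hp).1.1, (h p hp).1.2.trans_le hn⟩, fun o ho =>
    ⟨hm.trans ((h p hp).2 o ho).1, ((h p hp).2 o ho).2.trans_le hn⟩⟩

theorem Slice.InRange.append {m n : ℕ} {s t : Slice} (hs : s.InRange m n) (ht : t.InRange m n) :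
    Slice.InRange m n (s ++ t) := fun p hp => (List.mem_append.1 hp).elim (hs p) (ht p)

/-- The slice with a single critical point. -/
def Slice.point (i : ℕ) (os : List ℕ) : Slice := [(i, os)]

theorem Slice.hasRow_point (i : ℕ) (os : List ℕ) (j : ℕ) :
    (Slice.point i os).hasRow j = (i == j) := by simp [Slice.hasRow, Slice.point]

theorem Slice.hasOcc_point (i : ℕ) (os : List ℕ) (o : ℕ) :
    (Slice.point i os).hasOcc o = os.contains o := by simp [Slice.hasOcc, Slice.point]

theorem Slice.inRange_point {m n i : ℕ} {os : List ℕ} (hi : m ≤ i ∧ i < n)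
    (ho : ∀ o ∈ os, m ≤ o ∧ o < n) : (Slice.point i os).InRange m n := by
  intro p hp
  obtain rfl := List.mem_singleton.1 hp
  exact ⟨hi, ho⟩

/-- The boxes that do not pass through the critical point of row `k`. -/
def unmarked (k : ℕ) (W : List Slice) : List Slice := W.filter fun sl => !sl.hasRow k

theorem length_unmarked_add_countP (k : ℕ) (W : List Slice) :
    (unmarked k W).length + W.countP (fun sl => sl.hasRow k) = W.length := by
  rw [unmarked, ← List.countP_eq_length_filter, Nat.add_comm,
    List.length_eq_countP_add_countP fun sl : Slice => sl.hasRow k]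
  simp only [Bool.not_eq_true, Bool.decide_eq_false]

namespace Synth

/-- The synthesized data uses only identities from `n` on. -/
structure InRange (n : ℕ) (r : Synth E σ) : Prop where
  le : n ≤ r.next
  occ : ∀ e ∈ r.base, n ≤ e.occ ∧ e.occ < r.next
  row : ∀ a ∈ r.rows, n ≤ a.id ∧ a.id < r.next
  slice : ∀ sl ∈ r.cpts, sl.InRange n r.next

theorem InRange.allowed {n : ℕ} {r : Synth E σ} (h : r.InRange n) {sl : Slice}
    (hsl : Slice.Allowed r.cpts sl) : sl.InRange n r.next := by
  rcases hsl with hsl | rfl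
  · exact h.slice sl hsl
  · exact fun p hp => absurd hp List.not_mem_nil

theorem InRange.mem_occurrences {n : ℕ} {r : Synth E σ} (h : r.InRange n) {o : ℕ}
    (ho : o ∈ occurrences r.base) : n ≤ o ∧ o < r.next := by
  obtain ⟨e, he, rfl⟩ := List.mem_map.1 ho
  exact h.occ e he

/-- The rows hold, and the types of the variable occurrences are given by `T`, when the boxes `W`
are put around the term. -/
def Fits (X : ℕ → ℕ) (W : List Slice) (r : Synth E σ) (T : ℕ → Formula ι) : Prop :=
  RowsHold X W r.rows ∧ BaseFits X W r.base T

theorem Fits.perm {W W' : List Slice} {r : Synth E σ} {T : ℕ → Formula ι} (h : r.Fits X W T)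
    (hW : W.Perm W') : r.Fits X W' T := ⟨h.1.perm hW, h.2.perm hW⟩

theorem InRange.fits_map_congr {α : Type*} {n : ℕ} {r : Synth E σ} (hr : r.InRange n)
    {Z : List α} {f g : α → Slice} {T : ℕ → Formula ι}
    (hfg : ∀ z ∈ Z, ∀ i, n ≤ i → i < r.next →
      (f z).hasRow i = (g z).hasRow i ∧ (f z).hasOcc i = (g z).hasOcc i) :
    r.Fits X (Z.map f) T ↔ r.Fits X (Z.map g) T := by
  refine and_congr (forall₂_congr fun a ha => ?_) (forall₂_congr fun e he => ?_)
  · rw [List.countP_map, List.countP_map, List.countP_congr fun z hz => ?_]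
    simp only [Function.comp, (hfg z hz _ (hr.row a ha).1 (hr.row a ha).2).1]
  · rw [List.countP_map, List.countP_map, List.countP_congr fun z hz => ?_]
    simp only [Function.comp, (hfg z hz _ (hr.occ e he).1 (hr.occ e he).2).2]

/-- The synthesized data after boxing. Boxing only uses the slices, it does not change them. -/
def boxed (M : Term) (r : Synth E σ) : Synth E σ :=
  let bx := box M r.base r.ty r.cpts r.rows r.next
  ⟨bx.ty, bx.base, bx.rows, r.cpts, bx.next⟩

/-- The boxes that boxing adds. -/
def added (X : ℕ → ℕ) (M : Term) (r : Synth E σ) : List Slice :=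
  addedBoxes X M r.cpts r.next

theorem fits_boxed {M : Term} {r : Synth E σ} {W : List Slice} {T : ℕ → Formula ι} :
    (r.boxed M).Fits X W T ↔ r.Fits X (W ++ r.added X M) T :=
  and_congr (rowsHold_box ..) (baseFits_box ..)

theorem inst_boxed_ty (M : Term) (r : Synth E σ) :
    (r.boxed M).ty.inst X = Formula.bang^[(r.added X M).length] (r.ty.inst X) :=
  inst_box_ty ..

theorem le_boxed_next (M : Term) (r : Synth E σ) : r.next ≤ (r.boxed M).next := le_box_next ..

theorem occurrences_boxed (M : Term) (r : Synth E σ) :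
    occurrences (r.boxed M).base = occurrences r.base := occurrences_box ..

theorem map_var_boxed_base (M : Term) (r : Synth E σ) :
    (r.boxed M).base.map Entry.var = r.base.map Entry.var := map_var_base_box ..

theorem InRange.boxed {n : ℕ} {r : Synth E σ} (h : r.InRange n) (M : Term) :
    (r.boxed M).InRange n where
  le := h.le.trans (le_boxed_next M r)
  occ := (forall_mem_box_base (p := fun _ o => n ≤ o ∧ o < (r.boxed M).next) ..).2 fun e he =>
    ⟨(h.occ e he).1, (h.occ e he).2.trans_le (le_boxed_next M r)⟩
  row := by
    have hids : ∀ i ∈ r.rows.map Row.id, n ≤ i ∧ i < (r.boxed M).next :=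
      List.forall_mem_map.2 fun a ha =>
        ⟨(h.row a ha).1, (h.row a ha).2.trans_le (le_boxed_next M r)⟩
    rw [← map_id_rows_box M r.base r.ty r.cpts r.rows r.next] at hids
    exact List.forall_mem_map.1 hids
  slice sl hsl := (h.slice sl hsl).mono le_rfl (le_boxed_next M r)

/-- The slices of a subterm, together with the critical point between row `k` and all its free
variable occurrences if `p` holds. -/
def marked (p : Bool) (k : ℕ) (r : Synth E σ) : List Slice :=
  if p then r.cpts ++ [Slice.point k (occurrences r.base)] else r.cpts

theorem allowed_marked {p : Bool} {k : ℕ} {r : Synth E σ} {sl : Slice} :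
    Slice.Allowed (r.marked p k) sl ↔
      Slice.Allowed r.cpts sl ∨ p = true ∧ sl = Slice.point k (occurrences r.base) := by
  cases p <;> simp [marked, Slice.Allowed, or_right_comm]

section Marked

variable {n k : ℕ} {p : Bool} {r : Synth E σ} {sl : Slice} {W : List Slice}

theorem InRange.marked (hr : r.InRange n) (hk : r.next ≤ k)
    (hsl : Slice.Allowed (r.marked p k) sl) : sl.InRange n (k + 1) := by
  rcases allowed_marked.1 hsl with h | ⟨-, rfl⟩
  · exact (hr.allowed h).mono le_rfl (by omega)
  · refine Slice.inRange_point ⟨hr.le.trans hk, k.lt_succ_self⟩ fun o ho => ?_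
    have := hr.mem_occurrences ho
    omega

theorem InRange.marked_hasRow_eq_false (hr : r.InRange n)
    (hsl : Slice.Allowed (r.marked p k) sl) {i : ℕ} (hi : r.next ≤ i) (hik : i ≠ k) :
    sl.hasRow i = false := by
  rcases allowed_marked.1 hsl with h | ⟨-, rfl⟩
  · exact (hr.allowed h).hasRow_eq_false (.inr hi)
  · simpa [Slice.hasRow_point] using hik.symm

theorem InRange.marked_hasOcc_eq_false (hr : r.InRange n)
    (hsl : Slice.Allowed (r.marked p k) sl) {o : ℕ} (ho : r.next ≤ o) : sl.hasOcc o = false := by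
  rcases allowed_marked.1 hsl with h | ⟨-, rfl⟩
  · exact (hr.allowed h).hasOcc_eq_false (.inr ho)
  · rw [Slice.hasOcc_point, List.contains_eq_mem, decide_eq_false_iff_not]
    exact fun h => (hr.mem_occurrences h).2.not_ge ho

theorem InRange.countP_hasRow_eq_zero (hr : r.InRange n) (hk : r.next ≤ k)
    (hW : ∀ sl ∈ W, Slice.Allowed (r.marked false k) sl) :
    W.countP (fun sl => sl.hasRow k) = 0 := by
  refine List.countP_eq_zero.2 fun sl hsl => ?_
  rw [(hr.allowed (hW sl hsl)).hasRow_eq_false (.inr hk)]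
  exact Bool.false_ne_true

theorem allowed_of_mem_unmarked (hW : ∀ sl ∈ W, Slice.Allowed (r.marked p k) sl) :
    ∀ sl ∈ unmarked k W, Slice.Allowed r.cpts sl := by
  intro sl hsl
  obtain ⟨hsl, hk⟩ := List.mem_filter.1 hsl
  refine (allowed_marked.1 (hW sl hsl)).resolve_right ?_
  rintro ⟨-, rfl⟩
  simp [Slice.hasRow_point] at hk

theorem InRange.countP_not_hasOcc_unmarked (hr : r.InRange n) (hk : r.next ≤ k)
    (hW : ∀ sl ∈ W, Slice.Allowed (r.marked p k) sl) {o : ℕ} (ho : o ∈ occurrences r.base) :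
    (unmarked k W).countP (fun sl => !sl.hasOcc o) = W.countP fun sl => !sl.hasOcc o := by
  rw [unmarked, List.countP_filter]
  refine List.countP_congr fun sl hsl => ?_
  rcases allowed_marked.1 (hW sl hsl) with h | ⟨-, rfl⟩
  · simp [(hr.allowed h).hasRow_eq_false (.inr hk)]
  · simp [Slice.hasOcc_point, ho]

theorem InRange.fits_unmarked {T : ℕ → Formula ι} (hr : r.InRange n) (hk : r.next ≤ k)
    (hW : ∀ sl ∈ W, Slice.Allowed (r.marked p k) sl) :
    r.Fits X (unmarked k W) T ↔ r.Fits X W T := by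
  refine and_congr (forall₂_congr fun a ha => ?_) (forall₂_congr fun e he => ?_)
  · have hcount : (unmarked k W).countP (fun sl => sl.hasRow a.id) =
        W.countP fun sl => sl.hasRow a.id := by
      rw [unmarked, List.countP_filter]
      refine List.countP_congr fun sl hsl => ?_
      rcases allowed_marked.1 (hW sl hsl) with h | ⟨-, rfl⟩
      · simp [(hr.allowed h).hasRow_eq_false (.inr hk)]
      · have := (hr.row a ha).2
        simp only [Slice.hasRow_point, Bool.and_eq_true, beq_iff_eq]
        omega
    rw [hcount]
  · rw [hr.countP_not_hasOcc_unmarked hk hW (List.mem_map_of_mem he)]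

end Marked

end Synth

/-! ### The meaning of type synthesis for applications -/

theorem newRows_cons (m : ℕ) (c : Constraint) (cs : List Constraint) :
    newRows m (c :: cs) = ⟨m, c⟩ :: newRows (m + 1) cs := by
  simp [newRows, List.mapIdx_cons, Nat.add_comm, Nat.add_left_comm]

theorem mem_newRows {m : ℕ} {cs : List Constraint} {a : Row} (h : a ∈ newRows m cs) :
    m ≤ a.id ∧ a.id < m + cs.length := by
  simp only [newRows, List.mem_mapIdx] at h
  obtain ⟨i, hi, rfl⟩ := h
  simp only
  omega

theorem rowsHold_newRows {W : List Slice} {m : ℕ} {cs : List Constraint}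
    (h : ∀ sl ∈ W, ∀ i, m ≤ i → i < m + cs.length → Slice.hasRow sl i = false) :
    RowsHold X W (newRows m cs) ↔ Solves X cs := by
  induction cs generalizing m with
  | nil => simp [newRows, RowsHold, Solves]
  | cons c cs ih =>
    have hzero : W.countP (fun sl => sl.hasRow m) = 0 :=
      List.countP_eq_zero.2 fun sl hsl => by
        simp [h sl hsl m le_rfl (by simp)]
    have htail := ih (m := m + 1) fun sl hsl i hi hi' => h sl hsl i (by omega) (by
      simp only [List.length_cons]; omega)
    rw [newRows_cons, solves_cons, ← htail, RowsHold, List.forall_mem_cons, hzero,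
      Constraint.holdsSub_zero]
    rfl

namespace Synth

section App

variable (p q : Bool) (r : Synth E (.arr σ τ)) (s : Synth E σ)

/-- The equations between the type `s.ty` of the argument and the domain of the function `r`; `q`
says whether the argument is an application. -/
def appUnify : List Constraint :=
  if q then unify σ [s.ty, r.ty.dom] else unify σ [r.ty.dom, s.ty]

/-- The identity of the row for the outermost exponent of the type of the function. -/
def appKey : ℕ := s.next + (appUnify q r s).length

/-- Type synthesis for an application whose head and argument have the data `r` and `s`, where `s`
has already been boxed; `p` and `q` say whether the head and the argument are applications. -/
def app : Synth E τ :=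
  ⟨r.ty.cod, r.base ++ s.base,
    r.rows ++ s.rows ++ newRows s.next (appUnify q r s) ++
      [⟨appKey q r s, .eq r.ty.outer []⟩],
    productUnion (r.marked p (appKey q r s)) (s.marked q s.next), appKey q r s + 1⟩

theorem synthApp_eq_app (M N : Term) (r : Synth E (.arr σ τ)) (s : Synth E σ) :
    synthApp M N r s = app M.isApp N.isApp r (s.boxed N) := by
  rw [app, marked, marked, occurrences_boxed]
  rfl

variable {p q r s}

theorem exists_appUnify_eq (q : Bool) (r : Synth E (.arr σ τ)) (s : Synth E σ) :
    ∃ c cs, appUnify q r s = c :: cs ∧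
      (∀ X, Solves X cs ↔ s.ty.core X = r.ty.dom.core X) ∧
      ∀ X k, (q = false → k = 0) → (c.HoldsSub X k ↔
        (s.ty.outer.map X).sum = (r.ty.dom.outer.map X).sum + k) := by
  cases q with
  | true =>
    obtain ⟨cs, hunify, hcs⟩ := exists_unify_pair_eq s.ty r.ty.dom
    exact ⟨_, cs, hunify, hcs, fun X k _ => Iff.rfl⟩
  | false =>
    obtain ⟨cs, hunify, hcs⟩ := exists_unify_pair_eq r.ty.dom s.ty
    refine ⟨_, cs, hunify, fun X => (hcs X).trans eq_comm, fun X k hk => ?_⟩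
    obtain rfl := hk rfl
    simp only [Constraint.HoldsSub, Nat.add_zero, eq_comm]

theorem next_lt_appKey : s.next < appKey q r s := by
  obtain ⟨c, cs, h, -⟩ := exists_appUnify_eq q r s
  simp [appKey, h]

/-- The left components are boxes around the head, and the right components are boxes around the
argument, of an application. -/
def SlicePairs (p q : Bool) (r : Synth E (.arr σ τ)) (s : Synth E σ)
    (Z : List (Slice × Slice)) : Prop :=
  ∀ z ∈ Z, Slice.Allowed (r.marked p (appKey q r s)) z.1 ∧ Slice.Allowed (s.marked q s.next) z.2

theorem exists_slicePairs {W : List Slice} (hW : ∀ sl ∈ W, Slice.Allowed (app p q r s).cpts sl) :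
    ∃ Z, SlicePairs p q r s Z ∧ W = Z.map fun z => z.1 ++ z.2 := by
  induction W with
  | nil => exact ⟨[], fun z hz => absurd hz List.not_mem_nil, rfl⟩
  | cons sl W ih =>
    obtain ⟨hsl, hW⟩ := List.forall_mem_cons.1 hW
    obtain ⟨Z, hZ, rfl⟩ := ih hW
    obtain ⟨t, u, ht, hu, rfl⟩ := Slice.allowed_productUnion.1 hsl
    exact ⟨(t, u) :: Z, List.forall_mem_cons.2 ⟨⟨ht, hu⟩, hZ⟩, rfl⟩

variable {n : ℕ} {Z : List (Slice × Slice)}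

theorem SlicePairs.head (hZ : SlicePairs p q r s Z) :
    ∀ sl ∈ Z.map Prod.fst, Slice.Allowed (r.marked p (appKey q r s)) sl :=
  List.forall_mem_map.2 fun z hz => (hZ z hz).1

theorem SlicePairs.argument (hZ : SlicePairs p q r s Z) :
    ∀ sl ∈ Z.map Prod.snd, Slice.Allowed (s.marked q s.next) sl :=
  List.forall_mem_map.2 fun z hz => (hZ z hz).2

theorem SlicePairs.fits_head {T : ℕ → Formula ι} (hZ : SlicePairs p q r s Z) (hr : r.InRange n)
    (hs : s.InRange r.next) :
    r.Fits X (Z.map fun z => z.1 ++ z.2) T ↔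
      r.Fits X (unmarked (appKey q r s) (Z.map Prod.fst)) T := by
  rw [hr.fits_unmarked (hs.le.trans next_lt_appKey.le) hZ.head]
  refine hr.fits_map_congr fun z hz i _ hi => ?_
  have hz₂ := hs.marked le_rfl (hZ z hz).2
  rw [Slice.hasRow_append, Slice.hasOcc_append, hz₂.hasRow_eq_false (.inl hi),
    hz₂.hasOcc_eq_false (.inl hi), Bool.or_false, Bool.or_false]
  exact ⟨rfl, rfl⟩

theorem SlicePairs.fits_argument {T : ℕ → Formula ι} (hZ : SlicePairs p q r s Z)
    (hr : r.InRange n) (hs : s.InRange r.next) :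
    s.Fits X (Z.map fun z => z.1 ++ z.2) T ↔
      s.Fits X (unmarked s.next (Z.map Prod.snd)) T := by
  rw [hs.fits_unmarked le_rfl hZ.argument]
  refine hs.fits_map_congr fun z hz i hi hi' => ?_
  rw [Slice.hasRow_append, Slice.hasOcc_append, hr.marked_hasOcc_eq_false (hZ z hz).1 hi,
    hr.marked_hasRow_eq_false (hZ z hz).1 hi (hi'.trans next_lt_appKey).ne, Bool.false_or,
    Bool.false_or]
  exact ⟨rfl, rfl⟩

theorem SlicePairs.rowsHold_appKey (hZ : SlicePairs p q r s Z) (hs : s.InRange r.next) :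
    RowsHold X (Z.map fun z => z.1 ++ z.2) [⟨appKey q r s, .eq r.ty.outer []⟩] ↔
      Formula.bang^[(unmarked (appKey q r s) (Z.map Prod.fst)).length] (r.ty.inst X) =
        Formula.bang^[Z.length] (.lolli (r.ty.dom.inst X) (r.ty.cod.inst X)) := by
  have hkey := next_lt_appKey (q := q) (r := r) (s := s)
  have hcount : (Z.map fun z => z.1 ++ z.2).countP (fun sl => sl.hasRow (appKey q r s)) =
      (Z.map Prod.fst).countP fun sl => sl.hasRow (appKey q r s) := by
    rw [List.countP_map, List.countP_map]
    refine List.countP_congr fun z hz => ?_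
    simp only [Function.comp, Slice.hasRow_append,
      hs.marked_hasRow_eq_false (hZ z hz).2 hkey.le hkey.ne', Bool.or_false]
  have hlen := length_unmarked_add_countP (appKey q r s) (Z.map Prod.fst)
  rw [List.length_map] at hlen
  rw [RowsHold, List.forall_mem_singleton, hcount, ← GTy.core_eq_lolli]
  simp only [Constraint.HoldsSub, List.map_nil, List.sum_nil, Nat.zero_add]
  rw [GTy.inst_eq, ← Function.iterate_add_apply]
  constructor
  · intro h
    rw [h, hlen]
  · intro h
    have := (Formula.iterate_bang_inj (GTy.isCore_core _) (GTy.isCore_core _) h).1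
    omega

theorem SlicePairs.rowsHold_appUnify (hZ : SlicePairs p q r s Z) (hr : r.InRange n)
    (hs : s.InRange r.next) :
    RowsHold X (Z.map fun z => z.1 ++ z.2) (newRows s.next (appUnify q r s)) ↔
      Formula.bang^[(unmarked s.next (Z.map Prod.snd)).length] (s.ty.inst X) =
        Formula.bang^[Z.length] (r.ty.dom.inst X) := by
  have hkey := next_lt_appKey (q := q) (r := r) (s := s)
  have hcount : (Z.map fun z => z.1 ++ z.2).countP (fun sl => sl.hasRow s.next) =
      (Z.map Prod.snd).countP fun sl => sl.hasRow s.next := by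
    rw [List.countP_map, List.countP_map]
    refine List.countP_congr fun z hz => ?_
    simp only [Function.comp, Slice.hasRow_append,
      hr.marked_hasRow_eq_false (hZ z hz).1 hs.le hkey.ne, Bool.false_or]
  have hlen := length_unmarked_add_countP s.next (Z.map Prod.snd)
  rw [List.length_map] at hlen
  have hzero (hq : q = false) : (Z.map Prod.snd).countP (fun sl => sl.hasRow s.next) = 0 := by
    subst hq
    exact hs.countP_hasRow_eq_zero le_rfl hZ.argument
  obtain ⟨c, cs, hunify, hcs, hc⟩ := exists_appUnify_eq q r s
  have htail : RowsHold X (Z.map fun z => z.1 ++ z.2) (newRows (s.next + 1) cs) ↔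
      Solves X cs := by
    have hlt : appKey q r s = s.next + 1 + cs.length := by
      rw [appKey, hunify, List.length_cons, Nat.add_right_comm, Nat.add_assoc]
    refine rowsHold_newRows (List.forall_mem_map.2 fun z hz i hi hi' => ?_)
    have hle := hs.le
    rw [Slice.hasRow_append, hr.marked_hasRow_eq_false (hZ z hz).1 (by omega) (by omega),
      hs.marked_hasRow_eq_false (hZ z hz).2 (by omega) (by omega), Bool.false_or]
  rw [hunify, newRows_cons, GTy.iterate_bang_inst_eq_iff, ← hcs, ← htail, RowsHold,
    List.forall_mem_cons, hcount, hc _ _ hzero]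
  refine and_congr_left fun _ => ?_
  omega

theorem fits_app {T : ℕ → Formula ι} (hr : r.InRange n) (hs : s.InRange r.next)
    (hZ : SlicePairs p q r s Z) :
    (app p q r s).Fits X (Z.map fun z => z.1 ++ z.2) T ↔
      (r.Fits X (unmarked (appKey q r s) (Z.map Prod.fst)) T ∧
        s.Fits X (unmarked s.next (Z.map Prod.snd)) T) ∧
      Formula.bang^[(unmarked (appKey q r s) (Z.map Prod.fst)).length] (r.ty.inst X) =
        Formula.bang^[Z.length] (.lolli (r.ty.dom.inst X) (r.ty.cod.inst X)) ∧
      Formula.bang^[(unmarked s.next (Z.map Prod.snd)).length] (s.ty.inst X) =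
        Formula.bang^[Z.length] (r.ty.dom.inst X) := by
  rw [← hZ.fits_head hr hs, ← hZ.fits_argument hr hs, ← hZ.rowsHold_appKey hs,
    ← hZ.rowsHold_appUnify hr hs]
  simp only [Fits, app, rowsHold_append, baseFits_append]
  tauto

theorem inRange_app (hr : r.InRange n) (hs : s.InRange r.next) : (app p q r s).InRange n := by
  have hkey := next_lt_appKey (q := q) (r := r) (s := s)
  have hn := hr.le
  have hle := hs.le
  refine ⟨?_, fun e he => ?_, fun a ha => ?_, fun sl hsl => ?_⟩ <;> simp only [app]
  · omega
  · rcases List.mem_append.1 he with he | he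
    · have := hr.occ e he; omega
    · have := hs.occ e he; omega
  · simp only [app, List.mem_append, List.mem_singleton] at ha
    rcases ha with ((ha | ha) | ha) | rfl
    · have := hr.row a ha; omega
    · have := hs.row a ha; omega
    · have := mem_newRows ha
      rw [← appKey] at this
      omega
    · simp only; omega
  · obtain ⟨t, u, ht, hu, rfl⟩ := Slice.allowed_productUnion.1 (.inl hsl)
    exact (hr.marked (hle.trans hkey.le) ht).append
      ((hs.marked le_rfl hu).mono hn (by omega))

end App

end Synth

end

/-! ### The meaning of type synthesis for abstractions -/

section

variable {ι : Type*} {E : ℕ → STy ι} {σ τ : STy ι} {X : ℕ → ℕ}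

theorem mem_boundTypes {B : List (Entry (envCons σ E))} {Θ : GTy σ} :
    Θ ∈ boundTypes B ↔ ∃ o, (⟨0, o, Θ⟩ : Entry (envCons σ E)) ∈ B := by
  simp only [boundTypes, List.mem_filterMap]
  constructor
  · rintro ⟨⟨_ | x, o, Θ'⟩, he, h⟩ <;> cases h
    exact ⟨o, he⟩
  · rintro ⟨o, h⟩
    exact ⟨_, h, rfl⟩

theorem mem_boundOccs {B : List (Entry (envCons σ E))} {o : ℕ} :
    o ∈ boundOccs B ↔ ∃ Θ : GTy σ, (⟨0, o, Θ⟩ : Entry (envCons σ E)) ∈ B := by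
  simp only [boundOccs, List.mem_filterMap]
  constructor
  · rintro ⟨⟨_ | x, o', Θ⟩, he, h⟩ <;> cases h
    exact ⟨Θ, he⟩
  · rintro ⟨Θ, h⟩
    exact ⟨_, h, rfl⟩

theorem mem_unbound {B : List (Entry (envCons σ E))} {x o : ℕ} {Θ : GTy (E x)} :
    (⟨x, o, Θ⟩ : Entry E) ∈ unbound B ↔ (⟨x + 1, o, Θ⟩ : Entry (envCons σ E)) ∈ B := by
  simp only [unbound, List.mem_filterMap]
  constructor
  · rintro ⟨⟨_ | y, o', Θ'⟩, he, h⟩ <;> cases h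
    exact he
  · intro h
    exact ⟨_, h, rfl⟩

theorem length_boundTypes (B : List (Entry (envCons σ E))) :
    (boundTypes B).length = (B.map Entry.var).count 0 := by
  induction B with
  | nil => rfl
  | cons e B ih =>
    rcases e with ⟨_ | x, _, _⟩
    · exact (congrArg Nat.succ ih).trans List.count_cons_self.symm
    · exact ih.trans (List.count_cons_of_ne x.succ_ne_zero).symm

theorem map_var_unbound (B : List (Entry (envCons σ E))) :
    (unbound B).map Entry.var = lower (B.map Entry.var) := by
  induction B with
  | nil => rfl
  | cons e B ih =>
    rcases e with ⟨_ | x, _, _⟩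
    · exact ih
    · exact congrArg (x :: ·) ih

theorem baseFits_scons {W : List Slice} {B : List (Entry (envCons σ E))} {t : Formula ι}
    {T : ℕ → Formula ι} : BaseFits X W B (scons t T) ↔ BaseFits X W (unbound B) T ∧
      ∀ (o : ℕ) (Θ : GTy σ), (⟨0, o, Θ⟩ : Entry (envCons σ E)) ∈ B →
        Formula.bang^[W.countP fun sl => !sl.hasOcc o] (Θ.inst X) = t := by
  constructor
  · exact fun h => ⟨fun e he => h _ (mem_unbound.1 he), fun o Θ he => h _ he⟩
  · rintro ⟨hfree, hbound⟩ ⟨_ | x, o, Θ⟩ he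
    · exact hbound o Θ he
    · exact hfree _ (mem_unbound.2 he)

theorem baseFits_scons_of_boundTypes_eq_nil {W : List Slice} {B : List (Entry (envCons σ E))}
    (hB : boundTypes B = []) (t : Formula ι) {T : ℕ → Formula ι} :
    BaseFits X W B (scons t T) ↔ BaseFits X W (unbound B) T :=
  baseFits_scons.trans <| and_iff_left fun o _ he =>
    absurd (hB ▸ mem_boundTypes.2 ⟨o, he⟩) List.not_mem_nil

namespace Synth

section Lam

variable {s : Synth (envCons σ E) τ} {n : ℕ} {W : List Slice} {T : ℕ → Formula ι}

/-- The slices that remain when a variable which occurs in the body is abstracted. -/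
def keptSlices (s : Synth (envCons σ E) τ) : List Slice :=
  s.cpts.filter fun sl => !(boundOccs s.base).any sl.hasOcc

/-- The processed type of an abstracted variable which does not occur in the body. -/
def dummyType (s : Synth (envCons σ E) τ) : GTy σ × ℕ := process σ s.next

/-- Type synthesis for the abstraction of a variable whose occurrences in the body have the types
`Θ` and `Θs`; `s` is the data of the body, which has already been boxed. -/
def lamOccurs (Θ : GTy σ) (Θs : List (GTy σ)) (s : Synth (envCons σ E) τ) : Synth E (.arr σ τ) :=
  ⟨.lolli [] Θ s.ty, unbound s.base, s.rows ++ newRows s.next (contraction (Θ :: Θs)),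
    s.keptSlices, s.next + (contraction (Θ :: Θs)).length⟩

/-- Type synthesis for the abstraction of a variable which does not occur in the body, if the body
is an application; `s` is the data of the body, which has already been boxed. -/
def lamApp (s : Synth (envCons σ E) τ) : Synth E (.arr σ τ) :=
  ⟨.lolli [] s.dummyType.1 (s.ty.setOuter [s.dummyType.2]), unbound s.base,
    s.rows ++ [⟨s.dummyType.2 + 1, .eq s.ty.outer [s.dummyType.2]⟩],
    s.marked true (s.dummyType.2 + 1), s.dummyType.2 + 2⟩

/-- Type synthesis for the abstraction of a variable which does not occur in the body, if the body
is not an application; `s` is the data of the body, which has already been boxed. -/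
def lamNotApp (s : Synth (envCons σ E) τ) : Synth E (.arr σ τ) :=
  ⟨.lolli [] s.dummyType.1 s.ty, unbound s.base, s.rows, s.cpts, s.dummyType.2⟩

theorem synthLam_eq_lamOccurs {M : Term} {r : Synth (envCons σ E) τ} {Θ : GTy σ}
    {Θs : List (GTy σ)} (hb : boundTypes (r.boxed M).base = Θ :: Θs) :
    synthLam M r = (r.boxed M).lamOccurs Θ Θs := by
  simp only [boxed] at hb
  simp only [synthLam, hb]
  rfl

theorem synthLam_eq_lamApp {M : Term} {r : Synth (envCons σ E) τ}
    (hb : boundTypes (r.boxed M).base = []) (hM : M.isApp = true) :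
    synthLam M r = (r.boxed M).lamApp := by
  simp only [boxed] at hb
  simp only [synthLam, hb, hM, if_true]
  rfl

theorem synthLam_eq_lamNotApp {M : Term} {r : Synth (envCons σ E) τ}
    (hb : boundTypes (r.boxed M).base = []) (hM : M.isApp = false) :
    synthLam M r = (r.boxed M).lamNotApp := by
  simp only [boxed] at hb
  simp only [synthLam, hb, hM]
  rfl

theorem next_le_dummyType : s.next ≤ s.dummyType.2 := le_process_next _ _

theorem allowed_keptSlices {sl : Slice} :
    Slice.Allowed s.keptSlices sl ↔
      Slice.Allowed s.cpts sl ∧ ∀ o ∈ boundOccs s.base, sl.hasOcc o = false := by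
  simp only [Slice.Allowed, keptSlices, List.mem_filter, Bool.not_eq_true', List.any_eq_false,
    Bool.not_eq_true, or_and_right]
  refine or_congr_right (and_iff_left_of_imp ?_).symm
  rintro rfl o -
  rfl

theorem countP_not_hasOcc_bound {o : ℕ} {Θ : GTy σ}
    (hW : ∀ sl ∈ W, Slice.Allowed s.keptSlices sl)
    (ho : (⟨0, o, Θ⟩ : Entry (envCons σ E)) ∈ s.base) :
    W.countP (fun sl => !sl.hasOcc o) = W.length :=
  List.countP_eq_length.2 fun sl hsl => by
    simp [(allowed_keptSlices.1 (hW sl hsl)).2 o (mem_boundOccs.2 ⟨Θ, ho⟩)]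

theorem forall_bound_inst_eq_iff {Θ : GTy σ} {Θs : List (GTy σ)}
    (hb : boundTypes s.base = Θ :: Θs) (hW : ∀ sl ∈ W, Slice.Allowed s.keptSlices sl) :
    (∀ (o : ℕ) (Θ' : GTy σ), (⟨0, o, Θ'⟩ : Entry (envCons σ E)) ∈ s.base →
      Formula.bang^[W.countP fun sl => !sl.hasOcc o] (Θ'.inst X) =
        Formula.bang^[W.length] (Θ.inst X)) ↔ ∀ Θ' ∈ Θs, Θ'.inst X = Θ.inst X := by
  constructor
  · intro h Θ' hΘ'
    obtain ⟨o, ho⟩ := mem_boundTypes.1 (hb ▸ List.mem_cons_of_mem _ hΘ')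
    have heq := h o Θ' ho
    rw [countP_not_hasOcc_bound hW ho] at heq
    exact Formula.iterate_bang_injective _ heq
  · intro h o Θ' ho
    rw [countP_not_hasOcc_bound hW ho]
    have hΘ' : Θ' ∈ Θ :: Θs := hb ▸ mem_boundTypes.2 ⟨o, ho⟩
    rcases List.mem_cons.1 hΘ' with rfl | hΘ'
    · rfl
    · rw [h Θ' hΘ']

theorem fits_lamOccurs {Θ : GTy σ} {Θs : List (GTy σ)} (hs : s.InRange n)
    (hb : boundTypes s.base = Θ :: Θs) (hW : ∀ sl ∈ W, Slice.Allowed s.keptSlices sl) :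
    (s.lamOccurs Θ Θs).Fits X W T ↔
      s.Fits X W (scons (Formula.bang^[W.length] (Θ.inst X)) T) ∧
        (Θs ≠ [] → ∃ A, Θ.inst X = .bang A) := by
  have hnew : RowsHold X W (newRows s.next (contraction (Θ :: Θs))) ↔
      Solves X (contraction (Θ :: Θs)) :=
    rowsHold_newRows fun sl hsl i hi _ =>
      (hs.allowed (allowed_keptSlices.1 (hW sl hsl)).1).hasRow_eq_false (.inr hi)
  simp only [Fits, lamOccurs, baseFits_scons, forall_bound_inst_eq_iff hb hW, rowsHold_append,
    hnew, solves_contraction]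
  tauto

theorem fits_lamNotApp (hb : boundTypes s.base = []) (t : Formula ι) :
    s.lamNotApp.Fits X W T ↔ s.Fits X W (scons t T) := by
  rw [Fits, Fits, baseFits_scons_of_boundTypes_eq_nil hb]
  rfl

theorem fits_lamApp (hs : s.InRange n) (hb : boundTypes s.base = [])
    (hW : ∀ sl ∈ W, Slice.Allowed (s.marked true (s.dummyType.2 + 1)) sl) (t : Formula ι) :
    s.lamApp.Fits X W T ↔ s.Fits X (unmarked (s.dummyType.2 + 1) W) (scons t T) ∧
      Formula.bang^[(unmarked (s.dummyType.2 + 1) W).length] (s.ty.inst X) =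
        Formula.bang^[W.length] ((s.ty.setOuter [s.dummyType.2]).inst X) := by
  have hlen := length_unmarked_add_countP (s.dummyType.2 + 1) W
  rw [hs.fits_unmarked (next_le_dummyType.trans (Nat.le_succ _)) hW, Fits, Fits,
    baseFits_scons_of_boundTypes_eq_nil hb, GTy.iterate_bang_inst_eq_iff, lamApp, rowsHold_append,
    GTy.core_setOuter, GTy.outer_setOuter, and_right_comm, and_iff_left rfl]
  refine and_congr_right fun _ => ?_
  rw [RowsHold, List.forall_mem_singleton, Constraint.HoldsSub]
  simp only [List.map_cons, List.map_nil, List.sum_cons, List.sum_nil, Nat.add_zero]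
  omega

theorem InRange.unbound_occ (hs : s.InRange n) :
    ∀ e ∈ unbound s.base, n ≤ e.occ ∧ e.occ < s.next :=
  fun _ he => hs.occ _ (mem_unbound.1 he)

theorem inRange_lamOccurs (hs : s.InRange n) (Θ : GTy σ) (Θs : List (GTy σ)) :
    (s.lamOccurs Θ Θs).InRange n where
  le := hs.le.trans (Nat.le_add_right ..)
  occ e he := (hs.unbound_occ e he).imp_right fun h => h.trans_le (Nat.le_add_right ..)
  row a ha := by
    rcases List.mem_append.1 ha with ha | ha
    · exact (hs.row a ha).imp_right fun h => h.trans_le (Nat.le_add_right ..)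
    · exact (mem_newRows ha).imp_left hs.le.trans
  slice sl hsl := (hs.slice sl (List.mem_filter.1 hsl).1).mono le_rfl (Nat.le_add_right ..)

theorem inRange_lamNotApp (hs : s.InRange n) : s.lamNotApp.InRange n where
  le := hs.le.trans next_le_dummyType
  occ e he := (hs.unbound_occ e he).imp_right fun h => h.trans_le next_le_dummyType
  row a ha := (hs.row a ha).imp_right fun h => h.trans_le next_le_dummyType
  slice sl hsl := (hs.slice sl hsl).mono le_rfl next_le_dummyType

theorem inRange_lamApp (hs : s.InRange n) : s.lamApp.InRange n := by
  have hle : s.next ≤ s.dummyType.2 := next_le_dummyType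
  have hlt : s.next ≤ s.dummyType.2 + 2 := by omega
  refine ⟨hs.le.trans hlt, fun e he => (hs.unbound_occ e he).imp_right fun h => h.trans_le hlt,
    fun a ha => ?_, fun sl hsl =>
      hs.marked (p := true) (hle.trans (Nat.le_succ _))
        (.inl (show sl ∈ s.marked true (s.dummyType.2 + 1) from hsl))⟩
  rcases List.mem_append.1 ha with ha | ha
  · exact (hs.row a ha).imp_right fun h => h.trans_le hlt
  · obtain rfl := List.mem_singleton.1 ha
    exact ⟨hs.le.trans (hle.trans (Nat.le_succ _)), Nat.lt_succ_self _⟩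

end Lam

theorem inRange_synthLam {M : Term} {r : Synth (envCons σ E) τ} {n : ℕ} (hr : r.InRange n) :
    (synthLam M r).InRange n := by
  cases hb : boundTypes (r.boxed M).base with
  | cons Θ Θs => exact synthLam_eq_lamOccurs hb ▸ inRange_lamOccurs (hr.boxed M) Θ Θs
  | nil =>
    cases hM : M.isApp with
    | true => exact synthLam_eq_lamApp hb hM ▸ inRange_lamApp (hr.boxed M)
    | false => exact synthLam_eq_lamNotApp hb hM ▸ inRange_lamNotApp (hr.boxed M)

theorem base_synthLam {M : Term} {r : Synth (envCons σ E) τ} :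
    (synthLam M r).base = unbound (r.boxed M).base := by
  cases hb : boundTypes (r.boxed M).base with
  | cons Θ Θs => rw [synthLam_eq_lamOccurs hb, lamOccurs]
  | nil =>
    cases hM : M.isApp with
    | true => rw [synthLam_eq_lamApp hb hM, lamApp]
    | false => rw [synthLam_eq_lamNotApp hb hM, lamNotApp]

end Synth

theorem inRange_synth {M : Term} (d : SDer E M σ) (n : ℕ) : (synth d n).InRange n := by
  induction d generalizing n with
  | var E x =>
    have hle : n ≤ (process (E x) n).2 := le_process_next (E x) n
    refine ⟨hle.trans (Nat.le_succ _), fun e he => ?_, fun a ha => absurd ha List.not_mem_nil,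
      fun sl hsl => absurd hsl List.not_mem_nil⟩
    obtain rfl := List.mem_singleton.1 he
    exact ⟨hle, Nat.lt_succ_self _⟩
  | lam d ih => exact Synth.inRange_synthLam (ih n)
  | @app E M N σ τ d₁ d₂ ih₁ ih₂ =>
    rw [synth, Synth.synthApp_eq_app]
    exact Synth.inRange_app (ih₁ n) ((ih₂ _).boxed N)

theorem map_var_base_synth {M : Term} (d : SDer E M σ) (n : ℕ) :
    (synth d n).base.map Entry.var = M.fvs := by
  induction d generalizing n with
  | var E x => rfl
  | @lam E M σ τ d ih =>
    rw [synth, Synth.base_synthLam, map_var_unbound, Synth.map_var_boxed_base, ih]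
    rfl
  | @app E M N σ τ d₁ d₂ ih₁ ih₂ =>
    rw [synth, Synth.synthApp_eq_app, Synth.app, List.map_append, Synth.map_var_boxed_base, ih₁,
      ih₂]
    rfl

end

/-! ### From solutions of the constraints to leveled typings -/

section

variable {ι : Type*} {E : ℕ → STy ι} {σ τ : STy ι} {X : ℕ → ℕ} {ℓ : ℕ → ℕ} {d n : ℕ}
  {W : List Slice} {M N : Term}

theorem mem_of_mem_sliceBoxes {cpts : List Slice} {sl : Slice} (h : sl ∈ sliceBoxes X cpts n) :
    sl ∈ cpts := by
  induction cpts generalizing n with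
  | nil => exact h
  | cons t cpts ih =>
    rcases List.mem_append.1 h with h | h
    · exact List.mem_cons.2 (.inl (List.eq_of_mem_replicate h))
    · exact List.mem_cons_of_mem _ (ih h)

theorem allowed_of_mem_addedBoxes {cpts : List Slice} {sl : Slice}
    (h : sl ∈ addedBoxes X M cpts n) : Slice.Allowed cpts sl := by
  rw [addedBoxes] at h
  split_ifs at h
  · exact absurd h List.not_mem_nil
  · exact (List.mem_append.1 h).imp mem_of_mem_sliceBoxes List.eq_of_mem_replicate

/-- When the boxes `W` are put around a term, every occurrence of a variable `x` ends up inside at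
least `ℓ x` of them. -/
def BaseLevels (ℓ : ℕ → ℕ) (W : List Slice) (B : List (Entry E)) : Prop :=
  ∀ e ∈ B, ℓ e.var ≤ W.countP fun sl => !sl.hasOcc e.occ

theorem BaseLevels.le_length {B : List (Entry E)} (h : BaseLevels ℓ W B) :
    ∀ x ∈ B.map Entry.var, ℓ x ≤ W.length :=
  List.forall_mem_map.2 fun e he => (h e he).trans List.countP_le_length

theorem baseLevels_scons {B : List (Entry (envCons σ E))} :
    BaseLevels (scons d ℓ) W B ↔ BaseLevels ℓ W (unbound B) ∧
      ∀ (o : ℕ) (Θ : GTy σ), (⟨0, o, Θ⟩ : Entry (envCons σ E)) ∈ B →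
        d ≤ W.countP fun sl => !sl.hasOcc o := by
  constructor
  · exact fun h => ⟨fun e he => h _ (mem_unbound.1 he), fun o Θ he => h _ he⟩
  · rintro ⟨hfree, hbound⟩ ⟨_ | x, o, Θ⟩ he
    · exact hbound o Θ he
    · exact hfree _ (mem_unbound.2 he)

theorem baseLevels_scons_of_boundTypes_eq_nil {B : List (Entry (envCons σ E))}
    (hB : boundTypes B = []) : BaseLevels (scons d ℓ) W B ↔ BaseLevels ℓ W (unbound B) :=
  baseLevels_scons.trans <| and_iff_left fun o _ he =>
    absurd (hB ▸ mem_boundTypes.2 ⟨o, he⟩) List.not_mem_nil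

namespace Synth

/-- Under the instantiation `X`, any boxes that make the synthesized data fit give a leveled
typing. -/
def Sound (X : ℕ → ℕ) (M : Term) (r : Synth E σ) : Prop :=
  ∀ (W : List Slice) (T : ℕ → Formula ι) (ℓ : ℕ → ℕ), (∀ sl ∈ W, Slice.Allowed r.cpts sl) →
    BaseLevels ℓ W r.base → r.Fits X W T →
      ∃ d, Leveled ℓ T d M (Formula.bang^[W.length] (r.ty.inst X))

theorem Sound.boxed {r : Synth E σ} (h : r.Sound X M) (N : Term) : (r.boxed N).Sound X M := by
  intro W T ℓ hW hℓ hF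
  rw [inst_boxed_ty, ← Function.iterate_add_apply, ← List.length_append]
  refine h _ T ℓ (List.forall_mem_append.2 ⟨hW, fun sl => allowed_of_mem_addedBoxes⟩)
    (fun e he => ?_) (fits_boxed.1 hF)
  rw [List.countP_append]
  exact ((forall_mem_box_base (p := fun x o => ℓ x ≤ W.countP fun sl => !sl.hasOcc o) ..).1
    hℓ e he).trans (Nat.le_add_right ..)

theorem sound_synthVar (E : ℕ → STy ι) (x n : ℕ) : (synthVar E x n).Sound X (.var x) := by
  intro W T ℓ hW _ hF
  have hlen : W.countP (fun sl => !sl.hasOcc (process (E x) n).2) = W.length :=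
    List.countP_eq_length.2 fun sl hsl => by
      obtain rfl := (hW sl hsl).resolve_left List.not_mem_nil
      rfl
  have hx : Formula.bang^[W.length] ((synthVar E x n).ty.inst X) = T x :=
    hlen ▸ hF.2 _ (List.mem_singleton_self _)
  exact ⟨W.length, .var_of_eq hx⟩

section Lam

variable {s : Synth (envCons σ E) τ}

theorem map_var_unbound_base (hfv : s.base.map Entry.var = M.fvs) :
    (unbound s.base).map Entry.var = (Term.lam M).fvs := by
  rw [map_var_unbound, hfv]
  rfl

theorem count_zero_fvs (hfv : s.base.map Entry.var = M.fvs) :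
    M.fvs.count 0 = (boundTypes s.base).length := by
  rw [length_boundTypes, hfv]

theorem Sound.lamOccurs {Θ : GTy σ} {Θs : List (GTy σ)} (h : s.Sound X M) (hs : s.InRange n)
    (hfv : s.base.map Entry.var = M.fvs) (hb : boundTypes s.base = Θ :: Θs) :
    (s.lamOccurs Θ Θs).Sound X (.lam M) := by
  intro W T ℓ hW hℓ hF
  obtain ⟨hF, hbang⟩ := (fits_lamOccurs hs hb hW).1 hF
  obtain ⟨d, hd⟩ := h W _ (scons W.length ℓ) (fun sl hsl => (allowed_keptSlices.1 (hW sl hsl)).1)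
    (baseLevels_scons.2 ⟨hℓ, fun _ _ ho => (countP_not_hasOcc_bound hW ho).ge⟩) hF
  refine ⟨W.length, .lam (map_var_unbound_base hfv ▸ hℓ.le_length) (fun hcount => hbang ?_) hd⟩
  rintro rfl
  simp [count_zero_fvs hfv, hb] at hcount

theorem Sound.lamNotApp (h : s.Sound X M) (hfv : s.base.map Entry.var = M.fvs)
    (hb : boundTypes s.base = []) : s.lamNotApp.Sound X (.lam M) := by
  intro W T ℓ hW hℓ hF
  obtain ⟨d, hd⟩ := h W _ (scons W.length ℓ) hW
    ((baseLevels_scons_of_boundTypes_eq_nil hb).2 hℓ)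
    ((fits_lamNotApp hb (Formula.bang^[W.length] (s.dummyType.1.inst X))).1 hF)
  exact ⟨W.length, .lam (map_var_unbound_base hfv ▸ hℓ.le_length)
    (fun hcount => by simp [count_zero_fvs hfv, hb] at hcount) hd⟩

theorem Sound.lamApp (h : s.Sound X M) (hs : s.InRange n)
    (hfv : s.base.map Entry.var = M.fvs) (hb : boundTypes s.base = []) :
    s.lamApp.Sound X (.lam M) := by
  intro W T ℓ hW hℓ hF
  change ∀ sl ∈ W, Slice.Allowed (s.marked true (s.dummyType.2 + 1)) sl at hW
  obtain ⟨hF, hty⟩ :=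
    (fits_lamApp hs hb hW (Formula.bang^[W.length] (s.dummyType.1.inst X))).1 hF
  have hbody : BaseLevels (scons W.length ℓ) (unmarked (s.dummyType.2 + 1) W) s.base := by
    rw [baseLevels_scons_of_boundTypes_eq_nil hb]
    intro e he
    rw [hs.countP_not_hasOcc_unmarked (next_le_dummyType.trans (Nat.le_succ _)) hW
      (List.mem_map_of_mem (mem_unbound.1 he))]
    exact hℓ e he
  obtain ⟨d, hd⟩ := h _ _ _ (allowed_of_mem_unmarked hW) hbody hF
  rw [hty] at hd
  exact ⟨W.length, .lam (map_var_unbound_base hfv ▸ hℓ.le_length)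
    (fun hcount => by simp [count_zero_fvs hfv, hb] at hcount) hd⟩

theorem Sound.synthLam {r : Synth (envCons σ E) τ} (h : r.Sound X M) (hr : r.InRange n)
    (hfv : r.base.map Entry.var = M.fvs) : (synthLam M r).Sound X (.lam M) := by
  have hfv' : (r.boxed M).base.map Entry.var = M.fvs := (map_var_boxed_base M r).trans hfv
  cases hb : boundTypes (r.boxed M).base with
  | cons Θ Θs =>
    exact synthLam_eq_lamOccurs hb ▸ (h.boxed M).lamOccurs (hr.boxed M) hfv' hb
  | nil =>
    cases hM : M.isApp with
    | true => exact synthLam_eq_lamApp hb hM ▸ (h.boxed M).lamApp (hr.boxed M) hfv' hb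
    | false => exact synthLam_eq_lamNotApp hb hM ▸ (h.boxed M).lamNotApp hfv' hb

end Lam

theorem SlicePairs.baseLevels_head {p q : Bool} {r : Synth E (.arr σ τ)} {s : Synth E σ}
    {Z : List (Slice × Slice)} (hZ : SlicePairs p q r s Z) (hr : r.InRange n)
    (hs : s.InRange r.next) (h : BaseLevels ℓ (Z.map fun z => z.1 ++ z.2) r.base) :
    BaseLevels ℓ (unmarked (appKey q r s) (Z.map Prod.fst)) r.base := by
  intro e he
  rw [hr.countP_not_hasOcc_unmarked (hs.le.trans next_lt_appKey.le) hZ.head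
    (List.mem_map_of_mem he)]
  refine (h e he).trans_eq ?_
  rw [List.countP_map, List.countP_map]
  refine List.countP_congr fun z hz => ?_
  simp only [Function.comp_apply, Slice.hasOcc_append,
    (hs.marked le_rfl (hZ z hz).2).hasOcc_eq_false (.inl (hr.occ e he).2), Bool.or_false]

theorem SlicePairs.baseLevels_argument {p q : Bool} {r : Synth E (.arr σ τ)} {s : Synth E σ}
    {Z : List (Slice × Slice)} (hZ : SlicePairs p q r s Z) (hr : r.InRange n)
    (hs : s.InRange r.next) (h : BaseLevels ℓ (Z.map fun z => z.1 ++ z.2) s.base) :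
    BaseLevels ℓ (unmarked s.next (Z.map Prod.snd)) s.base := by
  intro e he
  rw [hs.countP_not_hasOcc_unmarked le_rfl hZ.argument (List.mem_map_of_mem he)]
  refine (h e he).trans_eq ?_
  rw [List.countP_map, List.countP_map]
  refine List.countP_congr fun z hz => ?_
  simp only [Function.comp_apply, Slice.hasOcc_append,
    hr.marked_hasOcc_eq_false (hZ z hz).1 (hs.occ e he).1, Bool.false_or]

theorem Sound.app {p q : Bool} {r : Synth E (.arr σ τ)} {s : Synth E σ} (h₁ : r.Sound X M)
    (h₂ : s.Sound X N) (hr : r.InRange n) (hs : s.InRange r.next)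
    (hfv₁ : r.base.map Entry.var = M.fvs) (hfv₂ : s.base.map Entry.var = N.fvs) :
    (app p q r s).Sound X (.app M N) := by
  intro W T ℓ hW hℓ hF
  have hlevel : ∀ x ∈ (Term.app M N).fvs, ℓ x ≤ W.length := by
    rw [Term.fvs, ← hfv₁, ← hfv₂, ← List.map_append]
    exact hℓ.le_length
  obtain ⟨Z, hZ, rfl⟩ := exists_slicePairs hW
  obtain ⟨⟨hF₁, hF₂⟩, hty₁, hty₂⟩ := (fits_app hr hs hZ).1 hF
  obtain ⟨hℓ₁, hℓ₂⟩ := List.forall_mem_append.1 hℓ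
  obtain ⟨d₁, hd₁⟩ := h₁ _ T ℓ (allowed_of_mem_unmarked hZ.head) (hZ.baseLevels_head hr hs hℓ₁) hF₁
  obtain ⟨d₂, hd₂⟩ := h₂ _ T ℓ (allowed_of_mem_unmarked hZ.argument)
    (hZ.baseLevels_argument hr hs hℓ₂) hF₂
  rw [hty₁] at hd₁
  rw [hty₂] at hd₂
  rw [List.length_map] at hlevel ⊢
  exact ⟨Z.length, .app hlevel hd₁ hd₂⟩

end Synth

theorem sound_synth (der : SDer E M σ) (n : ℕ) : (synth der n).Sound X M := by
  induction der generalizing n with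
  | var E x => exact Synth.sound_synthVar E x n
  | lam der ih => exact (ih n).synthLam (inRange_synth der n) (map_var_base_synth der n)
  | @app E M N σ τ der₁ der₂ ih₁ ih₂ =>
    rw [synth, Synth.synthApp_eq_app]
    exact (ih₁ n).app ((ih₂ _).boxed N) (inRange_synth der₁ n) ((inRange_synth der₂ _).boxed N)
      (map_var_base_synth der₁ n) ((Synth.map_var_boxed_base N _).trans (map_var_base_synth der₂ _))

end

/-! ### From leveled typings to solutions of the constraints -/

section

variable {ι : Type*} {E : ℕ → STy ι} {σ τ : STy ι} {ℓ : ℕ → ℕ} {T : ℕ → Formula ι}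
  {A B C : Formula ι} {V W : List Slice} {M N : Term} {d k n x : ℕ} {p q : Bool}

theorem Formula.le_of_iterate_bang_eq {m n : ℕ} (hA : A.IsCore) (h : bang^[m] A = bang^[n] B) :
    n ≤ m := by
  obtain ⟨k, B₀, rfl, hB⟩ := B.exists_eq_iterate_bang
  rw [← Function.iterate_add_apply] at h
  exact (iterate_bang_inj hA hB h).1 ▸ Nat.le_add_right n k

namespace Synth

/-- The boxes `W`, listed from the outermost one to the innermost one, give the variables the types
`T` and the term the type `C` outside the boxes, for a suitable choice of the unknowns from `n` on,
and every occurrence of a variable `x` is inside the `ℓ x` outermost ones. -/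
structure RealizedBy (n : ℕ) (W : List Slice) (ℓ : ℕ → ℕ) (T : ℕ → Formula ι) (C : Formula ι)
    (r : Synth E σ) : Prop where
  allowed : ∀ sl ∈ W, Slice.Allowed r.cpts sl
  level_le : ∀ e ∈ r.base, ℓ e.var ≤ W.length
  hasOcc_take : ∀ e ∈ r.base, ∀ sl ∈ W.take (ℓ e.var), sl.hasOcc e.occ = false
  choosable : Choosable n r.next fun X =>
    r.Fits X W T ∧ Formula.bang^[W.length] (r.ty.inst X) = C

/-- Only the outer boxes need to be prescribed: boxing can add the inner ones. -/
theorem RealizedBy.boxed {r : Synth E σ} (h : r.RealizedBy n W ℓ T C) (hr : r.InRange n)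
    (hvar : M.isVar = true → W.length = d) (hd : ∀ e ∈ r.base, ℓ e.var ≤ d) :
    (r.boxed M).RealizedBy n (W.take d) ℓ T C where
  allowed sl hsl := h.allowed sl (List.mem_of_mem_take hsl)
  level_le := (forall_mem_box_base (p := fun x _ => ℓ x ≤ (W.take d).length) ..).2 fun e he =>
    List.length_take ▸ le_min (hd e he) (h.level_le e he)
  hasOcc_take := (forall_mem_box_base
    (p := fun x o => ∀ sl ∈ (W.take d).take (ℓ x), Slice.hasOcc sl o = false) ..).2
    fun e he sl hsl => h.hasOcc_take e he sl <| by
      rw [List.take_take, Nat.min_eq_left (hd e he)] at hsl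
      exact hsl
  choosable := by
    have hadded : Choosable r.next (r.boxed M).next fun X => (r.added X M).Perm (W.drop d) :=
      choosable_addedBoxes_perm M r.base r.ty r.cpts r.rows r.next
        (fun sl hsl => h.allowed sl (List.mem_of_mem_drop hsl))
        fun hM => by rw [← hvar hM, List.drop_length]
    refine (h.choosable.and hadded hr.le (le_boxed_next M r)).imp ?_
    rintro X ⟨⟨hF, hty⟩, hperm⟩
    have hW : (W.take d ++ r.added X M).Perm W := by
      simpa only [List.take_append_drop] using hperm.append_left (W.take d)
    refine ⟨fits_boxed.2 (hF.perm hW.symm), ?_⟩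
    rw [inst_boxed_ty, ← Function.iterate_add_apply, ← List.length_append, hW.length_eq, hty]

/-- The boxes `V`, completed to `d` boxes by inner ones through the critical point that joins row
`k` to all free variable occurrences. -/
def padded (d k : ℕ) (V : List Slice) (r : Synth E σ) : List Slice :=
  V ++ List.replicate (d - V.length) (Slice.point k (occurrences r.base))

section Padded

variable {r : Synth E σ}

theorem length_padded (hV : V.length ≤ d) : (r.padded d k V).length = d := by
  rw [padded, List.length_append, List.length_replicate, Nat.add_sub_cancel' hV]

theorem take_padded {j : ℕ} (hj : j ≤ V.length) : (r.padded d k V).take j = V.take j :=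
  List.take_append_of_le_length hj

theorem allowed_padded (hV : ∀ sl ∈ V, Slice.Allowed r.cpts sl)
    (hp : p = false → d ≤ V.length) : ∀ sl ∈ r.padded d k V, Slice.Allowed (r.marked p k) sl := by
  refine List.forall_mem_append.2 ⟨fun sl hsl => allowed_marked.2 (.inl (hV sl hsl)), ?_⟩
  intro sl hsl
  obtain ⟨hlt, rfl⟩ := List.mem_replicate.1 hsl
  refine allowed_marked.2 (.inr ⟨?_, rfl⟩)
  by_contra hp'
  exact hlt (Nat.sub_eq_zero_of_le (hp (Bool.not_eq_true _ ▸ hp')))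

theorem InRange.unmarked_padded (hr : r.InRange n) (hk : r.next ≤ k)
    (hV : ∀ sl ∈ V, Slice.Allowed r.cpts sl) : unmarked k (r.padded d k V) = V := by
  have hV' : V.filter (fun sl => !sl.hasRow k) = V :=
    List.filter_eq_self.2 fun sl hsl => by
      simp [(hr.allowed (hV sl hsl)).hasRow_eq_false (.inr hk)]
  simp [unmarked, padded, hV', Slice.hasRow_point]

end Padded

section Lam

variable {s : Synth (envCons σ E) τ}

theorem RealizedBy.lamOccurs {Θ : GTy σ} {Θs : List (GTy σ)}
    (h : s.RealizedBy n V (scons d ℓ) (scons (Formula.bang^[d] A) T) (Formula.bang^[d] B))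
    (hs : s.InRange n) (hV : V.length = d) (hb : boundTypes s.base = Θ :: Θs)
    (hbang : Θs ≠ [] → ∃ A', A = .bang A') :
    (s.lamOccurs Θ Θs).RealizedBy n V ℓ T (Formula.bang^[d] (.lolli A B)) := by
  subst hV
  have hkept : ∀ sl ∈ V, Slice.Allowed s.keptSlices sl := by
    refine fun sl hsl => allowed_keptSlices.2 ⟨h.allowed sl hsl, fun o ho => ?_⟩
    obtain ⟨Θ', ho⟩ := mem_boundOccs.1 ho
    exact h.hasOcc_take _ ho sl (List.take_length.symm ▸ hsl)
  refine ⟨hkept, fun e he => h.level_le _ (mem_unbound.1 he),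
    fun e he => h.hasOcc_take _ (mem_unbound.1 he),
    (h.choosable.mono_right (Nat.le_add_right ..)).imp ?_⟩
  rintro X ⟨hF, hty⟩
  have hΘ : Θ.inst X = A := by
    obtain ⟨o, ho⟩ := mem_boundTypes.1 (hb ▸ List.mem_cons_self)
    have heq := (baseFits_scons.1 hF.2).2 o Θ ho
    rw [countP_not_hasOcc_bound hkept ho] at heq
    exact Formula.iterate_bang_injective _ heq
  rw [fits_lamOccurs hs hb hkept, hΘ]
  refine ⟨⟨hF, hbang⟩, ?_⟩
  rw [← hΘ, ← Formula.iterate_bang_injective _ hty]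
  rfl

theorem RealizedBy.lamNotApp
    (h : s.RealizedBy n V (scons d ℓ) (scons (Formula.bang^[d] A) T) (Formula.bang^[d] B))
    (hs : s.InRange n) (hV : V.length = d) (hb : boundTypes s.base = []) (hA : A.erase = σ) :
    s.lamNotApp.RealizedBy n V ℓ T (Formula.bang^[d] (.lolli A B)) := by
  subst hV
  refine ⟨h.allowed, fun e he => h.level_le _ (mem_unbound.1 he),
    fun e he => h.hasOcc_take _ (mem_unbound.1 he),
    (h.choosable.and (choosable_process_inst_eq A hA _) hs.le next_le_dummyType).imp ?_⟩
  rintro X ⟨⟨hF, hty⟩, hdummy⟩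
  refine ⟨(fits_lamNotApp hb _).2 hF, ?_⟩
  rw [← hdummy, ← Formula.iterate_bang_injective _ hty]
  rfl

theorem RealizedBy.lamApp
    (h : s.RealizedBy n V (scons d ℓ) (scons (Formula.bang^[d] A) T) (Formula.bang^[d] B))
    (hs : s.InRange n) (hV : V.length ≤ d) (hb : boundTypes s.base = []) (hA : A.erase = σ) :
    s.lamApp.RealizedBy n (s.padded d (s.dummyType.2 + 1) V) ℓ T
      (Formula.bang^[d] (.lolli A B)) := by
  obtain ⟨m, B₀, rfl, hB₀⟩ := B.exists_eq_iterate_bang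
  have hle : s.next ≤ s.dummyType.2 := next_le_dummyType
  have hallowed : ∀ sl ∈ s.padded d (s.dummyType.2 + 1) V,
      Slice.Allowed (s.marked true (s.dummyType.2 + 1)) sl := allowed_padded h.allowed nofun
  refine ⟨hallowed, fun e he => ?_, fun e he => ?_,
    (((h.choosable.and (choosable_process_inst_eq A hA _) hs.le hle).and
      (Choosable.apply_eq s.dummyType.2 m) (hs.le.trans hle) (Nat.le_succ _)).mono_right
        (Nat.le_succ _)).imp ?_⟩
  · exact (h.level_le _ (mem_unbound.1 he)).trans (hV.trans_eq (length_padded hV).symm)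
  · rw [take_padded (show ℓ e.var ≤ V.length from h.level_le _ (mem_unbound.1 he))]
    exact h.hasOcc_take _ (mem_unbound.1 he)
  rintro X ⟨⟨⟨hF, hty⟩, hdummy⟩, hm⟩
  have hcore : s.ty.core X = B₀ := by
    rw [GTy.inst_eq, ← Function.iterate_add_apply, ← Function.iterate_add_apply] at hty
    exact (Formula.iterate_bang_inj (GTy.isCore_core _) hB₀ hty).2
  have hout : (s.ty.setOuter [s.dummyType.2]).inst X = Formula.bang^[m] B₀ := by
    rw [GTy.inst_eq, GTy.core_setOuter, GTy.outer_setOuter, hcore]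
    simp [hm]
  rw [fits_lamApp hs hb hallowed (Formula.bang^[d] A),
    hs.unmarked_padded (hle.trans (Nat.le_succ _)) h.allowed, length_padded hV, hout]
  refine ⟨⟨hF, hty⟩, ?_⟩
  rw [← hdummy, ← hout]
  rfl

theorem RealizedBy.exists_synthLam {r : Synth (envCons σ E) τ}
    (h : r.RealizedBy n W (scons d ℓ) (scons (Formula.bang^[d] A) T) (Formula.bang^[d] B))
    (hr : r.InRange n) (hfv : r.base.map Entry.var = M.fvs)
    (happ : M.isApp = false → d ≤ W.length) (hvar : M.isVar = true → W.length = d)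
    (hℓ : ∀ x ∈ (Term.lam M).fvs, ℓ x ≤ d) (hbang : 2 ≤ M.fvs.count 0 → ∃ A', A = .bang A')
    (hA : A.erase = σ) :
    ∃ V, V.length = d ∧ (synthLam M r).RealizedBy n V ℓ T (Formula.bang^[d] (.lolli A B)) := by
  have hd : ∀ x ∈ M.fvs, scons d ℓ x ≤ d := forall_mem_of_scons le_rfl hℓ
  have hs := h.boxed (M := M) hr hvar (List.forall_mem_map.1 (hfv ▸ hd))
  have hfv' : (r.boxed M).base.map Entry.var = M.fvs := (map_var_boxed_base M r).trans hfv
  have hle : (W.take d).length ≤ d := List.length_take_le ..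
  cases hb : boundTypes (r.boxed M).base with
  | cons Θ Θs =>
    obtain ⟨o, ho⟩ := mem_boundTypes.1 (hb ▸ List.mem_cons_self)
    have hd := hle.antisymm (hs.level_le _ ho)
    refine synthLam_eq_lamOccurs hb ▸
      ⟨_, hd, hs.lamOccurs (hr.boxed M) hd hb fun hΘs => hbang ?_⟩
    rw [count_zero_fvs hfv', hb]
    exact Nat.succ_le_succ (List.length_pos_iff.2 hΘs)
  | nil =>
    cases hM : M.isApp with
    | true =>
      exact synthLam_eq_lamApp hb hM ▸
        ⟨_, length_padded hle, hs.lamApp (hr.boxed M) hle hb hA⟩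
    | false =>
      have hd : (W.take d).length = d := List.length_take_of_le (happ hM)
      exact synthLam_eq_lamNotApp hb hM ▸ ⟨_, hd, hs.lamNotApp (hr.boxed M) hd hb hA⟩

end Lam

section App

theorem RealizedBy.length_le {r : Synth E σ} (h : r.RealizedBy n W ℓ T (Formula.bang^[d] C))
    (hC : C.IsCore) : W.length ≤ d := by
  obtain ⟨X, -, hty⟩ := h.choosable.exists_apply
  exact Formula.le_of_iterate_bang_eq hC hty.symm

variable {r : Synth E (.arr σ τ)} {s : Synth E σ} {Z : List (Slice × Slice)}

theorem RealizedBy.choosable_app (h₁ : r.RealizedBy n V ℓ T (Formula.bang^[d] (.lolli A B)))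
    (h₂ : s.RealizedBy r.next W ℓ T (Formula.bang^[d] A)) (hr : r.InRange n)
    (hs : s.InRange r.next) (hZ : SlicePairs p q r s Z) (hlen : Z.length = d)
    (hV : unmarked (appKey q r s) (Z.map Prod.fst) = V)
    (hW : unmarked s.next (Z.map Prod.snd) = W) :
    Choosable n (app p q r s).next fun X =>
      (app p q r s).Fits X (Z.map fun z => z.1 ++ z.2) T ∧
        Formula.bang^[d] ((app p q r s).ty.inst X) = Formula.bang^[d] B := by
  have hle : s.next ≤ (app p q r s).next := next_lt_appKey.le.trans (Nat.le_succ _)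
  refine ((h₁.choosable.and h₂.choosable hr.le hs.le).mono_right hle).imp ?_
  rintro X ⟨⟨hF₁, hty₁⟩, hF₂, hty₂⟩
  have hcore : r.ty.core X = .lolli A B := by
    rw [GTy.inst_eq, ← Function.iterate_add_apply] at hty₁
    exact (Formula.iterate_bang_inj (B := .lolli A B) (GTy.isCore_core _) trivial hty₁).2
  rw [GTy.core_eq_lolli] at hcore
  obtain ⟨hdom, hcod⟩ := Formula.lolli.inj hcore
  rw [fits_app hr hs hZ, hV, hW, hlen, hdom, hcod]
  exact ⟨⟨⟨hF₁, hF₂⟩, hty₁, hty₂⟩, congrArg _ hcod⟩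

theorem exists_append_of_mem_take_zip {P Q : List Slice} {j : ℕ} {sl : Slice}
    (h : sl ∈ ((P.zip Q).map fun z => z.1 ++ z.2).take j) :
    ∃ t ∈ P.take j, ∃ u ∈ Q.take j, sl = t ++ u := by
  rw [← List.map_take, List.zip, List.take_zipWith] at h
  obtain ⟨z, hz, rfl⟩ := List.mem_map.1 h
  exact ⟨z.1, (List.of_mem_zip hz).1, z.2, (List.of_mem_zip hz).2, rfl⟩

theorem RealizedBy.app (h₁ : r.RealizedBy n V ℓ T (Formula.bang^[d] (.lolli A B)))
    (h₂ : s.RealizedBy r.next W ℓ T (Formula.bang^[d] A)) (hr : r.InRange n)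
    (hs : s.InRange r.next) (hW : W.length ≤ d) (hp : p = false → d ≤ V.length)
    (hq : q = false → d ≤ W.length) :
    ((app p q r s).RealizedBy n (((r.padded d (appKey q r s) V).zip (s.padded d s.next W)).map
      fun z => z.1 ++ z.2) ℓ T (Formula.bang^[d] B)) := by
  have hV : V.length ≤ d := h₁.length_le trivial
  have hP := length_padded (k := appKey q r s) (r := r) hV
  have hQ := length_padded (k := s.next) (r := s) hW
  have hPa : ∀ sl ∈ r.padded d (appKey q r s) V, Slice.Allowed (r.marked p (appKey q r s)) sl :=
    allowed_padded h₁.allowed hp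
  have hQa : ∀ sl ∈ s.padded d s.next W, Slice.Allowed (s.marked q s.next) sl :=
    allowed_padded h₂.allowed hq
  have hZ : SlicePairs p q r s ((r.padded d (appKey q r s) V).zip (s.padded d s.next W)) :=
    fun z hz => ⟨hPa _ (List.of_mem_zip hz).1, hQa _ (List.of_mem_zip hz).2⟩
  have hlen : ((r.padded d (appKey q r s) V).zip (s.padded d s.next W)).length = d := by
    rw [List.length_zip, hP, hQ, Nat.min_self]
  refine ⟨List.forall_mem_map.2 fun z hz =>
    Slice.allowed_productUnion.2 ⟨z.1, z.2, (hZ z hz).1, (hZ z hz).2, rfl⟩, ?_, ?_, ?_⟩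
  · rw [List.length_map, hlen]
    exact List.forall_mem_append.2
      ⟨fun e he => (h₁.level_le e he).trans hV, fun e he => (h₂.level_le e he).trans hW⟩
  · intro e he sl hsl
    obtain ⟨t, ht, u, hu, rfl⟩ := exists_append_of_mem_take_zip hsl
    rw [Slice.hasOcc_append, Bool.or_eq_false_iff]
    rcases List.mem_append.1 he with he | he
    · have hu := hs.marked le_rfl (hQa u (List.mem_of_mem_take hu))
      rw [take_padded (h₁.level_le e he)] at ht
      exact ⟨h₁.hasOcc_take e he t ht, hu.hasOcc_eq_false (.inl (hr.occ e he).2)⟩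
    · have ht := hPa t (List.mem_of_mem_take ht)
      rw [take_padded (h₂.level_le e he)] at hu
      exact ⟨hr.marked_hasOcc_eq_false ht (hs.occ e he).1, h₂.hasOcc_take e he u hu⟩
  · rw [List.length_map, hlen]
    refine h₁.choosable_app h₂ hr hs hZ hlen ?_ ?_
    · rw [List.map_fst_zip (hP.trans hQ.symm).le,
        hr.unmarked_padded (hs.le.trans next_lt_appKey.le) h₁.allowed]
    · rw [List.map_snd_zip (hQ.trans hP.symm).le, hs.unmarked_padded le_rfl h₂.allowed]

theorem RealizedBy.exists_synthApp {s : Synth E σ}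
    (h₁ : r.RealizedBy n V ℓ T (Formula.bang^[d] (.lolli A B)))
    (h₂ : s.RealizedBy r.next W ℓ T (Formula.bang^[d] A)) (hr : r.InRange n)
    (hs : s.InRange r.next) (hfv : s.base.map Entry.var = N.fvs)
    (hM : M.isApp = false → d ≤ V.length) (hN : N.isApp = false → d ≤ W.length)
    (hvar : N.isVar = true → W.length = d) (hℓ : ∀ x ∈ N.fvs, ℓ x ≤ d) :
    ∃ V', (synthApp M N r s).RealizedBy n V' ℓ T (Formula.bang^[d] B) := by
  have h₂' := h₂.boxed (M := N) hs hvar (List.forall_mem_map.1 (hfv ▸ hℓ))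
  rw [synthApp_eq_app]
  refine ⟨_, h₁.app h₂' hr (hs.boxed N) (List.length_take_le ..) hM fun h => ?_⟩
  exact (List.length_take_of_le (hN h)).ge

end App

theorem realizedBy_synthVar (hB : B.erase = E x) (hT : T x = Formula.bang^[d] B)
    (hℓ : ℓ x ≤ d) :
    (synthVar E x n).RealizedBy n (List.replicate d []) ℓ T (Formula.bang^[d] B) where
  allowed _ hsl := .inr (List.eq_of_mem_replicate hsl)
  level_le := List.forall_mem_singleton.2 (List.length_replicate.symm ▸ hℓ)
  hasOcc_take e _ sl hsl := by
    rw [List.eq_of_mem_replicate (List.mem_of_mem_take hsl)]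
    rfl
  choosable := by
    refine ((choosable_process_inst_eq B hB n).mono_right (Nat.le_succ _)).imp fun X hX => ?_
    refine ⟨⟨nofun, List.forall_mem_singleton.2 ?_⟩, ?_⟩
    · rw [hX, List.countP_replicate, hT]
      rfl
    · rw [List.length_replicate]
      exact congrArg _ hX

end Synth

/-- Boxing puts no further box around a variable, and only an application has a critical point for
further boxes around itself: hence the conditions on the length of `W`. -/
theorem Leveled.exists_realizedBy (h : Leveled ℓ T d M C) (hE : ∀ x, E x = (T x).erase)
    (hσ : C.erase = σ) :
    ∃ der : SDer E M σ, ∀ (p : ℕ) (B : Formula ι), C = Formula.bang^[p] B →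
      (∀ x ∈ M.fvs, ℓ x ≤ p) → ∀ n : ℕ, ∃ W : List Slice,
        (M.isVar = true → W.length = p) ∧ (M.isApp = false → p ≤ W.length) ∧
          (synth der n).RealizedBy n W ℓ T C := by
  induction h generalizing E σ with
  | var ℓ T _ x =>
    obtain rfl : E x = σ := (hE x).trans hσ
    refine ⟨.var E x, fun p B hC hℓ n => ⟨List.replicate p [], fun _ => List.length_replicate,
      fun _ => List.length_replicate.ge, ?_⟩⟩
    rw [hC]
    refine Synth.realizedBy_synthVar ?_ hC (hℓ x (List.mem_singleton_self x))
    rw [hE, hC, Formula.erase_iterate_bang]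
  | @lam ℓ T d _ M A B hℓ hbang _ ih =>
    rw [Formula.erase_iterate_bang] at hσ
    obtain rfl : STy.arr A.erase B.erase = σ := hσ
    have hE' (x : ℕ) : envCons A.erase E x = (scons (Formula.bang^[d] A) T x).erase := by
      cases x with
      | zero => exact (Formula.erase_iterate_bang ..).symm
      | succ x => exact hE x
    obtain ⟨der, hder⟩ := ih hE' (Formula.erase_iterate_bang ..)
    refine ⟨.lam der, fun p B' hC _ n => ?_⟩
    obtain ⟨W, hvar, happ, hW⟩ := hder d B rfl (forall_mem_of_scons le_rfl hℓ) n
    obtain ⟨V, hd, hV⟩ := hW.exists_synthLam (inRange_synth der n) (map_var_base_synth der n)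
      happ hvar hℓ hbang rfl
    exact ⟨V, nofun, fun _ => hd ▸ Formula.le_of_iterate_bang_eq (A := .lolli A B) trivial hC, hV⟩
  | @app ℓ T d _ _ M N A B hℓ _ _ ih₁ ih₂ =>
    rw [Formula.erase_iterate_bang] at hσ
    subst hσ
    obtain ⟨der₁, hder₁⟩ := ih₁ hE (Formula.erase_iterate_bang ..)
    obtain ⟨der₂, hder₂⟩ := ih₂ hE (Formula.erase_iterate_bang ..)
    refine ⟨.app der₁ der₂, fun p B' _ _ n => ?_⟩
    have hr := inRange_synth der₁ n
    have hs := inRange_synth der₂ (synth der₁ n).next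
    obtain ⟨V, -, hM, hV⟩ := hder₁ d _ rfl (fun x hx => hℓ x (List.mem_append_left _ hx)) n
    obtain ⟨W, hvar, hN, hW⟩ :=
      hder₂ d _ rfl (fun x hx => hℓ x (List.mem_append_right _ hx)) (synth der₁ n).next
    obtain ⟨V', hV'⟩ := hV.exists_synthApp hW hr hs (map_var_base_synth der₂ _) hM hN hvar
      fun x hx => hℓ x (List.mem_append_right _ hx)
    exact ⟨V', nofun, nofun, hV'⟩

end

/-! ### The algorithm -/

section

variable {ι : Type*} {E : ℕ → STy ι} {σ : STy ι} {M : Term} {Γ : Ctx ι} {X : ℕ → ℕ}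

theorem mem_typesOf {B : List (Entry E)} {x : ℕ} {Θ : GTy (E x)} :
    Θ ∈ typesOf B x ↔ ∃ o, (⟨x, o, Θ⟩ : Entry E) ∈ B := by
  simp only [typesOf, List.mem_filterMap]
  constructor
  · rintro ⟨⟨y, o, Θ'⟩, he, h⟩
    split_ifs at h with hy
    cases hy
    cases h
    exact ⟨o, he⟩
  · rintro ⟨o, h⟩
    exact ⟨_, h, by simp⟩

theorem length_typesOf (B : List (Entry E)) (x : ℕ) :
    (typesOf B x).length = (B.map Entry.var).count x := by
  induction B with
  | nil => rfl
  | cons e B ih =>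
    rw [typesOf, List.map_cons, List.count_cons, ← ih]
    by_cases h : e.var = x
    · rw [List.filterMap_cons_some (b := h ▸ e.ty) (by simp [h])]
      simp [h, typesOf]
    · rw [List.filterMap_cons_none (by simp [h])]
      simp [h, typesOf]

theorem baseFits_nil_iff {B : List (Entry E)} {T : ℕ → Formula ι} :
    BaseFits X [] B T ↔
      ∀ x ∈ B.map Entry.var, ∀ Θ ∈ typesOf B x, Θ.inst X = T x := by
  constructor
  · intro h x _ Θ hΘ
    obtain ⟨o, ho⟩ := mem_typesOf.1 hΘ
    exact h _ ho
  · rintro h ⟨x, o, Θ⟩ he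
    exact h x (List.mem_map_of_mem he) Θ (mem_typesOf.2 ⟨o, he⟩)

theorem solves_contraction_and_head?_iff {l : List (GTy σ)} (hl : l ≠ []) {o : Option (Formula ι)} :
    (Solves X (contraction l) ∧ ∀ Θ ∈ l.head?, o = some (Θ.inst X)) ↔
      ∃ A, o = some A ∧ (2 ≤ l.length → ∃ A', A = .bang A') ∧ ∀ Θ ∈ l, Θ.inst X = A := by
  obtain ⟨Θ, l, rfl⟩ := List.exists_cons_of_ne_nil hl
  have hlen : 2 ≤ (Θ :: l).length ↔ l ≠ [] := by
    rw [List.length_cons, Nat.succ_le_succ_iff, Nat.succ_le_iff, List.length_pos_iff]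
  rw [solves_contraction, hlen]
  constructor
  · rintro ⟨⟨hbang, hl⟩, ho⟩
    exact ⟨_, ho Θ rfl, hbang, List.forall_mem_cons.2 ⟨rfl, hl⟩⟩
  · rintro ⟨A, ho, hbang, hl⟩
    obtain ⟨rfl, hl⟩ := List.forall_mem_cons.1 hl
    refine ⟨⟨hbang, hl⟩, fun Θ' hΘ' => ?_⟩
    cases hΘ'
    exact ho

theorem map_var_boxed_synth (der : SDer E M σ) :
    ((synth der 0).boxed M).base.map Entry.var = M.fvs :=
  (Synth.map_var_boxed_base M _).trans (map_var_base_synth der 0)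

theorem solves_constraints_algorithm (der : SDer E M σ) :
    Solves X (algorithm der).constraints ↔ RowsHold X [] ((synth der 0).boxed M).rows ∧
      ∀ x ∈ M.fvs, Solves X (contraction (typesOf ((synth der 0).boxed M).base x)) := by
  rw [← map_var_boxed_synth der]
  change (∀ c ∈ ((synth der 0).boxed M).rows.map Row.lin ++ List.flatMap _ _, _) ↔ _
  rw [List.forall_mem_append, List.forall_mem_map]
  refine and_congr (forall₂_congr fun a _ => ?_) ?_
  · rw [List.countP_nil, Constraint.holdsSub_zero]
  · simp only [List.mem_flatMap, List.mem_dedup, Solves]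
    exact ⟨fun h x hx c hc => h c ⟨x, hx, hc⟩, fun h c ⟨x, hx, hc⟩ => h x hx c hc⟩

theorem instSubset_base_algorithm (der : SDer E M σ) :
    InstSubset X (algorithm der).base Γ ↔ ∀ x ∈ M.fvs,
      ∀ Θ ∈ (typesOf ((synth der 0).boxed M).base x).head?, Γ x = some (Θ.inst X) := by
  rw [← map_var_boxed_synth der]
  change (∀ p ∈ List.flatMap _ _, _) ↔ _
  simp only [List.mem_flatMap, List.mem_dedup, List.mem_map, List.take_one, Option.mem_toList]
  constructor
  · exact fun h x hx Θ hΘ => h ⟨x, Θ⟩ ⟨x, hx, Θ, hΘ, rfl⟩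
  · rintro h _ ⟨x, hx, Θ, hΘ, rfl⟩
    exact h x hx Θ hΘ

theorem solves_and_instSubset_algorithm_iff (der : SDer E M σ) :
    Solves X (algorithm der).constraints ∧ InstSubset X (algorithm der).base Γ ↔
      ∃ T, (∀ x ∈ M.fvs, Γ x = some (T x)) ∧
        (∀ x, 2 ≤ M.fvs.count x → ∃ A, T x = .bang A) ∧
        ((synth der 0).boxed M).Fits X [] T := by
  have hcount (x : ℕ) :
      (typesOf ((synth der 0).boxed M).base x).length = M.fvs.count x := by
    rw [length_typesOf, map_var_boxed_synth]
  have hne : ∀ x ∈ M.fvs, typesOf ((synth der 0).boxed M).base x ≠ [] := fun x hx =>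
    List.length_pos_iff.1 (hcount x ▸ List.count_pos_iff.2 hx)
  have hcontr := forall₂_congr fun x hx =>
    hcount x ▸ solves_contraction_and_head?_iff (X := X) (o := Γ x) (hne x hx)
  simp only [solves_constraints_algorithm, instSubset_base_algorithm, Synth.Fits,
    baseFits_nil_iff, map_var_boxed_synth, and_assoc]
  rw [← forall₂_and, hcontr]
  constructor
  · rintro ⟨hrows, h⟩
    have : Nonempty (Formula ι) := ⟨(algorithm der).ty.inst X⟩
    choose! T hT using h
    exact ⟨T, fun x hx => (hT x hx).1, fun x hx =>
      (hT x (List.count_pos_iff.1 (by omega))).2.1 hx, hrows, fun x hx => (hT x hx).2.2⟩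
  · rintro ⟨T, hT, hbang, hrows, hbase⟩
    exact ⟨hrows, fun x hx => ⟨T x, hT x hx, hbang x, hbase x hx⟩⟩

theorem LeveledTyping.of_algorithm (der : SDer E M σ)
    (hX : Solves X (algorithm der).constraints) (hΓ : InstSubset X (algorithm der).base Γ) :
    LeveledTyping Γ M ((algorithm der).ty.inst X) := by
  obtain ⟨T, hT, hbang, hF⟩ := (solves_and_instSubset_algorithm_iff der).1 ⟨hX, hΓ⟩
  refine ⟨fun x hx => ?_, T, ?_⟩
  · obtain ⟨A, hA⟩ := hbang x hx
    exact ⟨A, hA ▸ hT x (List.count_pos_iff.1 (by omega))⟩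
  · obtain ⟨d, hd⟩ := (sound_synth der 0).boxed M [] T (fun _ => 0) nofun
      (fun _ _ => Nat.zero_le _) hF
    exact ⟨d, hT, hd⟩

theorem LeveledTyping.exists_algorithm {C : Formula ι} (h : LeveledTyping Γ M C) :
    ∃ (E : ℕ → STy ι) (der : SDer E M C.erase) (X : ℕ → ℕ),
      Solves X (algorithm der).constraints ∧ InstSubset X (algorithm der).base Γ ∧
      C = (algorithm der).ty.inst X := by
  obtain ⟨hbang, T, d, hT, hL⟩ := h
  obtain ⟨der, hder⟩ := hL.exists_realizedBy (fun _ => rfl) rfl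
  obtain ⟨W, hvar, -, hW⟩ := hder 0 C rfl (fun _ _ => Nat.zero_le _) 0
  obtain ⟨X, hF, hC⟩ := (hW.boxed (inRange_synth der 0) hvar fun _ _ =>
    Nat.zero_le _).choosable.exists_apply
  have hsol := (solves_and_instSubset_algorithm_iff der).2 ⟨T, hT, fun x hx => ?_, hF⟩
  · exact ⟨_, der, X, hsol.1, hsol.2, hC.symm⟩
  · obtain ⟨A, hA⟩ := hbang x hx
    exact ⟨A, Option.some.inj ((hT x (List.count_pos_iff.1 (by omega))).symm.trans hA)⟩

end

end EAL

theorem mainTheorem1_general {ι : Type*} (M : EAL.Term) (Γ : EAL.Ctx ι) (hΓ : Γ.dom.Finite)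
    (C : EAL.Formula ι) :
    EAL.Typing Γ M C ↔
      ∃ (E : ℕ → EAL.STy ι) (d : EAL.SDer E M C.erase) (X : ℕ → ℕ),
        EAL.Solves X (EAL.algorithm d).constraints ∧
        EAL.InstSubset X (EAL.algorithm d).base Γ ∧
        C = (EAL.algorithm d).ty.inst X := by
  constructor
  · exact fun h => h.leveledTyping.exists_algorithm
  · rintro ⟨E, d, X, hX, hB, hC⟩
    rw [hC]
    exact (EAL.LeveledTyping.of_algorithm d hX hB).typing hΓ

theorem mainTheorem1 {ι : Type*} (M : EAL.Term) (hM : EAL.SimplyTypeable ι M)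
    (Γ : EAL.Ctx ι) (hΓ : Γ.dom.Finite) (C : EAL.Formula ι) :
    EAL.Typing Γ M C ↔
      ∃ (E : ℕ → EAL.STy ι) (d : EAL.SDer E M C.erase) (X : ℕ → ℕ),
        EAL.Solves X (EAL.algorithm d).constraints ∧
        EAL.InstSubset X (EAL.algorithm d).base Γ ∧
        C = (EAL.algorithm d).ty.inst X :=
  mainTheorem1_general M Γ hΓ C
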